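/- **Setting.** Let $(N,g,J)$ be a connected Kähler manifold of real dimension $2n$ with Kähler form $\omega(u,v)=g(Ju,v)$, and let $\Phi:\mathbb{T}^n\times N\to N$ be a smooth action of the torus $\mathbb{T}^n=\mathbb{R}^n/\mathbb{Z}^n$, $\mathrm{Lie}(\mathbb{T}^n)=\mathbb{R}^n$. Write $\Phi_a=\Phi(a,\cdot)$, let $N^\circ=\{q\in N : \Phi(a,q)=q\Rightarrow a=e\}$ be the set of points where the action is free, and let $\xi_N(q)=\frac{d}{dt}\big|_0\Phi([t\xi],q)$ be the fundamental vector field of $\xi\in\mathbb{R}^n$. A *momentum map* is a smooth $\mathbb{T}^n$-invariant map $\mu:N\to\mathbb{R}^n$ with $\omega(\xi_N,\cdot)=d\langle\mu,\xi\rangle$ for all $\xi$. Assume that $\Phi$ is effective, holomorphic and Hamiltonian (each $\Phi_a$ preserves $\omega$ and a momentum map exists), and that for every $\xi\in\mathbb{R}^n$ the vector field $-J\xi_N$ is complete, with flow $\varphi^\xi:\mathbb{R}\times N\to N$. **Terminology.** A connection is *flat* if its torsion and curvature vanish. Given a Riemannian metric $h$ and a linear connection $\nabla$ on a manifold $M$,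 the *dual connection* $\nabla^*$ is the one with $Xh(Y,Z)=h(\nabla_XY,Z)+h(Y,\nabla^*_XZ)$ for all vector fields; $(M,h,\nabla)$ is *dually flat* if $\nabla$ and $\nabla^*$ are flat. An *isomorphism* $(M,h,\nabla)\to(M',h',\nabla')$ of dually flat spaces is a diffeomorphism that pulls back $h'$, $\nabla'$, $\nabla'^*$ to $h$, $\nabla$, $\nabla^*$. A *global pair of dual coordinate systems* is a pair $(x,y)$ of coordinate systems on all of $M$ such that $x$ is $\nabla$-affine ($\nabla_{\partial/\partial x_i}\partial/\partial x_j=0$ for all $i,j$), $y$ is $\nabla^*$-affine and $h(\partial/\partial x_i,\partial/\partial y_j)=\delta_{ij}$. On $TM$, with $T_u(TM)\cong T_xM\oplus T_xM$ via $A\mapsto(\pi_*A,KA)$, where $\pi:TM\to M$ is the projection and $K$ the connector of $\nabla$, put $g^{TM}((v,w),(\bar v,\bar w))=h(v,\bar v)+h(w,\bar w)$ and $J^{TM}(v,w)=(-w,v)$. The effective, holomorphic and isometric action $\Phi$ is a *torification* of $(M,h,\nabla)$, $\dim M=n$, if there are a global frame $X_1,\dots,X_n$ of $\nabla$-parallel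 vector fields on $M$ and a holomorphic and isometric diffeomorphism $F:TM/\Gamma\to N^\circ$, where $\Gamma$ is the group of translations $u\mapsto u+\sum_i k_iX_i$, $k\in\mathbb{Z}^n$, and $TM/\Gamma$ carries the structure induced from $TM$, such that $F([u+\sum_i t_iX_i])=\Phi([t],F([u]))$ for all $t\in\mathbb{R}^n$, $u\in TM$. Let $\nabla^{\mathrm{flat}}$ be the canonical flat connection of $\mathbb{R}^n$ and of its open subsets, and let $x=(x_1,\dots,x_n)$ be the standard coordinates. **Theorem.** Fix $p\in N^\circ$ and for $x,u,v\in\mathbb{R}^n$ set $h_x(u,v)=g_{\varphi^x(1,p)}(u_N,v_N)$. Then: 1. $h$ is a Riemannian metric on $\mathbb{R}^n$ and $(\mathbb{R}^n,h,\nabla^{\mathrm{flat}})$ is dually flat. 2. $\Phi$ is a torification of $(\mathbb{R}^n,h,\nabla^{\mathrm{flat}})$. 3. Let $\mu$ be a momentum map. Then $\mu(N^\circ)$ is open in $\mathbb{R}^n$ and carries a unique Riemannian metric $k$ that makes $\mu:N^\circ\to\mu(N^\circ)$ a Riemannian submersion; let $\nabla^k$ be the dual connection of $\nabla^{\mathrm{flat}}$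 with respect to $k$. The canonical space $(\mu(N^\circ),k,\nabla^k)$ is dually flat, and there are coordinates $y=(y_1,\dots,y_n)$ on $\mathbb{R}^n$ such that (a) $(x,y)$ is a global pair of dual coordinate systems on $(\mathbb{R}^n,h,\nabla^{\mathrm{flat}})$, and (b) $-y$ is an isomorphism of dually flat spaces from $(\mathbb{R}^n,h,\nabla^{\mathrm{flat}})$ to $(\mu(N^\circ),k,\nabla^k)$. If there is no $C\in\mathbb{R}^n\setminus\{0\}$ with $\mu(N^\circ)=\mu(N^\circ)+C$ (which is the case if $N$ is compact), then $y$ satisfying (a) and (b) is unique. -/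

import Mathlib

open scoped Manifold ContDiff

noncomputable section

namespace KahlerToric

/-- The Euclidean space `ℝⁿ`. -/
abbrev Vec (n : ℕ) : Type := EuclideanSpace ℝ (Fin n)

/-! ### Geometry of open subsets of `ℝⁿ`

A vector field on an open set `U ⊆ ℝⁿ` is represented by a function `Vec n → Vec n` that is smooth
on `U`; only its values on `U` matter, and all identities are required on `U` only. Metrics and
connections on `U` are represented in the same way. -/

section Domain

variable {n : ℕ}

/-- Smooth vector fields on `U`. -/
def IsSmoothField (U : Set (Vec n)) (X : Vec n → Vec n) : Prop := ContDiffOn ℝ ∞ X U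

/-- Smooth Riemannian metrics on `U`. -/
structure IsRiemannianMetric (U : Set (Vec n)) (h : Vec n → Vec n →L[ℝ] Vec n →L[ℝ] ℝ) :
    Prop where
  smooth : ContDiffOn ℝ ∞ h U
  symm : ∀ x ∈ U, ∀ u v, h x u v = h x v u
  pos : ∀ x ∈ U, ∀ u, u ≠ 0 → 0 < h x u u

/-- Linear connections `(X, Y) ↦ ∇_X Y` on `U`. -/
structure IsLinearConnection (U : Set (Vec n))
    (D : (Vec n → Vec n) → (Vec n → Vec n) → (Vec n → Vec n)) : Prop where
  smooth : ∀ X Y, IsSmoothField U X → IsSmoothField U Y → IsSmoothField U (D X Y)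
  linear_left : ∀ (f g : Vec n → ℝ) (X Y Z : Vec n → Vec n),
    ContDiffOn ℝ ∞ f U → ContDiffOn ℝ ∞ g U →
    IsSmoothField U X → IsSmoothField U Y → IsSmoothField U Z →
    ∀ x ∈ U, D (fun z => f z • X z + g z • Y z) Z x = f x • D X Z x + g x • D Y Z x
  add_right : ∀ X Y Z : Vec n → Vec n,
    IsSmoothField U X → IsSmoothField U Y → IsSmoothField U Z →
    ∀ x ∈ U, D X (fun z => Y z + Z z) x = D X Y x + D X Z x
  leibniz : ∀ (f : Vec n → ℝ) (X Y : Vec n → Vec n),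
    ContDiffOn ℝ ∞ f U → IsSmoothField U X → IsSmoothField U Y →
    ∀ x ∈ U, D X (fun z => f z • Y z) x = fderiv ℝ f x (X x) • Y x + f x • D X Y x

/-- `∇` is flat on `U`: torsion and curvature vanish. -/
structure IsFlatConnection (U : Set (Vec n))
    (D : (Vec n → Vec n) → (Vec n → Vec n) → (Vec n → Vec n)) : Prop where
  torsion : ∀ X Y, IsSmoothField U X → IsSmoothField U Y →
    ∀ x ∈ U, D X Y x - D Y X x - VectorField.lieBracket ℝ X Y x = 0
  curvature : ∀ X Y Z, IsSmoothField U X → IsSmoothField U Y → IsSmoothField U Z →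
    ∀ x ∈ U, D X (D Y Z) x - D Y (D X Z) x - D (VectorField.lieBracket ℝ X Y) Z x = 0

/-- The canonical flat connection `∇^flat` of `ℝⁿ`, also used on open subsets. -/
def flatConnection (X Y : Vec n → Vec n) : Vec n → Vec n := fun x => fderiv ℝ Y x (X x)

/-- `(h, ∇, ∇*)` is a dualistic structure on `U`: `h` is a Riemannian metric and `∇*` is the dual
connection of `∇` with respect to `h` (which determines `∇*` uniquely on `U`). -/
structure IsDualistic (U : Set (Vec n)) (h : Vec n → Vec n →L[ℝ] Vec n →L[ℝ] ℝ)
    (D Dstar : (Vec n → Vec n) → (Vec n → Vec n) → (Vec n → Vec n)) : Prop where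
  isOpen : IsOpen U
  metric : IsRiemannianMetric U h
  connection : IsLinearConnection U D
  connection_dual : IsLinearConnection U Dstar
  dual : ∀ X Y Z, IsSmoothField U X → IsSmoothField U Y → IsSmoothField U Z →
    ∀ x ∈ U, fderiv ℝ (fun z => h z (Y z) (Z z)) x (X x)
      = h x (D X Y x) (Z x) + h x (Y x) (Dstar X Z x)

/-- The dualistic structure `(h, ∇, ∇*)` on `U` is dually flat. -/
structure IsDuallyFlat (U : Set (Vec n)) (h : Vec n → Vec n →L[ℝ] Vec n →L[ℝ] ℝ)
    (D Dstar : (Vec n → Vec n) → (Vec n → Vec n) → (Vec n → Vec n)) : Prop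
    extends IsDualistic U h D Dstar where
  flat : IsFlatConnection U D
  flat_dual : IsFlatConnection U Dstar

/-- `f` restricts to a diffeomorphism from `U` onto `U'`. -/
def IsDiffeoOn (U U' : Set (Vec n)) (f : Vec n → Vec n) : Prop :=
  ContDiffOn ℝ ∞ f U ∧ Set.MapsTo f U U' ∧
    ∃ f' : Vec n → Vec n, ContDiffOn ℝ ∞ f' U' ∧ Set.MapsTo f' U' U ∧ Set.InvOn f' f U U'

/-- `y` is a coordinate system on the open set `U`: a diffeomorphism onto an open set. -/
def IsCoordinateSystem (U : Set (Vec n)) (y : Vec n → Vec n) : Prop :=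
  IsOpen (y '' U) ∧ IsDiffeoOn U (y '' U) y

/-- The coordinate vector field `∂/∂y_j`, that is, the field sent to the constant field `e_j`
by the derivative of `y`. -/
def coordField (y : Vec n → Vec n) (j : Fin n) : Vec n → Vec n :=
  fun x => (fderiv ℝ y x).inverse (EuclideanSpace.single j 1)

/-- `y` is an affine coordinate system on `U` for the connection `∇`. -/
def IsAffineCoordinateSystem (U : Set (Vec n))
    (D : (Vec n → Vec n) → (Vec n → Vec n) → (Vec n → Vec n)) (y : Vec n → Vec n) : Prop :=
  IsCoordinateSystem U y ∧ ∀ i j, ∀ x ∈ U, D (coordField y i) (coordField y j) x = 0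

/-- `(x, y)` is a global pair of dual coordinate systems on `(U, h, ∇)`, where `∇*` is the dual
connection of `∇`. -/
structure IsDualCoordinatePair (U : Set (Vec n)) (h : Vec n → Vec n →L[ℝ] Vec n →L[ℝ] ℝ)
    (D Dstar : (Vec n → Vec n) → (Vec n → Vec n) → (Vec n → Vec n))
    (x y : Vec n → Vec n) : Prop where
  affine : IsAffineCoordinateSystem U D x
  affine_dual : IsAffineCoordinateSystem U Dstar y
  pairing : ∀ i j, ∀ z ∈ U, h z (coordField x i z) (coordField y j z) = if i = j then 1 else 0

/-- `φ^* ∇' = ∇` for a diffeomorphism `φ` from `U` to `U'`: if the fields `X'`, `Y'` on `U'` are the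
push-forwards of `X`, `Y`, then `∇'_{X'} Y'` is the push-forward of `∇_X Y`. -/
def PullsBackConnection (U U' : Set (Vec n)) (φ : Vec n → Vec n)
    (D D' : (Vec n → Vec n) → (Vec n → Vec n) → (Vec n → Vec n)) : Prop :=
  ∀ X Y X' Y', IsSmoothField U X → IsSmoothField U Y →
    IsSmoothField U' X' → IsSmoothField U' Y' →
    (∀ x ∈ U, X' (φ x) = fderiv ℝ φ x (X x)) → (∀ x ∈ U, Y' (φ x) = fderiv ℝ φ x (Y x)) →
    ∀ x ∈ U, D' X' Y' (φ x) = fderiv ℝ φ x (D X Y x)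

/-- `φ` is an isomorphism of dually flat spaces from `(U, h, ∇)` to `(U', h', ∇')`, with dual
connections `∇*` and `∇'*`. -/
structure IsDuallyFlatIso (U : Set (Vec n)) (h : Vec n → Vec n →L[ℝ] Vec n →L[ℝ] ℝ)
    (D Dstar : (Vec n → Vec n) → (Vec n → Vec n) → (Vec n → Vec n))
    (U' : Set (Vec n)) (h' : Vec n → Vec n →L[ℝ] Vec n →L[ℝ] ℝ)
    (D' Dstar' : (Vec n → Vec n) → (Vec n → Vec n) → (Vec n → Vec n))
    (φ : Vec n → Vec n) : Prop where
  source : IsDuallyFlat U h D Dstar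
  target : IsDuallyFlat U' h' D' Dstar'
  diffeo : IsDiffeoOn U U' φ
  metric : ∀ x ∈ U, ∀ u v, h' (φ x) (fderiv ℝ φ x u) (fderiv ℝ φ x v) = h x u v
  connection : PullsBackConnection U U' φ D D'
  connection_dual : PullsBackConnection U U' φ Dstar Dstar'

/-! #### Dombrowski's construction

The tangent bundle of `U` is `U ×ˢ univ`: the pair `(x, r)` is the vector `r` at `x`. -/

/-- The connector `K_u : T_u(TU) → T_x U` at `u = (x, r)`; in coordinates
`K_u (a, b) = b + Γ_x (a, r)`, with Christoffel symbols `Γ_x (a, r) = (∇_a r)(x)` for constant fields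
`a`, `r`. -/
def connector (D : (Vec n → Vec n) → (Vec n → Vec n) → (Vec n → Vec n)) (u A : Vec n × Vec n) :
    Vec n :=
  A.2 + D (fun _ => A.1) (fun _ => u.2) u.1

/-- The metric of `TU`: `A ↦ (π_* A, K A)` is an isometry onto `T_x U ⊕ T_x U`. -/
def dombrowskiMetric (h : Vec n → Vec n →L[ℝ] Vec n →L[ℝ] ℝ)
    (D : (Vec n → Vec n) → (Vec n → Vec n) → (Vec n → Vec n)) (u A B : Vec n × Vec n) : ℝ :=
  h u.1 A.1 B.1 + h u.1 (connector D u A) (connector D u B)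

/-- The almost complex structure of `TU`: `J A` is the vector with `π_* (J A) = - K A` and
`K (J A) = π_* A`. -/
def dombrowskiJ (D : (Vec n → Vec n) → (Vec n → Vec n) → (Vec n → Vec n)) (u A : Vec n × Vec n) :
    Vec n × Vec n :=
  (-connector D u A, A.1 - D (fun _ => -connector D u A) (fun _ => u.2) u.1)

/-! #### Parallel lattices -/

/-- `X = (X₁, …, Xₙ)` is a frame of `∇`-parallel vector fields on `U`, that is, a generator of a
parallel lattice in `TU`. -/
structure IsParallelFrame (U : Set (Vec n))
    (D : (Vec n → Vec n) → (Vec n → Vec n) → (Vec n → Vec n)) (X : Fin n → Vec n → Vec n) :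
    Prop where
  smooth : ∀ i, IsSmoothField U (X i)
  parallel : ∀ i Y, IsSmoothField U Y → ∀ x ∈ U, D Y (X i) x = 0
  basis : ∀ x ∈ U, LinearIndependent ℝ (fun i => X i x)

/-- The orbit relation on `TU` of the group `Γ(L)` of translations
`u ↦ u + k₁ X₁ + ⋯ + kₙ Xₙ`, `k ∈ ℤⁿ`. -/
def latticeSetoid (U : Set (Vec n)) (X : Fin n → Vec n → Vec n) :
    Setoid {u : Vec n × Vec n // u.1 ∈ U} where
  r u v := u.1.1 = v.1.1 ∧ ∃ k : Fin n → ℤ, v.1.2 = u.1.2 + ∑ i, (k i : ℝ) • X i u.1.1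
  iseqv := by
    refine ⟨fun u => ⟨rfl, 0, by simp⟩, ?_, ?_⟩
    · rintro u v ⟨h, k, hk⟩
      refine ⟨h.symm, -k, ?_⟩
      rw [hk, ← h]
      simp
    · rintro u v w ⟨h, k, hk⟩ ⟨h', l, hl⟩
      refine ⟨h.trans h', k + l, ?_⟩
      rw [hl, hk, ← h]
      simp [add_smul, Finset.sum_add_distrib, add_assoc]

/-- The quotient `M_L = TU / Γ(L)`, where `L` is the lattice generated by `X`. -/
abbrev LatticeQuotient (U : Set (Vec n)) (X : Fin n → Vec n → Vec n) : Type :=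
  Quotient (latticeSetoid U X)

/-- The quotient map `q_L : TU → M_L`. -/
def quotientMap (U : Set (Vec n)) (X : Fin n → Vec n → Vec n)
    (u : {u : Vec n × Vec n // u.1 ∈ U}) : LatticeQuotient U X :=
  Quotient.mk (latticeSetoid U X) u

end Domain

/-! ### Kähler manifolds -/

section Kahler

variable {E : Type*} [NormedAddCommGroup E] [NormedSpace ℝ E] {H : Type*} [TopologicalSpace H]
  {I : ModelWithCorners ℝ E H} {N : Type*} [TopologicalSpace N] [ChartedSpace H N]
  [IsManifold I ∞ N]

/-- Smooth vector fields on a manifold. -/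
def IsSmoothVectorField (X : (p : N) → TangentSpace I p) : Prop :=
  ContMDiff I I.tangent ∞ (fun p => (⟨p, X p⟩ : TangentBundle I N))

variable (I N) in
/-- A Kähler structure `(g, J)`: a Riemannian metric and a compatible smooth almost complex
structure `J` that is integrable (its Nijenhuis tensor vanishes) and whose fundamental form
`ω (u, v) = g (J u, v)` is closed. -/
structure KahlerStructure where
  g : Bundle.ContMDiffRiemannianMetric I ∞ E (fun p : N => TangentSpace I p)
  J : (p : N) → TangentSpace I p →L[ℝ] TangentSpace I p
  J_smooth : ContMDiff I (I.prod 𝓘(ℝ, E →L[ℝ] E)) ∞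
    (fun p => Bundle.TotalSpace.mk' (E →L[ℝ] E)
      (E := fun p : N => TangentSpace I p →L[ℝ] TangentSpace I p) p (J p))
  J_sq : ∀ p v, J p (J p v) = -v
  hermitian : ∀ p v w, g.inner p (J p v) (J p w) = g.inner p v w
  integrable : ∀ X Y : (p : N) → TangentSpace I p,
    IsSmoothVectorField X → IsSmoothVectorField Y → ∀ p : N,
      VectorField.mlieBracket I X Y p
        + J p (VectorField.mlieBracket I (fun q => J q (X q)) Y p)
        + J p (VectorField.mlieBracket I X (fun q => J q (Y q)) p)
        - VectorField.mlieBracket I (fun q => J q (X q)) (fun q => J q (Y q)) p = 0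
  -- the invariant formula for `dω (X, Y, Z) = 0`
  closed : ∀ X Y Z : (p : N) → TangentSpace I p,
    IsSmoothVectorField X → IsSmoothVectorField Y → IsSmoothVectorField Z → ∀ p : N,
      mvfderiv I (fun q => g.inner q (J q (Y q)) (Z q)) p (X p)
        + mvfderiv I (fun q => g.inner q (J q (Z q)) (X q)) p (Y p)
        + mvfderiv I (fun q => g.inner q (J q (X q)) (Y q)) p (Z p)
        - g.inner p (J p (VectorField.mlieBracket I X Y p)) (Z p)
        - g.inner p (J p (VectorField.mlieBracket I Y Z p)) (X p)
        - g.inner p (J p (VectorField.mlieBracket I Z X p)) (Y p) = 0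

/-- The Kähler form `ω (u, v) = g (J u, v)`. -/
def KahlerStructure.omega (K : KahlerStructure I N) (p : N)
    (u v : TangentSpace I p) : ℝ :=
  K.g.inner p (K.J p u) v

/-- `φ : ℝ × N → N` is the (global) flow of the vector field `X`; such a `φ` exists exactly when `X`
is complete. -/
def IsFlow (X : (p : N) → TangentSpace I p) (φ : ℝ → N → N) : Prop :=
  ∀ q, φ 0 q = q ∧ IsMIntegralCurve (fun t => φ t q) X

end Kahler

/-! ### Torus actions -/

/-- The torus `ℝⁿ/ℤⁿ`. -/
abbrev Torus (n : ℕ) : Type := Fin n → UnitAddCircle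

/-- The quotient map `ℝⁿ → ℝⁿ/ℤⁿ`, `t ↦ [t]`, which is also the exponential map of the torus. -/
def toTorus {n : ℕ} (t : Vec n) : Torus n := fun i => (t i : UnitAddCircle)

section Action

variable {n : ℕ} {E : Type*} [NormedAddCommGroup E] [NormedSpace ℝ E]
  {H : Type*} [TopologicalSpace H] {I : ModelWithCorners ℝ E H}
  {N : Type*} [TopologicalSpace N] [ChartedSpace H N] [AddAction (Torus n) N]

variable (n I N) in
/-- The action `Tⁿ × N → N` is smooth. The smooth structure of `Tⁿ = ℝⁿ/ℤⁿ` is the one for which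
`ℝⁿ → Tⁿ` is a local diffeomorphism, so smoothness is tested on `ℝⁿ × N`. -/
def IsSmoothTorusAction : Prop :=
  ContMDiff (𝓘(ℝ, Vec n).prod I) I ∞ (fun q : Vec n × N => toTorus q.1 +ᵥ q.2)

variable (n N) in
/-- The set `N°` of points where the action is free. -/
def freeSet : Set N := {p | ∀ a : Torus n, a +ᵥ p = p → a = 0}

variable (I) in
/-- The map `ξ ↦ ξ_N (p)` from `Lie(Tⁿ) = ℝⁿ` to `T_p N`: the derivative at `0` of
`t ↦ [t] +ᵥ p`. So `ξ_N` is the fundamental vector field of `ξ`. -/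
def fundamental (p : N) : Vec n →L[ℝ] TangentSpace I p :=
  (mfderiv 𝓘(ℝ, Vec n) I (fun t : Vec n => toTorus t +ᵥ p) 0 : Vec n →L[ℝ] E)

variable [IsManifold I ∞ N] (K : KahlerStructure I N)

/-- Each `Φ_a` is a holomorphic map. -/
def IsHolomorphicAction (n : ℕ) [AddAction (Torus n) N] : Prop :=
  ∀ (a : Torus n) (p : N) (v : TangentSpace I p),
    mfderiv I I (fun q : N => a +ᵥ q) p (K.J p v)
      = K.J (a +ᵥ p) (mfderiv I I (fun q : N => a +ᵥ q) p v)

/-- Each `Φ_a` is an isometric map. -/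
def IsIsometricAction (n : ℕ) [AddAction (Torus n) N] : Prop :=
  ∀ (a : Torus n) (p : N) (v w : TangentSpace I p),
    K.g.inner (a +ᵥ p) (mfderiv I I (fun q : N => a +ᵥ q) p v)
      (mfderiv I I (fun q : N => a +ᵥ q) p w) = K.g.inner p v w

/-- Each `Φ_a` preserves the Kähler form. -/
def IsSymplecticAction (n : ℕ) [AddAction (Torus n) N] : Prop :=
  ∀ (a : Torus n) (p : N) (v w : TangentSpace I p),
    K.omega (a +ᵥ p) (mfderiv I I (fun q : N => a +ᵥ q) p v)
      (mfderiv I I (fun q : N => a +ᵥ q) p w) = K.omega p v w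

/-- `μ : N → ℝⁿ` is a momentum map: it is invariant and `ω (ξ_N, ·) = d⟨μ, ξ⟩` for all `ξ`. -/
structure IsMomentumMap (μ : N → Vec n) : Prop where
  smooth : ContMDiff I 𝓘(ℝ, Vec n) ∞ μ
  invariant : ∀ (a : Torus n) (p : N), μ (a +ᵥ p) = μ p
  hamiltonian : ∀ (ξ : Vec n) (p : N) (v : TangentSpace I p),
    K.omega p (fundamental I p ξ) v = mvfderiv I (fun q => inner ℝ (μ q) ξ) p v

/-- The action is Hamiltonian. -/
def IsHamiltonianAction (n : ℕ) [AddAction (Torus n) N] : Prop :=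
  IsSymplecticAction K n ∧ ∃ μ : N → Vec n, IsMomentumMap K μ

/-- The action on `N` is a torification of the dually flat space `(U, h, ∇)`: it is effective,
holomorphic and isometric, and there are a parallel frame `X` on `U`, generating a lattice `L`, and a
bijection `F` from `M_L = TU / Γ(L)` onto `N°` that is a holomorphic and isometric diffeomorphism,
equivariant for the action `[t] · q_L (u) = q_L (u + t₁ X₁ + ⋯ + tₙ Xₙ)` on `M_L`.

The smooth structure, the metric and the complex structure of `M_L` are those for which
`q_L : TU → M_L` is a local diffeomorphism, locally isometric and holomorphic; the conditions on `F`
are expressed accordingly through a map `τ` that represents `F ∘ q_L` on `U × ℝⁿ`. -/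
def IsTorification (U : Set (Vec n)) (h : Vec n → Vec n →L[ℝ] Vec n →L[ℝ] ℝ)
    (D : (Vec n → Vec n) → (Vec n → Vec n) → (Vec n → Vec n)) : Prop :=
  FaithfulVAdd (Torus n) N ∧ IsHolomorphicAction K n ∧ IsIsometricAction K n ∧
  ∃ X : Fin n → Vec n → Vec n, IsParallelFrame U D X ∧
  ∃ F : LatticeQuotient U X → N,
    Function.Injective F ∧ Set.range F = freeSet n N ∧
    (∀ (t : Vec n) (u v : {u : Vec n × Vec n // u.1 ∈ U}), v.1.1 = u.1.1 →
      v.1.2 = u.1.2 + ∑ i, t i • X i u.1.1 →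
      F (quotientMap U X v) = toTorus t +ᵥ F (quotientMap U X u)) ∧
    ∃ τ : Vec n × Vec n → N,
      (∀ u : {u : Vec n × Vec n // u.1 ∈ U}, τ u.1 = F (quotientMap U X u)) ∧
      IsLocalDiffeomorphOn 𝓘(ℝ, Vec n × Vec n) I ∞ τ {u | u.1 ∈ U} ∧
      (∀ u : Vec n × Vec n, u.1 ∈ U → ∀ A : Vec n × Vec n,
        mfderiv 𝓘(ℝ, Vec n × Vec n) I τ u (dombrowskiJ D u A)
          = K.J (τ u) (mfderiv 𝓘(ℝ, Vec n × Vec n) I τ u A)) ∧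
      (∀ u : Vec n × Vec n, u.1 ∈ U → ∀ A B : Vec n × Vec n,
        K.g.inner (τ u) (mfderiv 𝓘(ℝ, Vec n × Vec n) I τ u A)
            (mfderiv 𝓘(ℝ, Vec n × Vec n) I τ u B)
          = dombrowskiMetric h D u A B)

/-- `k` is the Riemannian metric on `μ(N°)` that makes `μ : N° → μ(N°)` a Riemannian submersion: each
derivative is onto, and isometric on the orthogonal complement of its kernel. -/
structure IsSubmersionMetric (μ : N → Vec n) (k : Vec n → Vec n →L[ℝ] Vec n →L[ℝ] ℝ) : Prop where
  metric : IsRiemannianMetric (μ '' freeSet n N) k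
  surjective : ∀ p ∈ freeSet n N, Function.Surjective (mfderiv I 𝓘(ℝ, Vec n) μ p)
  isometric : ∀ p ∈ freeSet n N, ∀ u v : TangentSpace I p,
    (∀ w : TangentSpace I p, mfderiv I 𝓘(ℝ, Vec n) μ p w = 0 →
      K.g.inner p u w = 0 ∧ K.g.inner p v w = 0) →
    k (μ p) (mfderiv I 𝓘(ℝ, Vec n) μ p u) (mfderiv I 𝓘(ℝ, Vec n) μ p v) = K.g.inner p u v

/-- `(k, ∇^k, ∇^flat)` is the canonical dualistic structure of `μ(N°)`: `k` makes `μ` a Riemannian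
submersion and `∇^k` is the dual connection of `∇^flat` with respect to `k`. -/
structure IsCanonicalStructure (μ : N → Vec n) (k : Vec n → Vec n →L[ℝ] Vec n →L[ℝ] ℝ)
    (Dk : (Vec n → Vec n) → (Vec n → Vec n) → (Vec n → Vec n)) : Prop where
  submersion : IsSubmersionMetric K μ k
  dualistic : IsDualistic (μ '' freeSet n N) k Dk flatConnection

end Action

end KahlerToric

end

open KahlerToric

/-! The action extends to the complexified torus. As the torus is abelian and acts holomorphically,
the fields `ξ_N` and `J η_N` commute with the fundamental fields; vanishing of the Nijenhuis tensor
then makes the `J ξ_N` commute with each other (`mlieBracket_complexFundamental`). A momentum map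
makes the orbits isotropic, so on N° the fields `-J x_N + r_N` form a frame of dimension `2n`. Such
a commuting complete frame is a coordinate frame (`exists_flattening`), and `IsCommutingFlow`
deduces that `c ↦ complexFlow φ c p` is a local diffeomorphism from ℝⁿ × ℝⁿ into N° whose derivative
is the frame itself.

This map is onto N° because its image is open, as are all other orbits of free points, and N° is
connected (`range_complexFlow`). For the connectedness, a non-free point is fixed by a nontrivial
torsion element of the torus, of which there are countably many. The fixed set of such an element
has real codimension at least two: its derivative at a fixed point commutes with `J` and is not the
identity, otherwise the element would act trivially near that point, hence on all of N, against
effectiveness. A countable union of such sets does not separate balls, since by Hausdorff dimension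
almost every broken line with two segments avoids it (`joinedIn_diff_iUnion_of_isThin`).

The rest is Hessian geometry. Along the flow, `y x = -μ (φ x 1 p)` has Jacobian `h`
(`IsMomentumMap.isHessian`). Positivity makes `y` injective on ℝⁿ, which gives injectivity of the
parametrization modulo ℤⁿ and thus the torification. The dual of the flat connection is the
pull-back of the flat connection by `y`, hence flat, and `y` is dual to the standard coordinates.
The kernel of `dμ` on N° is tangent to the orbits, so the submersion metric is the one for which
`-y` is an isometry onto μ(N°), and its dual connection has the inverse map as affine coordinates
(`IsHessian.legendre`). Two choices of `y` differ by a constant, and such a translation must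
preserve μ(N°). -/

namespace KahlerToric

/-! ### Hessian metrics and their dual connections. -/

section Hessian

variable {n : ℕ}

/-- `h` is a Riemannian metric on the open set `U`, with matrix the Jacobian of the map `y`. -/
structure IsHessian (U : Set (Vec n)) (h : Vec n → Vec n →L[ℝ] Vec n →L[ℝ] ℝ)
    (y : Vec n → Vec n) : Prop where
  isOpen : IsOpen U
  smooth : ContDiffOn ℝ ∞ y U
  eq : ∀ x ∈ U, ∀ u v, h x u v = inner ℝ (fderiv ℝ y x u) v
  symm : ∀ x ∈ U, ∀ u v, h x u v = h x v u
  pos : ∀ x ∈ U, ∀ u, u ≠ 0 → 0 < h x u u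

/-- The pull-back by `y` of the flat connection. -/
noncomputable def hessianDual (y : Vec n → Vec n) (X Z : Vec n → Vec n) : Vec n → Vec n :=
  fun x => (fderiv ℝ y x).inverse (fderiv ℝ (fun z => fderiv ℝ y z (Z z)) x (X x))

theorem flatConnection_isSmoothField {U : Set (Vec n)} (hU : IsOpen U) {X Y : Vec n → Vec n}
    (hX : IsSmoothField U X) (hY : IsSmoothField U Y) :
    IsSmoothField U (flatConnection X Y) :=
  (ContDiffOn.fderiv_of_isOpen (m := ∞) hY hU (by simp)).clm_apply hX

theorem IsSmoothField.differentiableAt {U : Set (Vec n)} (hU : IsOpen U) {X : Vec n → Vec n}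
    (hX : IsSmoothField U X) {x : Vec n} (hx : x ∈ U) : DifferentiableAt ℝ X x :=
  (hX.contDiffAt (hU.mem_nhds hx)).differentiableAt (by simp)

theorem differentiableAt_fderiv {U : Set (Vec n)} (hU : IsOpen U) {X : Vec n → Vec n}
    (hX : ContDiffOn ℝ ∞ X U) {x : Vec n} (hx : x ∈ U) : DifferentiableAt ℝ (fderiv ℝ X) x :=
  ((ContDiffOn.fderiv_of_isOpen (m := ∞) hX hU (by simp)).contDiffAt
    (hU.mem_nhds hx)).differentiableAt (by simp)

theorem isSymmSndFDerivAt {U : Set (Vec n)} (hU : IsOpen U) {X : Vec n → Vec n}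
    (hX : ContDiffOn ℝ ∞ X U) {x : Vec n} (hx : x ∈ U) : IsSymmSndFDerivAt ℝ X x :=
  (hX.contDiffAt (hU.mem_nhds hx)).isSymmSndFDerivAt (by simpa using ENat.LEInfty.out (m := 2))

theorem flatConnection_isLinearConnection {U : Set (Vec n)} (hU : IsOpen U) :
    IsLinearConnection U (flatConnection (n := n)) where
  smooth _ _ hX hY := flatConnection_isSmoothField hU hX hY
  linear_left f g X Y Z _ _ _ _ _ x _ := by simp [flatConnection]
  add_right X Y Z _ hY hZ x hx := by
    simp only [flatConnection]
    rw [fderiv_fun_add (hY.differentiableAt hU hx) (hZ.differentiableAt hU hx)]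
    rfl
  leibniz f X Y hf _ hY x hx := by
    simp only [flatConnection]
    rw [fderiv_fun_smul ((hf.contDiffAt (hU.mem_nhds hx)).differentiableAt (by simp))
      (hY.differentiableAt hU hx)]
    simp [add_comm]

theorem fderiv_fderiv_apply {U : Set (Vec n)} (hU : IsOpen U) {Z Y : Vec n → Vec n}
    (hZ : ContDiffOn ℝ ∞ Z U) (hY : IsSmoothField U Y) {x : Vec n} (hx : x ∈ U) (u : Vec n) :
    fderiv ℝ (fun z => fderiv ℝ Z z (Y z)) x u
      = fderiv ℝ (fderiv ℝ Z) x u (Y x) + fderiv ℝ Z x (fderiv ℝ Y x u) := by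
  rw [fderiv_clm_apply (differentiableAt_fderiv hU hZ hx) (hY.differentiableAt hU hx)]
  simp [add_comm]

/-- The curvature vanishes by symmetry of the second derivative of `Z`; the first-order terms add up
to the derivative of `Z` along the bracket. -/
theorem flatConnection_isFlatConnection {U : Set (Vec n)} (hU : IsOpen U) :
    IsFlatConnection U (flatConnection (n := n)) where
  torsion X Y _ _ x _ := by simp [flatConnection, VectorField.lieBracket]
  curvature X Y Z hX hY hZ x hx := by
    unfold flatConnection
    rw [fderiv_fderiv_apply hU hZ hY hx, fderiv_fderiv_apply hU hZ hX hx,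
      (isSymmSndFDerivAt hU hZ hx).eq (X x) (Y x)]
    simp [VectorField.lieBracket]

namespace IsHessian

variable {U : Set (Vec n)} {h : Vec n → Vec n →L[ℝ] Vec n →L[ℝ] ℝ} {y : Vec n → Vec n}

theorem isInvertible (H : IsHessian U h y) {x : Vec n} (hx : x ∈ U) :
    (fderiv ℝ y x).IsInvertible := by
  have hinj : Function.Injective (fderiv ℝ y x : Vec n →ₗ[ℝ] Vec n) := by
    rw [← LinearMap.ker_eq_bot, LinearMap.ker_eq_bot']
    intro u hu
    by_contra h0
    have := H.pos x hx u h0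
    rw [H.eq x hx] at this
    simp only [ContinuousLinearMap.coe_coe] at hu
    simp [hu] at this
  refine ⟨(LinearEquiv.ofInjectiveEndo _ hinj).toContinuousLinearEquiv, ?_⟩
  ext u
  rfl

theorem apply_inverse (H : IsHessian U h y) {x : Vec n} (hx : x ∈ U) (u : Vec n) :
    fderiv ℝ y x ((fderiv ℝ y x).inverse u) = u :=
  (H.isInvertible hx).self_apply_inverse u

theorem inverse_apply (H : IsHessian U h y) {x : Vec n} (hx : x ∈ U) (u : Vec n) :
    (fderiv ℝ y x).inverse (fderiv ℝ y x u) = u :=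
  (H.isInvertible hx).inverse_apply_self u

theorem contDiffOn_fderiv (H : IsHessian U h y) : ContDiffOn ℝ ∞ (fderiv ℝ y) U :=
  ContDiffOn.fderiv_of_isOpen (m := ∞) H.smooth H.isOpen (by simp)

theorem contDiffOn_inverse (H : IsHessian U h y) :
    ContDiffOn ℝ ∞ (fun x => (fderiv ℝ y x).inverse) U := by
  intro x hx
  obtain ⟨e, he⟩ := H.isInvertible hx
  have h1 := (H.contDiffOn_fderiv x hx)
  have h2 : ContDiffAt ℝ ∞ ContinuousLinearMap.inverse (fderiv ℝ y x) := by
    rw [← he]; exact contDiffAt_map_inverse e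
  exact h2.comp_contDiffWithinAt x h1

theorem isRiemannianMetric (H : IsHessian U h y) : IsRiemannianMetric U h where
  smooth := by
    have : ContDiffOn ℝ ∞ (fun x => (innerSL ℝ (E := Vec n)).comp (fderiv ℝ y x)) U :=
      contDiffOn_const.clm_comp H.contDiffOn_fderiv
    refine this.congr fun x hx => ?_
    ext u v
    simp [H.eq x hx, innerSL_apply_apply]
  symm := H.symm
  pos := H.pos

theorem smooth_apply (H : IsHessian U h y) {Z : Vec n → Vec n} (hZ : IsSmoothField U Z) :
    IsSmoothField U (fun z => fderiv ℝ y z (Z z)) :=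
  H.contDiffOn_fderiv.clm_apply hZ

theorem hessianDual_isSmoothField (H : IsHessian U h y) {X Z : Vec n → Vec n}
    (hX : IsSmoothField U X) (hZ : IsSmoothField U Z) : IsSmoothField U (hessianDual y X Z) :=
  H.contDiffOn_inverse.clm_apply (flatConnection_isSmoothField H.isOpen hX (H.smooth_apply hZ))

theorem hessianDual_isLinearConnection (H : IsHessian U h y) :
    IsLinearConnection U (hessianDual y) where
  smooth _ _ hX hZ := H.hessianDual_isSmoothField hX hZ
  linear_left f g X Y Z _ _ _ _ _ x _ := by simp [hessianDual]
  add_right X Y Z hX hY hZ x hx := by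
    simp only [hessianDual, map_add]
    rw [fderiv_fun_add ((H.smooth_apply hY).differentiableAt H.isOpen hx)
      ((H.smooth_apply hZ).differentiableAt H.isOpen hx)]
    simp
  leibniz f X Y hf _ hY x hx := by
    simp only [hessianDual, map_smul]
    rw [fderiv_fun_smul ((hf.contDiffAt (H.isOpen.mem_nhds hx)).differentiableAt (by simp))
      ((H.smooth_apply hY).differentiableAt H.isOpen hx)]
    simp [add_comm, H.inverse_apply hx]

/-- Since `h(Y, Z) = ⟨dy Z, Y⟩`, the product rule gives duality. The map `dy` intertwines
`hessianDual y` with the flat connection in the second argument, so its curvature is the flat one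
transported by the inverse of `dy`; its torsion vanishes because the second derivative of `y` is
symmetric. -/
theorem isDuallyFlat (H : IsHessian U h y) :
    IsDuallyFlat U h flatConnection (hessianDual y) where
  isOpen := H.isOpen
  metric := H.isRiemannianMetric
  connection := flatConnection_isLinearConnection H.isOpen
  connection_dual := H.hessianDual_isLinearConnection
  dual X Y Z hX hY hZ x hx := by
    have h1 : (fun z => h z (Y z) (Z z)) =ᶠ[nhds x]
        fun z => inner ℝ (fderiv ℝ y z (Z z)) (Y z) := by
      filter_upwards [H.isOpen.mem_nhds hx] with z hz
      rw [H.symm z hz, H.eq z hz]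
    rw [h1.fderiv_eq, fderiv_inner_apply ℝ ((H.smooth_apply hZ).differentiableAt H.isOpen hx)
      (hY.differentiableAt H.isOpen hx), H.symm x hx _ (Z x), H.symm x hx (Y x), H.eq x hx,
      H.eq x hx, hessianDual, H.apply_inverse hx]
    rfl
  flat := flatConnection_isFlatConnection H.isOpen
  flat_dual :=
    { torsion := by
        intro X Y hX hY x hx
        unfold hessianDual
        rw [fderiv_fderiv_apply H.isOpen H.smooth hY hx,
          fderiv_fderiv_apply H.isOpen H.smooth hX hx,
          (isSymmSndFDerivAt H.isOpen H.smooth hx).eq (X x) (Y x), map_add, map_add,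
          H.inverse_apply hx, H.inverse_apply hx]
        simp [VectorField.lieBracket]
      curvature := by
        intro X Y Z hX hY hZ x hx
        have key : ∀ Y, (fun z => fderiv ℝ y z (hessianDual y Y Z z)) =ᶠ[nhds x]
            flatConnection Y (fun z => fderiv ℝ y z (Z z)) := by
          intro Y
          filter_upwards [H.isOpen.mem_nhds hx] with z hz
          rw [hessianDual, H.apply_inverse hz]
          rfl
        have hc := (flatConnection_isFlatConnection H.isOpen).curvature X Y _ hX hY
          (H.smooth_apply hZ) x hx
        rw [hessianDual, hessianDual, hessianDual, (key Y).fderiv_eq, (key X).fderiv_eq,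
          ← map_sub, ← map_sub]
        exact (congrArg _ hc).trans (map_zero _) }

/-- `hessianDual` only depends on germs. -/
theorem _root_.KahlerToric.hessianDual_congr (y : Vec n → Vec n) (X : Vec n → Vec n)
    {Z Z' : Vec n → Vec n}
    {x : Vec n} (hZ : Z =ᶠ[nhds x] Z') : hessianDual y X Z x = hessianDual y X Z' x := by
  have : (fun z => fderiv ℝ y z (Z z)) =ᶠ[nhds x] fun z => fderiv ℝ y z (Z' z) := by
    filter_upwards [hZ] with z hz
    rw [hz]
  rw [hessianDual, hessianDual, this.fderiv_eq]

/-- A connection dual to the flat one is `hessianDual`. -/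
theorem eq_hessianDual (H : IsHessian U h y)
    {D : (Vec n → Vec n) → (Vec n → Vec n) → (Vec n → Vec n)}
    (hD : IsDualistic U h D flatConnection) {X Y : Vec n → Vec n} (hX : IsSmoothField U X)
    (hY : IsSmoothField U Y) {x : Vec n} (hx : x ∈ U) : D X Y x = hessianDual y X Y x := by
  by_contra hne
  -- Both duality relations are tested on the constant field `w`; subtracting them leaves `h(w, w) =
  -- 0`, against positivity.
  set w := D X Y x - hessianDual y X Y x with hw
  have hw0 : w ≠ 0 := sub_ne_zero.2 hne
  have hW : IsSmoothField U (fun _ => w) := contDiffOn_const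
  have h1 := hD.dual X Y (fun _ => w) hX hY hW x hx
  have h2 := H.isDuallyFlat.dual X (fun _ => w) Y hX hW hY x hx
  have h3 : (fun z => h z (Y z) w) =ᶠ[nhds x] fun z => h z w (Y z) := by
    filter_upwards [H.isOpen.mem_nhds hx] with z hz
    rw [H.symm z hz]
  rw [h3.fderiv_eq, h2, H.symm x hx (Y x), H.symm x hx w (hessianDual y X Y x)] at h1
  have h4 : h x (D X Y x - hessianDual y X Y x) w = 0 := by
    rw [(h x).map_sub, sub_apply]
    linarith
  exact (H.pos x hx w hw0).ne' h4

/-- `D` agrees with `hessianDual y` only on `U` and on smooth fields. For the curvature, the inner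
derivative is therefore replaced as a germ, and the bracket is first shown to be smooth. -/
theorem isDuallyFlat_of_isDualistic (H : IsHessian U h y)
    {D : (Vec n → Vec n) → (Vec n → Vec n) → (Vec n → Vec n)}
    (hD : IsDualistic U h D flatConnection) : IsDuallyFlat U h D flatConnection where
  toIsDualistic := hD
  flat_dual := flatConnection_isFlatConnection H.isOpen
  flat :=
    { torsion := by
        intro X Y hX hY x hx
        rw [H.eq_hessianDual hD hX hY hx, H.eq_hessianDual hD hY hX hx]
        exact H.isDuallyFlat.flat_dual.torsion X Y hX hY x hx
      curvature := by
        intro X Y Z hX hY hZ x hx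
        have hb : IsSmoothField U (VectorField.lieBracket ℝ X Y) :=
          ContDiffOn.sub (flatConnection_isSmoothField H.isOpen hX hY)
            (flatConnection_isSmoothField H.isOpen hY hX)
        have key : ∀ Y, IsSmoothField U Y → D Y Z =ᶠ[nhds x] hessianDual y Y Z := by
          intro Y hY
          filter_upwards [H.isOpen.mem_nhds hx] with z hz
          exact H.eq_hessianDual hD hY hZ hz
        rw [H.eq_hessianDual hD hX (hD.connection.smooth _ _ hY hZ) hx,
          H.eq_hessianDual hD hY (hD.connection.smooth _ _ hX hZ) hx,
          H.eq_hessianDual hD hb hZ hx, hessianDual_congr y X (key Y hY),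
          hessianDual_congr y Y (key X hX)]
        exact H.isDuallyFlat.flat_dual.curvature X Y Z hX hY hZ x hx }

theorem isDualistic_swap (H : IsHessian U h y) :
    IsDualistic U h (hessianDual y) flatConnection where
  isOpen := H.isOpen
  metric := H.isRiemannianMetric
  connection := H.hessianDual_isLinearConnection
  connection_dual := flatConnection_isLinearConnection H.isOpen
  dual X Y Z hX hY hZ x hx := by
    have h2 := H.isDuallyFlat.dual X Z Y hX hZ hY x hx
    have h3 : (fun z => h z (Y z) (Z z)) =ᶠ[nhds x] fun z => h z (Z z) (Y z) := by
      filter_upwards [H.isOpen.mem_nhds hx] with z hz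
      rw [H.symm z hz]
    rw [h3.fderiv_eq, h2, add_comm, H.symm x hx (Z x), H.symm x hx (Y x)]

end IsHessian

end Hessian

/-! ### Global dual coordinates and the Legendre transform. -/

section Legendre

variable {n : ℕ}

/-- An injective smooth map of `ℝⁿ` with invertible derivatives is a diffeomorphism onto an open
set. -/
theorem isOpen_range_and_exists_inverse {f : Vec n → Vec n} (hf : ContDiff ℝ ∞ f)
    (hinj : Function.Injective f) (hinv : ∀ x, (fderiv ℝ f x).IsInvertible) :
    IsOpen (Set.range f) ∧
      ∃ ψ : Vec n → Vec n, ContDiffOn ℝ ∞ ψ (Set.range f) ∧ ∀ x, ψ (f x) = x := by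
  have hstrict : ∀ x, ∃ e : Vec n ≃L[ℝ] Vec n, HasStrictFDerivAt f (e : Vec n →L[ℝ] Vec n) x := by
    intro x
    obtain ⟨e, he⟩ := hinv x
    refine ⟨e, ?_⟩
    rw [he]
    exact hf.contDiffAt.hasStrictFDerivAt (by simp)
  have hopen : IsOpenMap f := by
    choose e he using hstrict
    exact isOpenMap_of_hasStrictFDerivAt_equiv he
  have hemb : Topology.IsOpenEmbedding f :=
    Topology.IsOpenEmbedding.of_continuous_injective_isOpenMap hf.continuous hinj hopen
  refine ⟨hopen.isOpen_range, Function.invFun f, ?_, Function.leftInverse_invFun hinj⟩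
  rintro _ ⟨x, rfl⟩
  obtain ⟨e, he⟩ := hstrict x
  have h1 : ContDiffAt ℝ ∞ (hemb.toOpenPartialHomeomorph f).symm (f x) := by
    have hx : (hemb.toOpenPartialHomeomorph f).symm (f x) = x :=
      hemb.toOpenPartialHomeomorph_left_inv
    refine OpenPartialHomeomorph.contDiffAt_symm _ (f₀' := e) (by simp) ?_ ?_
    · rw [hx]; exact he.hasFDerivAt
    · rw [hx]; exact hf.contDiffAt
  refine (h1.congr_of_eventuallyEq ?_).contDiffWithinAt
  filter_upwards [hopen.isOpen_range.mem_nhds ⟨x, rfl⟩]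
  rintro _ ⟨z, rfl⟩
  rw [Function.leftInverse_invFun hinj z]
  exact hemb.toOpenPartialHomeomorph_left_inv.symm

theorem isDiffeoOn_range {f ψ : Vec n → Vec n} (hf : ContDiff ℝ ∞ f)
    (hψ : ContDiffOn ℝ ∞ ψ (Set.range f)) (hl : ∀ x, ψ (f x) = x) :
    IsDiffeoOn Set.univ (Set.range f) f := by
  refine ⟨hf.contDiffOn, fun x _ => ⟨x, rfl⟩, ψ, hψ, fun x _ => Set.mem_univ _, ?_, ?_⟩
  · intro x _
    exact hl x
  · rintro _ ⟨x, rfl⟩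
    rw [hl]

theorem coordField_id (j : Fin n) (x : Vec n) :
    coordField id j x = EuclideanSpace.single j 1 := by
  have : fderiv ℝ (id : Vec n → Vec n) x = ContinuousLinearMap.id ℝ (Vec n) := fderiv_id
  rw [coordField, this, ContinuousLinearMap.inverse_id]
  rfl

namespace IsHessian

variable {h : Vec n → Vec n →L[ℝ] Vec n →L[ℝ] ℝ} {y : Vec n → Vec n}

theorem contDiff (H : IsHessian Set.univ h y) : ContDiff ℝ ∞ y := contDiffOn_univ.1 H.smooth

theorem hasFDerivAt (H : IsHessian Set.univ h y) (x : Vec n) : HasFDerivAt y (fderiv ℝ y x) x :=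
  (H.contDiff.differentiable (by simp) x).hasFDerivAt

/-- A monotonicity argument on the segment from `a` to `b`: the component of `y` along `b - a` has
derivative `h(b - a, b - a) > 0`. -/
theorem injective (H : IsHessian Set.univ h y) : Function.Injective y := by
  intro a b hab
  by_contra hne
  have hv : b - a ≠ 0 := sub_ne_zero.2 (Ne.symm hne)
  let f : ℝ → ℝ := fun t => inner ℝ (y (a + t • (b - a))) (b - a)
  have hd : ∀ t, HasDerivAt f (h (a + t • (b - a)) (b - a) (b - a)) t := by
    intro t
    have h1 : HasDerivAt (fun t : ℝ => a + t • (b - a)) (b - a) t := by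
      simpa using ((hasDerivAt_id t).smul_const (b - a)).const_add a
    have h2 := (H.hasFDerivAt (a + t • (b - a))).comp_hasDerivAt t h1
    have h3 := h2.inner ℝ (hasDerivAt_const t (b - a))
    rw [H.eq _ (Set.mem_univ _)]
    simpa using h3
  have hmono : StrictMono f := by
    refine strictMono_of_deriv_pos fun t => ?_
    rw [(hd t).deriv]
    exact H.pos _ (Set.mem_univ _) _ hv
  have := hmono (zero_lt_one)
  simp [f, hab] at this

/-- The fields `∂/∂y_j` are the preimages of `e_j` under `dy`. So `dy` makes them constant, whence
parallel, and `h(e_i, ∂/∂y_j) = ⟨e_j, e_i⟩`. -/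
theorem isDualCoordinatePair (H : IsHessian Set.univ h y) :
    IsDualCoordinatePair Set.univ h flatConnection (hessianDual y) id y where
  affine := by
    refine ⟨⟨by simp, ?_⟩, fun i j x _ => ?_⟩
    · simpa using isDiffeoOn_range (ψ := id) contDiff_id contDiffOn_id (fun x => rfl)
    · have : coordField (id : Vec n → Vec n) j = fun _ => EuclideanSpace.single j 1 :=
        funext (coordField_id j)
      rw [this, flatConnection]
      simp
  affine_dual := by
    obtain ⟨ho, ψ, hψ, hl⟩ := isOpen_range_and_exists_inverse H.contDiff H.injective
      (fun x => H.isInvertible (Set.mem_univ x))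
    refine ⟨⟨by simpa using ho, by simpa using isDiffeoOn_range H.contDiff hψ hl⟩, ?_⟩
    intro i j x _
    have : (fun z => fderiv ℝ y z (coordField y j z)) = fun _ => EuclideanSpace.single j 1 :=
      funext fun z => H.apply_inverse (Set.mem_univ z) _
    rw [hessianDual, this]
    simp
  pairing i j z hz := by
    rw [coordField_id, H.symm z hz, H.eq z hz, coordField, H.apply_inverse hz]
    simp [EuclideanSpace.inner_single_left, PiLp.single_apply, eq_comm]

/-- The inverse of `-y`, with values in the source of `y`. -/
theorem exists_inverse_neg (H : IsHessian Set.univ h y) :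
    IsOpen (Set.range fun x => -y x) ∧ ∃ ψ : Vec n → Vec n,
      ContDiffOn ℝ ∞ ψ (Set.range fun x => -y x) ∧ ∀ x, ψ (-y x) = x := by
  refine isOpen_range_and_exists_inverse (f := fun x => -y x) H.contDiff.neg
    (fun a b hab => H.injective (neg_injective hab)) fun x => ?_
  obtain ⟨e, he⟩ := H.isInvertible (Set.mem_univ x)
  refine ⟨(ContinuousLinearEquiv.neg ℝ).trans e, ?_⟩
  rw [fderiv_fun_neg, ← he]
  ext u : 1
  simp

theorem fderiv_inverse_neg (H : IsHessian Set.univ h y) {ψ : Vec n → Vec n}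
    (hψ : ContDiffOn ℝ ∞ ψ (Set.range fun x => -y x)) (hl : ∀ x, ψ (-y x) = x)
    (x u : Vec n) : fderiv ℝ ψ (-y x) (fderiv ℝ y x u) = -u := by
  have h1 : HasFDerivAt ψ (fderiv ℝ ψ (-y x)) (-y x) :=
    ((hψ.contDiffAt (H.exists_inverse_neg.1.mem_nhds ⟨x, rfl⟩)).differentiableAt
      (by simp)).hasFDerivAt
  have h2 : HasFDerivAt (fun x => -y x) (-fderiv ℝ y x) x := (H.hasFDerivAt x).neg
  have h3 := HasFDerivAt.comp (f := fun x => -y x) x h1 h2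
  have h4 : (ψ ∘ fun x => -y x) = id := funext hl
  rw [h4] at h3
  have h5 := h3.unique (hasFDerivAt_id x)
  have h6 := DFunLike.congr_fun h5 u
  simp only [ContinuousLinearMap.comp_apply, neg_apply, map_neg, ContinuousLinearMap.id_apply] at h6
  rwa [neg_eq_iff_eq_neg] at h6

/-- The metric of which `-y` is an isometry is again Hessian. -/
theorem legendre (H : IsHessian Set.univ h y) {k : Vec n → Vec n →L[ℝ] Vec n →L[ℝ] ℝ}
    (hk : ∀ x u v, k (-y x) (fderiv ℝ y x u) (fderiv ℝ y x v) = h x u v) {ψ : Vec n → Vec n}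
    (hψ : ContDiffOn ℝ ∞ ψ (Set.range fun x => -y x)) (hl : ∀ x, ψ (-y x) = x) :
    IsHessian (Set.range fun x => -y x) k (fun z => -ψ z) := by
  have surj : ∀ x u, ∃ u', fderiv ℝ y x u' = u := fun x u =>
    ⟨_, H.apply_inverse (Set.mem_univ x) u⟩
  refine ⟨H.exists_inverse_neg.1, hψ.neg, ?_, ?_, ?_⟩
  · rintro _ ⟨x, rfl⟩ u v
    obtain ⟨u, rfl⟩ := surj x u
    obtain ⟨v, rfl⟩ := surj x v
    -- As `ψ` inverts `-y`, its derivative is minus the inverse of `dy`; the sign in `-ψ` makes the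
    -- Jacobian positive.
    rw [fderiv_fun_neg, neg_apply, H.fderiv_inverse_neg hψ hl, hk, neg_neg,
      H.symm x (Set.mem_univ _), H.eq x (Set.mem_univ _), real_inner_comm]
  · rintro _ ⟨x, rfl⟩ u v
    obtain ⟨u, rfl⟩ := surj x u
    obtain ⟨v, rfl⟩ := surj x v
    rw [hk, hk, H.symm x (Set.mem_univ _)]
  · rintro _ ⟨x, rfl⟩ u hu
    obtain ⟨u, rfl⟩ := surj x u
    rw [hk]
    refine H.pos x (Set.mem_univ _) u ?_
    rintro rfl
    simp at hu

/-- The matrix of `k` at `-y x` is the inverse of the matrix of `h` at `x`, that is, minus the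
derivative of `ψ`. -/
theorem exists_legendre_metric (H : IsHessian Set.univ h y) :
    ∃ k : Vec n → Vec n →L[ℝ] Vec n →L[ℝ] ℝ,
      ∀ x u v, k (-y x) (fderiv ℝ y x u) (fderiv ℝ y x v) = h x u v := by
  obtain ⟨-, ψ, hψ, hl⟩ := H.exists_inverse_neg
  refine ⟨fun z => (innerSL ℝ).comp (-fderiv ℝ ψ z), fun x u v => ?_⟩
  have : ((innerSL ℝ).comp (-fderiv ℝ ψ (-y x)) (fderiv ℝ y x u)) (fderiv ℝ y x v)
      = inner ℝ (-(fderiv ℝ ψ (-y x) (fderiv ℝ y x u))) (fderiv ℝ y x v) := rfl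
  rw [this, H.fderiv_inverse_neg hψ hl, neg_neg, real_inner_comm, ← H.eq x (Set.mem_univ _),
    H.symm x (Set.mem_univ _)]

/-- Under `-y` the affine coordinates correspond up to sign: `-ψ`, affine for `Dk`, pulls back to
`-x`, and the standard coordinates of the target pull back to `-y`. Signs do not affect the
connections. -/
theorem isDuallyFlatIso (H : IsHessian Set.univ h y) {k : Vec n → Vec n →L[ℝ] Vec n →L[ℝ] ℝ}
    (hk : ∀ x u v, k (-y x) (fderiv ℝ y x u) (fderiv ℝ y x v) = h x u v)
    {Dk : (Vec n → Vec n) → (Vec n → Vec n) → (Vec n → Vec n)}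
    (hD : IsDualistic (Set.range fun x => -y x) k Dk flatConnection) :
    IsDuallyFlatIso Set.univ h flatConnection (hessianDual y)
      (Set.range fun x => -y x) k Dk flatConnection (fun x => -y x) := by
  obtain ⟨ho, ψ, hψ, hl⟩ := H.exists_inverse_neg
  have L := H.legendre hk hψ hl
  have hd : ∀ x, fderiv ℝ (fun x => -y x) x = -fderiv ℝ y x := fun x => fderiv_fun_neg
  have hF : ∀ x, HasFDerivAt (fun x => -y x) (-fderiv ℝ y x) x := fun x => (H.hasFDerivAt x).neg
  refine ⟨H.isDuallyFlat, L.isDuallyFlat_of_isDualistic hD,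
    isDiffeoOn_range (f := fun x => -y x) H.contDiff.neg hψ hl, ?_, ?_, ?_⟩
  · intro x _ u v
    simp [hd, hk]
  · intro X Y X' Y' hX hY hX' hY' hXX hYY x hx
    have hmem : -y x ∈ Set.range fun x => -y x := ⟨x, rfl⟩
    have h1 : ∀ z, fderiv ℝ (fun z => -ψ z) (-y z) (Y' (-y z)) = -Y z := by
      intro z
      have := hYY z (Set.mem_univ z)
      simp only at this
      rw [this, hd, fderiv_fun_neg, neg_apply, neg_apply, map_neg,
        H.fderiv_inverse_neg hψ hl, neg_neg]
    have h2 : HasFDerivAt (fun z => fderiv ℝ (fun z => -ψ z) z (Y' z))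
        (fderiv ℝ (fun z => fderiv ℝ (fun z => -ψ z) z (Y' z)) (-y x)) (-y x) :=
      ((L.smooth_apply hY').differentiableAt ho hmem).hasFDerivAt
    have h3 := HasFDerivAt.comp (f := fun x => -y x) x h2 (hF x)
    have h4 : ((fun z => fderiv ℝ (fun z => -ψ z) z (Y' z)) ∘ fun x => -y x) = fun z => -Y z :=
      funext h1
    rw [h4] at h3
    have h5 : -fderiv ℝ Y x (X x) = fderiv ℝ (fun z => fderiv ℝ (fun z => -ψ z) z (Y' z)) (-y x)
        (X' (-y x)) := by
      have := DFunLike.congr_fun (h3.unique (hY.differentiableAt isOpen_univ hx).hasFDerivAt.neg)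
        (X x)
      have hx' := hXX x hx
      simp only at hx'
      rw [hx', hd]
      simpa using this.symm
    show Dk X' Y' (-y x) = _
    rw [L.eq_hessianDual hD hX' hY' hmem, hessianDual, ← h5, hd, flatConnection]
    have h6 := L.inverse_apply hmem (fderiv ℝ y x (fderiv ℝ Y x (X x)))
    rw [fderiv_fun_neg, neg_apply, H.fderiv_inverse_neg hψ hl, neg_neg] at h6
    rw [map_neg, fderiv_fun_neg, h6]
    rfl
  · intro X Y X' Y' hX hY hX' hY' hXX hYY x hx
    have hmem : -y x ∈ Set.range fun x => -y x := ⟨x, rfl⟩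
    have h2 := (hY'.differentiableAt ho hmem).hasFDerivAt
    have h3 := HasFDerivAt.comp (f := fun x => -y x) x h2 (hF x)
    have h4 : (Y' ∘ fun x => -y x) = fun z => -(fderiv ℝ y z (Y z)) := by
      funext z
      have := hYY z (Set.mem_univ z)
      simp only at this
      simp [this, hd]
    rw [h4] at h3
    have h5 := DFunLike.congr_fun (h3.unique
      ((H.smooth_apply hY).differentiableAt isOpen_univ hx).hasFDerivAt.neg) (X x)
    have hx' := hXX x hx
    simp only at hx'
    show fderiv ℝ Y' (-y x) (X' (-y x)) = _
    rw [hx', hd, hessianDual, neg_apply (fderiv ℝ y x) ((fderiv ℝ y x).inverse _),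
      H.apply_inverse hx]
    simpa using h5

end IsHessian

/-- Two coordinate systems dual to the standard one differ by a translation. -/
theorem IsDualCoordinatePair.exists_add_const {h : Vec n → Vec n →L[ℝ] Vec n →L[ℝ] ℝ}
    (hh : IsRiemannianMetric Set.univ h)
    {D Ds : (Vec n → Vec n) → (Vec n → Vec n) → (Vec n → Vec n)} {y₁ y₂ : Vec n → Vec n}
    (h₁ : IsDualCoordinatePair Set.univ h D Ds id y₁)
    (h₂ : IsDualCoordinatePair Set.univ h D Ds id y₂) : ∃ C, ∀ x, y₁ x = y₂ x + C := by
  have hdiff : ∀ {y}, IsDualCoordinatePair Set.univ h D Ds id y → Differentiable ℝ y := by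
    intro y hy
    exact (contDiffOn_univ.1 hy.affine_dual.1.2.1).differentiable (by simp)
  have hinv : ∀ {y}, IsDualCoordinatePair Set.univ h D Ds id y →
      ∀ x, (fderiv ℝ y x).IsInvertible := by
    intro y hy x
    obtain ⟨ho, -, -, ψ, hψ, -, hl, -⟩ := hy.affine_dual.1
    have h1 := ((hψ.contDiffAt (ho.mem_nhds ⟨x, trivial, rfl⟩)).differentiableAt
      (by simp)).hasFDerivAt
    have h3 := h1.comp x (hdiff hy x).hasFDerivAt
    have h4 : ψ ∘ y = id := funext fun z => hl (Set.mem_univ z)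
    rw [h4] at h3
    have h5 := h3.unique (hasFDerivAt_id x)
    have hinj : Function.Injective (fderiv ℝ y x : Vec n →ₗ[ℝ] Vec n) :=
      Function.LeftInverse.injective (g := fderiv ℝ ψ (y x)) fun u => DFunLike.congr_fun h5 u
    exact ⟨(LinearEquiv.ofInjectiveEndo _ hinj).toContinuousLinearEquiv, by ext u; rfl⟩
  -- By nondegeneracy of `h`, the pairing with the constant frame determines the dual coordinate
  -- fields.
  have hcf : ∀ j x, coordField y₁ j x = coordField y₂ j x := by
    intro j x
    by_contra hne
    have hw := sub_ne_zero.2 hne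
    set w := coordField y₁ j x - coordField y₂ j x with hwdef
    have h0 : ∀ i, h x (EuclideanSpace.single i 1) w = 0 := by
      intro i
      have e1 := h₁.pairing i j x (Set.mem_univ _)
      have e2 := h₂.pairing i j x (Set.mem_univ _)
      rw [coordField_id] at e1 e2
      rw [hwdef, map_sub, e1, e2, sub_self]
    have h1 : ∀ u, h x u w = 0 := by
      intro u
      have hu : (h x).flip w = 0 := by
        apply ContinuousLinearMap.coe_injective
        refine (EuclideanSpace.basisFun (Fin n) ℝ).toBasis.ext fun i => ?_
        simpa using h0 i
      simpa using DFunLike.congr_fun hu u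
    exact (hh.pos x (Set.mem_univ _) w hw).ne' (h1 w)
  have hfd : ∀ x, fderiv ℝ y₁ x = fderiv ℝ y₂ x := by
    intro x
    have h1 : (fderiv ℝ y₁ x).inverse = (fderiv ℝ y₂ x).inverse := by
      apply ContinuousLinearMap.coe_injective
      refine (EuclideanSpace.basisFun (Fin n) ℝ).toBasis.ext fun i => ?_
      simpa [coordField] using hcf i x
    -- Inverting twice loses nothing only because both derivatives are invertible: `inverse` is zero
    -- elsewhere.
    have h2 := congrArg ContinuousLinearMap.inverse h1
    rwa [(hinv h₁ x).inverse_inverse, (hinv h₂ x).inverse_inverse] at h2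
  refine ⟨y₁ 0 - y₂ 0, fun x => ?_⟩
  have hc : ∀ a b, (y₁ - y₂) a = (y₁ - y₂) b := by
    refine is_const_of_fderiv_eq_zero (𝕜 := ℝ) ((hdiff h₁).sub (hdiff h₂)) fun x => ?_
    rw [fderiv_sub (hdiff h₁ x) (hdiff h₂ x), hfd, sub_self]
  have := hc x 0
  simp only [Pi.sub_apply] at this
  rw [← this]
  abel

theorem IsDiffeoOn.image_eq {U U' : Set (Vec n)} {f : Vec n → Vec n} (hf : IsDiffeoOn U U' f) :
    f '' U = U' := by
  obtain ⟨-, hm, f', -, hm', -, hr⟩ := hf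
  exact Set.Subset.antisymm hm.image_subset fun z hz => ⟨f' z, hm' hz, hr hz⟩

/-- A nonempty bounded set is not invariant under a nontrivial translation. -/
theorem not_translation_invariant_of_isBounded {S : Set (Vec n)} (hS : Bornology.IsBounded S)
    (hne : S.Nonempty) : ¬ ∃ C : Vec n, C ≠ 0 ∧ (fun z => z + C) '' S = S := by
  rintro ⟨C, hC, hSC⟩
  obtain ⟨z, hz⟩ := hne
  obtain ⟨R, hR⟩ := hS.exists_norm_le
  have hmem : ∀ m : ℕ, z + (m : ℝ) • C ∈ S := by
    intro m
    induction m with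
    | zero => simpa using hz
    | succ m ih =>
      rw [← hSC]
      exact ⟨_, ih, by push_cast; module⟩
  obtain ⟨m, hm⟩ := exists_nat_gt ((R + ‖z‖) / ‖C‖)
  have h1 := hR _ (hmem m)
  have h2 : ‖(m : ℝ) • C‖ ≤ ‖z + (m : ℝ) • C‖ + ‖z‖ := by
    simpa using norm_sub_le (z + (m : ℝ) • C) z
  rw [norm_smul, Real.norm_natCast] at h2
  rw [div_lt_iff₀ (norm_pos_iff.2 hC)] at hm
  linarith

end Legendre

/-! ### Sets of codimension at least two do not separate balls. -/

section Thin

open Module Topology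

variable {E : Type*} [NormedAddCommGroup E] [NormedSpace ℝ E]

/-- `T` is locally a Lipschitz graph over a subset of a linear subspace of codimension at
least two. -/
def IsThin (T : Set E) : Prop :=
  ∀ s ∈ T, ∃ (L : Submodule ℝ E) (P : E →L[ℝ] L) (C : NNReal), finrank ℝ L + 2 ≤ finrank ℝ E ∧
    ∃ O ∈ 𝓝[T] s, ∀ a ∈ T ∩ O, ∀ b ∈ T ∩ O, ‖a - b‖ ≤ C * ‖P (a - b)‖

/-- The union of the lines through `x` and a point of `T`. -/
def lineCone (x : E) (T : Set E) : Set E :=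
  (fun q : E × ℝ => x + q.2 • (q.1 - x)) '' (T ×ˢ Set.univ)

theorem IsThin.finrank_pos {T : Set E} (hT : IsThin T) (hne : T.Nonempty) : 0 < finrank ℝ E := by
  obtain ⟨s, hs⟩ := hne
  obtain ⟨L, -, -, h, -⟩ := hT s hs
  omega

variable [FiniteDimensional ℝ E]

/-- The estimate makes `P` injective on `A` with Lipschitz inverse, so `A × ℝ` is a Lipschitz image
of a subset of `L × ℝ`. -/
theorem dimH_prod_univ_le {A : Set E} {L : Submodule ℝ E} (P : E →L[ℝ] L) (C : NNReal)
    (hA : ∀ a ∈ A, ∀ b ∈ A, ‖a - b‖ ≤ C * ‖P (a - b)‖) :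
    dimH (A ×ˢ (Set.univ : Set ℝ)) ≤ (finrank ℝ L + 1 : ℕ) := by
  let σ : L × ℝ → E × ℝ := fun q => (Function.invFunOn P A q.1, q.2)
  have hσ : LipschitzOnWith (max C 1) σ ((P '' A) ×ˢ Set.univ) := by
    refine LipschitzOnWith.of_dist_le_mul ?_
    rintro ⟨_, s⟩ ⟨⟨a, ha, rfl⟩, -⟩ ⟨_, t⟩ ⟨⟨b, hb, rfl⟩, -⟩
    have e1 := Function.invFunOn_eq (f := P) (s := A) ⟨a, ha, rfl⟩
    have m1 := Function.invFunOn_mem (f := P) (s := A) ⟨a, ha, rfl⟩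
    have e2 := Function.invFunOn_eq (f := P) (s := A) ⟨b, hb, rfl⟩
    have m2 := Function.invFunOn_mem (f := P) (s := A) ⟨b, hb, rfl⟩
    have h1 := hA _ m1 _ m2
    rw [map_sub, e1, e2, ← dist_eq_norm, ← dist_eq_norm] at h1
    rw [Prod.dist_eq, Prod.dist_eq]
    have hC : (C : ℝ) ≤ (max C 1 : NNReal) := by simp
    have h1' : (1 : ℝ) ≤ (max C 1 : NNReal) := by simp
    refine max_le ?_ ?_
    · refine h1.trans (mul_le_mul hC (le_max_left _ _) dist_nonneg (by positivity))
    · calc dist s t = 1 * dist s t := (one_mul _).symm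
        _ ≤ _ := mul_le_mul h1' (le_max_right _ _) dist_nonneg (by positivity)
  have hsub : A ×ˢ (Set.univ : Set ℝ) ⊆ σ '' ((P '' A) ×ˢ Set.univ) := by
    rintro ⟨a, s⟩ ⟨ha, -⟩
    refine ⟨(P a, s), ⟨⟨a, ha, rfl⟩, trivial⟩, ?_⟩
    have e1 := Function.invFunOn_eq (f := P) (s := A) ⟨a, ha, rfl⟩
    have m1 := Function.invFunOn_mem (f := P) (s := A) ⟨a, ha, rfl⟩
    have h1 := hA _ m1 _ ha
    rw [map_sub, e1, sub_self, norm_zero, mul_zero] at h1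
    have h2 := sub_eq_zero.1 (norm_le_zero_iff.1 h1)
    exact Prod.ext h2 rfl
  calc dimH (A ×ˢ (Set.univ : Set ℝ)) ≤ dimH (σ '' ((P '' A) ×ˢ Set.univ)) := dimH_mono hsub
    _ ≤ dimH ((P '' A) ×ˢ (Set.univ : Set ℝ)) := hσ.dimH_image_le
    _ ≤ dimH (Set.univ : Set (L × ℝ)) := dimH_mono (Set.subset_univ _)
    _ = (finrank ℝ L + 1 : ℕ) := by rw [Real.dimH_univ_eq_finrank]; simp

/-- Coning adds at most one dimension, because the cone is a smooth image of `T × ℝ`. The graph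
property is local; countably many pieces suffice, and Hausdorff dimension is stable under countable
unions. -/
theorem IsThin.dimH_lineCone {T : Set E} (hT : IsThin T) (x : E) :
    dimH (lineCone x T) ≤ (finrank ℝ E - 1 : ℕ) := by
  choose! L P C hL O hO hP using hT
  obtain ⟨t, htT, htc, hcov⟩ := TopologicalSpace.countable_cover_nhdsWithin hO
  have hsub : lineCone x T ⊆ ⋃ s ∈ t, lineCone x (T ∩ O s) := by
    rintro _ ⟨⟨a, c⟩, ⟨ha, -⟩, rfl⟩
    obtain ⟨s, hs, has⟩ := Set.mem_iUnion₂.1 (hcov ha)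
    exact Set.mem_iUnion₂.2 ⟨s, hs, (a, c), ⟨⟨ha, has⟩, trivial⟩, rfl⟩
  refine (dimH_mono hsub).trans ?_
  rw [dimH_bUnion htc]
  refine iSup₂_le fun s hs => ?_
  have hcd : ContDiff ℝ 1 (fun q : E × ℝ => x + q.2 • (q.1 - x)) := by fun_prop
  refine ((hcd.contDiffOn.dimH_image_le convex_univ (Set.subset_univ _)).trans
    (dimH_prod_univ_le (P s) (C s) (hP s (htT hs)))).trans ?_
  have := hL s (htT hs)
  exact_mod_cast (by omega : finrank ℝ (L s) + 1 ≤ finrank ℝ E - 1)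

theorem dimH_iUnion_lineCone_lt {ι : Type*} [Countable ι] {T : ι → Set E}
    (hT : ∀ i, IsThin (T i)) (hE : 0 < finrank ℝ E) (x : E) :
    dimH (⋃ i, lineCone x (T i)) < finrank ℝ E := by
  rw [dimH_iUnion]
  refine (iSup_le fun i => (hT i).dimH_lineCone x).trans_lt ?_
  exact_mod_cast Nat.sub_lt hE one_pos

/-- The complement of a countable union of thin sets is dense. -/
theorem dense_compl_iUnion_of_isThin {ι : Type*} [Countable ι] {T : ι → Set E}
    (hT : ∀ i, IsThin (T i)) : Dense (⋃ i, T i)ᶜ := by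
  -- A nonempty thin set forces `E` to have positive dimension, as needed for the strict bound; the
  -- empty union is treated apart.
  rcases Set.eq_empty_or_nonempty (⋃ i, T i) with h0 | ⟨s, hs⟩
  · rw [h0, Set.compl_empty]; exact dense_univ
  obtain ⟨i, hi⟩ := Set.mem_iUnion.1 hs
  refine (dense_compl_of_dimH_lt_finrank
    (dimH_iUnion_lineCone_lt hT ((hT i).finrank_pos ⟨s, hi⟩) 0)).mono ?_
  refine Set.compl_subset_compl.2 (Set.iUnion_mono fun j a ha => ?_)
  exact ⟨(a, 1), ⟨ha, trivial⟩, by simp⟩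

/-- Two points of a convex open set can be joined away from a countable union of thin sets. -/
theorem joinedIn_diff_iUnion_of_isThin {ι : Type*} [Countable ι] {T : ι → Set E}
    (hT : ∀ i, IsThin (T i)) {B : Set E} (hB : Convex ℝ B) (hBo : IsOpen B) {x y : E}
    (hx : x ∈ B \ ⋃ i, T i) (hy : y ∈ B \ ⋃ i, T i) : JoinedIn (B \ ⋃ i, T i) x y := by
  rcases Set.eq_empty_or_nonempty (⋃ i, T i) with h0 | ⟨s, hs⟩
  · rw [h0, Set.sdiff_empty]
    exact JoinedIn.of_segment_subset (hB.segment_subset hx.1 hy.1)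
  obtain ⟨i, hi⟩ := Set.mem_iUnion.1 hs
  have hE := (hT i).finrank_pos ⟨s, hi⟩
  have hd : Dense ((⋃ i, lineCone x (T i)) ∪ ⋃ i, lineCone y (T i))ᶜ := by
    refine dense_compl_of_dimH_lt_finrank ?_
    rw [dimH_union]
    exact max_lt (dimH_iUnion_lineCone_lt hT hE x) (dimH_iUnion_lineCone_lt hT hE y)
  -- The segments from `x` and from `y` to a point `z` off both cones cannot meet any `T i`.
  obtain ⟨z, hz, hzd⟩ := hd.exists_mem_open hBo ⟨x, hx.1⟩
  rw [Set.mem_compl_iff, Set.mem_union, not_or] at hz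
  have key : ∀ w, w ∈ B \ ⋃ i, T i → z ∉ ⋃ i, lineCone w (T i) →
      JoinedIn (B \ ⋃ i, T i) w z := by
    intro w hw hzw
    refine JoinedIn.of_segment_subset fun a ha => ⟨hB.segment_subset hw.1 hzd ha, fun haT => ?_⟩
    rw [segment_eq_image'] at ha
    obtain ⟨c, -, rfl⟩ := ha
    obtain ⟨j, hj⟩ := Set.mem_iUnion.1 haT
    have hc : c ≠ 0 := by
      rintro rfl
      simp only [zero_smul, add_zero] at haT
      exact hw.2 haT
    -- If the point at parameter `c` of the segment is in `T j`, then `z` is on the line through `w`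
    -- and that point, at parameter `c⁻¹`.
    refine hzw (Set.mem_iUnion.2 ⟨j, (w + c • (z - w), c⁻¹), ⟨hj, trivial⟩, ?_⟩)
    simp [smul_smul, hc]
  exact (key x hx hz.1).trans (key y hy hz.2).symm

end Thin

/-! ### Fixed points of maps with complex linear derivative. -/

section FixedSet

open Module Topology

variable {E : Type*} [NormedAddCommGroup E] [InnerProductSpace ℝ E] [FiniteDimensional ℝ E]

/-- The range of `A` is stable under `J`: with `A v ≠ 0` it contains the independent vectors `A v`
and `J (A v)`. -/
theorem finrank_ker_add_two_le {A J : E →L[ℝ] E} (hJ : ∀ v, J (J v) = -v)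
    (hcomm : ∀ v, A (J v) = J (A v)) (hA : A ≠ 0) :
    finrank ℝ (LinearMap.ker (A : E →ₗ[ℝ] E)) + 2 ≤ finrank ℝ E := by
  obtain ⟨v, hv⟩ : ∃ v, A v ≠ 0 := by
    by_contra! h
    exact hA (ContinuousLinearMap.ext h)
  have hli : LinearIndependent ℝ ![A v, A (J v)] := by
    rw [LinearIndependent.pair_iff]
    intro s t hst
    rw [hcomm] at hst
    have h1 := congrArg J hst
    simp only [map_add, map_smul, hJ, map_zero] at h1
    have h2 : (s ^ 2 + t ^ 2) • A v = 0 := by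
      have : (s ^ 2 + t ^ 2) • A v
          = s • (s • A v + t • J (A v)) - t • (s • J (A v) + t • -A v) := by module
      rw [this, hst, h1]; simp
    have h3 : s ^ 2 + t ^ 2 = 0 := (smul_eq_zero.1 h2).resolve_right hv
    constructor <;> nlinarith [sq_nonneg s, sq_nonneg t]
  have hrange : 2 ≤ finrank ℝ (LinearMap.range (A : E →ₗ[ℝ] E)) := by
    let w : Fin 2 → LinearMap.range (A : E →ₗ[ℝ] E) :=
      ![⟨A v, v, rfl⟩, ⟨A (J v), J v, rfl⟩]
    have hw : LinearIndependent ℝ w := by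
      refine LinearIndependent.of_comp (LinearMap.range (A : E →ₗ[ℝ] E)).subtype ?_
      convert hli using 1
      funext i
      fin_cases i <;> rfl
    simpa using hw.fintype_card_le_finrank
  have := LinearMap.finrank_range_add_finrank_ker (A : E →ₗ[ℝ] E)
  omega

/-- The fixed points of a map that commutes to first order with complex structures form a thin set,
if the derivative at these points is not the identity. -/
theorem isThin_of_fixed {T : Set E} {f : E → E} (hf : ∀ s ∈ T, f s = s)
    (hd : ∀ s ∈ T, ∃ B J : E →L[ℝ] E, HasStrictFDerivAt f B s ∧ (∀ v, J (J v) = -v) ∧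
      (∀ v, B (J v) = J (B v)) ∧ B ≠ ContinuousLinearMap.id ℝ E) : IsThin T := by
  intro s hs
  obtain ⟨B, J, hB, hJ, hc, hne⟩ := hd s hs
  set A := B - ContinuousLinearMap.id ℝ E with hAdef
  set K : Submodule ℝ E := LinearMap.ker (A : E →ₗ[ℝ] E) with hK
  let P : E →L[ℝ] K := K.orthogonalProjectionOnto
  -- `P` projects onto the kernel of `A`, so `(P, A)` is injective and bounds `‖a - b‖` by the two
  -- images.
  obtain ⟨C, hC0, hC⟩ : ∃ C : NNReal, 0 < C ∧ AntilipschitzWith C (P.prod A) := by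
    have hker : LinearMap.ker ((P.prod A : E →L[ℝ] K × E) : E →ₗ[ℝ] K × E) = ⊥ := by
      rw [LinearMap.ker_eq_bot']
      intro v hv
      have h1 : P v = 0 := congrArg Prod.fst hv
      have h2 : v ∈ K := congrArg Prod.snd hv
      have h3 : (P v : E) = v := K.starProjection_eq_self_iff.2 h2
      rw [← h3, h1]; rfl
    exact LinearMap.exists_antilipschitzWith _ hker
  have hstrict : HasStrictFDerivAt (fun z => f z - z) A s := hB.sub (hasStrictFDerivAt_id s)
  -- At fixed points `f z - z` vanishes, so `‖A (a - b)‖` is at most this constant times `‖a - b‖`.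
  -- After multiplication by `C` it is half of `‖a - b‖` and is absorbed, which leaves the Lipschitz
  -- constant `2 * C`.
  have happ := hstrict.approximates_deriv_on_nhds (c := (2 * C)⁻¹) (Or.inr (by positivity))
  obtain ⟨O, hO, happ⟩ := happ
  refine ⟨K, P, 2 * C, ?_, O, mem_nhdsWithin_of_mem_nhds hO, ?_⟩
  · refine finrank_ker_add_two_le (A := A) hJ (fun v => ?_) (sub_ne_zero.2 hne)
    simp [hAdef, hc]
  · intro a ha b hb
    have h1 := happ a ha.2 b hb.2
    simp only [hf a ha.1, hf b hb.1, sub_self, zero_sub, norm_neg] at h1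
    have h2 := hC.le_mul_dist a b
    rw [dist_eq_norm, dist_eq_norm, ← map_sub] at h2
    have h3 : ‖P.prod A (a - b)‖ ≤ max ‖P (a - b)‖ ((2 * C : ℝ)⁻¹ * ‖a - b‖) := by
      rw [ContinuousLinearMap.prod_apply, Prod.norm_def]
      refine max_le_max le_rfl ?_
      simpa using h1
    have hC0' : (0 : ℝ) < C := by exact_mod_cast hC0
    have h4 : ‖a - b‖ ≤ C * max ‖P (a - b)‖ ((2 * C : ℝ)⁻¹ * ‖a - b‖) :=
      h2.trans (mul_le_mul_of_nonneg_left h3 hC0'.le)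
    push_cast
    have hn := norm_nonneg (P (a - b))
    rcases max_choice ‖P (a - b)‖ ((2 * C : ℝ)⁻¹ * ‖a - b‖) with h5 | h5
    · rw [h5] at h4
      nlinarith
    · rw [h5] at h4
      have h6 : (C : ℝ) * ((2 * C : ℝ)⁻¹ * ‖a - b‖) = ‖a - b‖ / 2 := by field_simp
      rw [h6] at h4
      have h7 : ‖a - b‖ ≤ 0 := by linarith
      exact h7.trans (by positivity)

end FixedSet

/-! ### Torsion elements in closed subgroups of a torus. -/

section TorusTorsion

/-- An element of infinite order generates a dense subgroup, so `G` is the whole circle and contains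
the class of `1/2`. An element of finite order serves itself. -/
theorem exists_torsion_mem_of_isClosed_circle {G : AddSubgroup UnitAddCircle}
    (hG : IsClosed (G : Set UnitAddCircle)) {c : UnitAddCircle} (hc : c ∈ G) (hc0 : c ≠ 0) :
    ∃ a ∈ G, a ≠ 0 ∧ ∃ m : ℕ, 0 < m ∧ m • a = 0 := by
  by_cases ho : addOrderOf c = 0
  · have hd : DenseRange (· • c : ℤ → UnitAddCircle) := AddCircle.denseRange_zsmul_iff.2 ho
    have hsub : Set.range (· • c : ℤ → UnitAddCircle) ⊆ G := by
      rintro _ ⟨k, rfl⟩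
      exact G.zsmul_mem hc k
    have htop : (G : Set UnitAddCircle) = Set.univ := by
      rw [← hG.closure_eq]; exact (hd.mono hsub).closure_eq
    refine ⟨((1 / 2 : ℝ) : UnitAddCircle), by rw [← SetLike.mem_coe, htop]; trivial, ?_, 2,
      by norm_num, ?_⟩
    · intro h
      rw [AddCircle.coe_eq_zero_iff] at h
      obtain ⟨k, hk⟩ := h
      have h2 : (2 * k : ℤ) = 1 := by
        have : (2 * (k : ℝ)) = 1 := by simp at hk; linarith
        exact_mod_cast this
      omega
    · rw [← AddCircle.coe_nsmul]
      simp only [nsmul_eq_mul]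
      norm_num
  · exact ⟨c, hc, hc0, addOrderOf c, Nat.pos_of_ne_zero ho, addOrderOf_nsmul_eq_zero c⟩

/-- A nontrivial closed subgroup of a torus contains a nontrivial torsion element. -/
theorem exists_torsion_mem_of_isClosed {n : ℕ} {G : AddSubgroup (Torus n)}
    (hG : IsClosed (G : Set (Torus n))) {c : Torus n} (hc : c ∈ G) (hc0 : c ≠ 0) :
    ∃ a ∈ G, a ≠ 0 ∧ ∃ m : ℕ, 0 < m ∧ m • a = 0 := by
  induction n with
  | zero => exact absurd (Subsingleton.elim c 0) hc0
  | succ n ih =>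
    let ι : UnitAddCircle →+ Torus (n + 1) := AddMonoidHom.single (fun _ => UnitAddCircle) 0
    let ρ : Torus (n + 1) →+ Torus n :=
      { toFun := fun a i => a i.succ, map_zero' := rfl, map_add' := fun _ _ => rfl }
    have hι : Continuous ι := continuous_single (A := fun _ : Fin (n + 1) => UnitAddCircle) 0
    have hρ : Continuous ρ := continuous_pi fun i => continuous_apply _
    -- Either `G` meets the first circle factor nontrivially, or the projection `ρ` to the other
    -- factors is injective on `G`. In the second case `G.map ρ` is closed by compactness, and
    -- torsion lifts by injectivity.
    by_cases hker : ∃ d ∈ G.comap ι, d ≠ 0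
    · obtain ⟨d, hd, hd0⟩ := hker
      obtain ⟨a, ha, ha0, m, hm, hma⟩ :=
        exists_torsion_mem_of_isClosed_circle (G := G.comap ι) (hG.preimage hι) hd hd0
      refine ⟨ι a, ha, fun h => ha0 ?_, m, hm, by rw [← map_nsmul, hma, map_zero]⟩
      have := congrFun h 0
      simpa [ι] using this
    · push Not at hker
      have hinj : ∀ a ∈ G, ρ a = 0 → a = 0 := by
        intro a ha h
        have h1 : ι (a 0) = a := by
          funext i
          refine Fin.cases ?_ (fun j => ?_) i
          · simp [ι]
          · have := congrFun h j
            simp only [ρ, AddMonoidHom.coe_mk, ZeroHom.coe_mk] at this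
            simp [ι, this]
        have h2 := hker (a 0) (by rw [AddSubgroup.mem_comap, h1]; exact ha)
        rw [← h1, h2, map_zero]
      have hcl : IsClosed ((G.map ρ : AddSubgroup (Torus n)) : Set (Torus n)) := by
        rw [AddSubgroup.coe_map]
        exact (hG.isCompact.image hρ).isClosed
      obtain ⟨_, ⟨a, ha, rfl⟩, ha0, m, hm, hma⟩ := ih hcl (c := ρ c) ⟨c, hc, rfl⟩
        (fun h => hc0 (hinj c hc h))
      refine ⟨a, ha, fun h => ha0 (by rw [h, map_zero]), m, hm, hinj _ (G.nsmul_mem ha m) ?_⟩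
      rw [map_nsmul, hma]

theorem countable_torsion (n : ℕ) : {a : Torus n | ∃ m : ℕ, 0 < m ∧ m • a = 0}.Countable := by
  have : {a : Torus n | ∃ m : ℕ, 0 < m ∧ m • a = 0}
      ⊆ ⋃ m : ℕ, Set.pi Set.univ fun _ => {u : UnitAddCircle | (m + 1) • u = 0} := by
    rintro a ⟨m, hm, hma⟩
    refine Set.mem_iUnion.2 ⟨m - 1, fun i _ => ?_⟩
    rw [Nat.sub_add_cancel hm]
    exact congrFun hma i
  refine Set.Countable.mono this (Set.countable_iUnion fun m => Set.Finite.countable ?_)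
  exact Set.Finite.pi fun _ => AddCircle.finite_torsion (1 : ℝ) m.succ_pos

end TorusTorsion

/-! ### The covering ℝⁿ → ℝⁿ/ℤⁿ. -/

section ToTorus

variable {n : ℕ}

theorem toTorus_zero : toTorus (0 : Vec n) = 0 := by
  funext i; simp [toTorus]

theorem toTorus_add (s t : Vec n) : toTorus (s + t) = toTorus s + toTorus t := by
  funext i; simp [toTorus]

theorem toTorus_eq_zero_iff {t : Vec n} : toTorus t = 0 ↔ ∃ k : Fin n → ℤ, ∀ i, t i = k i := by
  constructor
  · intro h
    have h1 : ∀ i, ∃ k : ℤ, t i = k := by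
      intro i
      have := congrFun h i
      simp only [toTorus, Pi.zero_apply] at this
      rw [AddCircle.coe_eq_zero_iff] at this
      obtain ⟨k, hk⟩ := this
      exact ⟨k, by rw [← hk]; simp⟩
    choose k hk using h1
    exact ⟨k, hk⟩
  · rintro ⟨k, hk⟩
    funext i
    simp only [toTorus, hk, Pi.zero_apply]
    rw [AddCircle.coe_eq_zero_iff]
    exact ⟨k i, by simp⟩

theorem isOpenQuotientMap_toTorus : IsOpenQuotientMap (toTorus : Vec n → Torus n) := by
  have h1 : IsOpenQuotientMap (Pi.map (fun _ => ((↑) : ℝ → UnitAddCircle)) :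
      (Fin n → ℝ) → (Fin n → UnitAddCircle)) :=
    IsOpenQuotientMap.piMap fun _ => QuotientAddGroup.isOpenQuotientMap_mk
  exact h1.comp (EuclideanSpace.equiv (Fin n) ℝ).toHomeomorph.isOpenQuotientMap

theorem toTorus_surjective : Function.Surjective (toTorus : Vec n → Torus n) :=
  isOpenQuotientMap_toTorus.surjective

/-- If `ξ i ≠ 0`, the time `1 / (2 ξ i)` makes the coordinate `i` equal to `1/2`, which is not an
integer. -/
theorem eq_zero_of_forall_toTorus_smul {ξ : Vec n} (h : ∀ s : ℝ, toTorus (s • ξ) = 0) : ξ = 0 := by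
  ext i
  by_contra hi
  simp only [PiLp.zero_apply] at hi
  obtain ⟨k, hk⟩ := toTorus_eq_zero_iff.1 (h (1 / (2 * ξ i)))
  have h1 := hk i
  simp only [PiLp.smul_apply, smul_eq_mul] at h1
  have h2 : (1 / (2 * ξ i)) * ξ i = 1 / 2 := by field_simp
  rw [h2] at h1
  have h3 : (2 * k i : ℤ) = 1 := by
    have : (2 * (k i : ℝ)) = 1 := by linarith
    exact_mod_cast this
  omega

end ToTorus

/-! ### Fundamental vector fields of a smooth torus action. -/

section Action

variable {n : ℕ} {E : Type*} [NormedAddCommGroup E] [NormedSpace ℝ E]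
  {H : Type*} [TopologicalSpace H] {I : ModelWithCorners ℝ E H}
  {N : Type*} [AddAction (Torus n) N]

theorem toTorus_add_vadd (s t : Vec n) (q : N) :
    toTorus (s + t) +ᵥ q = toTorus s +ᵥ (toTorus t +ᵥ q) := by
  rw [toTorus_add, add_vadd]

variable [TopologicalSpace N] [ChartedSpace H N]

theorem contMDiff_vadd (hs : IsSmoothTorusAction n I N) (a : Torus n) :
    ContMDiff I I ∞ (fun q : N => a +ᵥ q) := by
  obtain ⟨t, rfl⟩ := toTorus_surjective a
  exact ContMDiff.comp (g := fun q : Vec n × N => toTorus q.1 +ᵥ q.2) (f := fun q : N => (t, q))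
    hs (contMDiff_const.prodMk contMDiff_id)

theorem contMDiff_orbit (hs : IsSmoothTorusAction n I N) (q : N) :
    ContMDiff 𝓘(ℝ, Vec n) I ∞ (fun t : Vec n => toTorus t +ᵥ q) :=
  ContMDiff.comp (g := fun q : Vec n × N => toTorus q.1 +ᵥ q.2) (f := fun t : Vec n => (t, q))
    hs (contMDiff_id.prodMk contMDiff_const)

theorem hasMFDerivAt_vadd (hs : IsSmoothTorusAction n I N) (a : Torus n) (q : N) :
    HasMFDerivAt I I (fun q : N => a +ᵥ q) q (mfderiv I I (fun q : N => a +ᵥ q) q) :=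
  ((contMDiff_vadd hs a).mdifferentiable (by simp) q).hasMFDerivAt

theorem hasMFDerivAt_orbit_zero (hs : IsSmoothTorusAction n I N) (q : N) :
    HasMFDerivAt 𝓘(ℝ, Vec n) I (fun t : Vec n => toTorus t +ᵥ q) 0 (fundamental I q) :=
  ((contMDiff_orbit hs q).mdifferentiable (by simp) 0).hasMFDerivAt

theorem hasMFDerivAt_orbit (hs : IsSmoothTorusAction n I N) (q : N) (t : Vec n) :
    HasMFDerivAt 𝓘(ℝ, Vec n) I (fun t : Vec n => toTorus t +ᵥ q) t
      (fundamental I (toTorus t +ᵥ q)) := by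
  have h1 : HasMFDerivAt 𝓘(ℝ, Vec n) 𝓘(ℝ, Vec n) (fun s : Vec n => s - t) t
      (ContinuousLinearMap.id ℝ (Vec n)) :=
    ((hasFDerivAt_id t).sub_const t).hasMFDerivAt
  have h2 : HasMFDerivAt 𝓘(ℝ, Vec n) I (fun s : Vec n => toTorus s +ᵥ (toTorus t +ᵥ q)) (t - t)
      (fundamental I (toTorus t +ᵥ q)) := by
    rw [sub_self]; exact hasMFDerivAt_orbit_zero hs _
  have h3 := HasMFDerivAt.comp (f := fun s : Vec n => s - t) t h2 h1
  have h4 : (fun s : Vec n => toTorus s +ᵥ (toTorus t +ᵥ q)) ∘ (fun s : Vec n => s - t)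
      = fun s => toTorus s +ᵥ q := by
    funext s
    simp only [Function.comp_apply]
    rw [← toTorus_add_vadd, sub_add_cancel]
  rw [h4] at h3
  exact h3

/-- Commutativity of the torus: `a` maps the orbit curve through `q` to the one through `a +ᵥ q`
with the same parameter. -/
theorem mfderiv_vadd_fundamental (hs : IsSmoothTorusAction n I N) (a : Torus n) (q : N)
    (ξ : Vec n) : mfderiv I I (fun q : N => a +ᵥ q) q (fundamental I q ξ)
      = fundamental I (a +ᵥ q) ξ := by
  have h0 : toTorus (0 : Vec n) +ᵥ q = q := by rw [toTorus_zero, zero_vadd]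
  have h1 : HasMFDerivAt I I (fun q : N => a +ᵥ q) (toTorus (0 : Vec n) +ᵥ q)
      (mfderiv I I (fun q : N => a +ᵥ q) q) := by
    rw [h0]; exact hasMFDerivAt_vadd hs a q
  have h3 := HasMFDerivAt.comp (f := fun t : Vec n => toTorus t +ᵥ q) 0 h1
    (hasMFDerivAt_orbit_zero hs q)
  have h4 : (fun q : N => a +ᵥ q) ∘ (fun t : Vec n => toTorus t +ᵥ q)
      = fun t : Vec n => toTorus t +ᵥ (a +ᵥ q) := by
    funext t
    simp only [Function.comp_apply]
    rw [← add_vadd, ← add_vadd, add_comm]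
  rw [h4] at h3
  exact DFunLike.congr_fun (hasMFDerivAt_unique h3 (hasMFDerivAt_orbit_zero hs (a +ᵥ q))) ξ

theorem isMIntegralCurve_orbit (hs : IsSmoothTorusAction n I N) (ξ : Vec n) (q : N) :
    IsMIntegralCurve (I := I) (fun s : ℝ => toTorus (s • ξ) +ᵥ q)
      (fun q => fundamental I q ξ) := by
  intro s
  have h1 : HasMFDerivAt 𝓘(ℝ, ℝ) 𝓘(ℝ, Vec n) (fun s : ℝ => s • ξ) s
      ((1 : ℝ →L[ℝ] ℝ).smulRight ξ) := by
    have := (hasFDerivAt_id (𝕜 := ℝ) s).smul_const ξ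
    exact this.hasMFDerivAt
  have h3 := HasMFDerivAt.comp (f := fun s : ℝ => s • ξ) s (hasMFDerivAt_orbit hs q (s • ξ)) h1
  refine h3.congr_mfderiv (ContinuousLinearMap.ext_ring ?_)
  exact (fundamental I (toTorus (s • ξ) +ᵥ q)).map_smul (1 : ℝ) ξ

theorem isClosed_stabilizer (hs : IsSmoothTorusAction n I N) [T2Space N] (q : N) :
    IsClosed (AddAction.stabilizer (Torus n) q : Set (Torus n)) := by
  rw [← isOpenQuotientMap_toTorus.isQuotientMap.isClosed_preimage]
  have : toTorus ⁻¹' (AddAction.stabilizer (Torus n) q : Set (Torus n))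
      = {t : Vec n | toTorus t +ᵥ q = q} := by
    ext t; simp [AddAction.mem_stabilizer_iff]
  rw [this]
  exact isClosed_eq (contMDiff_orbit hs q).continuous continuous_const

variable [IsManifold I ∞ N]

/-- The field is the tangent map of the action evaluated on the smooth section `q ↦ (ξ, 0)` over
`(0, q)`. -/
theorem isSmoothVectorField_fundamental (hs : IsSmoothTorusAction n I N) (ξ : Vec n) :
    IsSmoothVectorField (I := I) (fun q : N => fundamental I q ξ) := by
  have : IsManifold I 1 N := .of_le (n := ∞) (by simp)
  have hsec : ContMDiff I (𝓘(ℝ, Vec n).prod I).tangent ∞ (fun q : N =>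
      (equivTangentBundleProd 𝓘(ℝ, Vec n) (Vec n) I N).symm
        ((⟨(0 : Vec n), ξ⟩ : TangentBundle 𝓘(ℝ, Vec n) (Vec n)),
          (⟨q, 0⟩ : TangentBundle I N))) := by
    have := IsManifold.of_le (n := ∞) (m := ∞ + 1) (I := I) (M := N) (by simp)
    refine (contMDiff_equivTangentBundleProd_symm (n := ∞)).comp (contMDiff_const.prodMk ?_)
    exact Bundle.contMDiff_zeroSection ℝ (TangentSpace I)
  have h1 := (ContMDiff.contMDiff_tangentMap (m := ∞) hs (by simp)).comp hsec
  refine h1.congr fun q => ?_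
  have h0 : toTorus (0 : Vec n) +ᵥ q = q := by rw [toTorus_zero, zero_vadd]
  have h2 : MDifferentiableAt (𝓘(ℝ, Vec n).prod I) I
    (fun q : Vec n × N => toTorus q.1 +ᵥ q.2) (0, q) := hs.mdifferentiable (by simp) _
  have h3 : (fundamental I q ξ : E) = mfderiv (𝓘(ℝ, Vec n).prod I) I
      (fun q : Vec n × N => toTorus q.1 +ᵥ q.2) (0, q) (ξ, 0) := by
    have h4 := mfderiv_comp (f := fun t : Vec n => (t, q)) (0 : Vec n) h2
      (mdifferentiableAt_id.prodMk mdifferentiableAt_const)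
    rw [mfderiv_prod_left] at h4
    exact DFunLike.congr_fun h4 ξ
  show (⟨q, fundamental I q ξ⟩ : TangentBundle I N) = ⟨toTorus (0 : Vec n) +ᵥ q,
    mfderiv (𝓘(ℝ, Vec n).prod I) I (fun q : Vec n × N => toTorus q.1 +ᵥ q.2) (0, q) (ξ, 0)⟩
  rw [← h3]
  exact congrArg (fun z : N => (⟨z, (fundamental I q ξ : E)⟩ : TangentBundle I N)) h0.symm

end Action

/-! ### Vector fields and their brackets read in a chart. -/

section Chart

open Topology

variable {E : Type*} [NormedAddCommGroup E] [NormedSpace ℝ E]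
  {H : Type*} [TopologicalSpace H] {I : ModelWithCorners ℝ E H}
  {N : Type*} [TopologicalSpace N] [ChartedSpace H N] [IsManifold I ∞ N]

theorem contMDiffAt_chart (q : N) {q' : N} (hq : q' ∈ (extChartAt I q).source) :
    ContMDiffAt I 𝓘(ℝ, E) ∞ (extChartAt I q) q' :=
  contMDiffAt_extChartAt' (by simpa using hq)

/-- The derivative of the chart at `q`. -/
noncomputable def dchart (I : ModelWithCorners ℝ E H) (q r : N) : E →L[ℝ] E :=
  mfderiv I 𝓘(ℝ, E) (extChartAt I q) r

/-- The derivative of the inverse of the chart at `q`. -/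
noncomputable def dchartSymm (I : ModelWithCorners ℝ E H) (q : N) (z : E) : E →L[ℝ] E :=
  mfderiv 𝓘(ℝ, E) I (extChartAt I q).symm z

theorem hasMFDerivAt_chart (q : N) {q' : N} (hq : q' ∈ (extChartAt I q).source) :
    HasMFDerivAt I 𝓘(ℝ, E) (extChartAt I q) q' (dchart I q q' :) :=
  ((contMDiffAt_chart q hq).mdifferentiableAt (by simp)).hasMFDerivAt

variable [I.Boundaryless]

theorem contMDiffAt_chart_symm (q : N) {z : E} (hz : z ∈ (extChartAt I q).target) :
    ContMDiffAt 𝓘(ℝ, E) I ∞ (extChartAt I q).symm z :=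
  (contMDiffOn_extChartAt_symm q).contMDiffAt ((isOpen_extChartAt_target q).mem_nhds hz)

theorem hasMFDerivAt_chart_symm (q : N) {z : E} (hz : z ∈ (extChartAt I q).target) :
    HasMFDerivAt 𝓘(ℝ, E) I (extChartAt I q).symm z (dchartSymm I q z :) :=
  ((contMDiffAt_chart_symm q hz).mdifferentiableAt (by simp)).hasMFDerivAt

theorem dchart_dchartSymm (q : N) {z : E} (hz : z ∈ (extChartAt I q).target) (v : E) :
    dchart I q ((extChartAt I q).symm z) (dchartSymm I q z v) = v := by
  have : IsManifold I 1 N := .of_le (n := ∞) (by simp)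
  have h := mfderiv_extChartAt_comp_mfderivWithin_extChartAt_symm (I := I) hz
  rw [I.range_eq_univ, mfderivWithin_univ] at h
  exact DFunLike.congr_fun h v

theorem dchartSymm_dchart (q : N) {z : E} (hz : z ∈ (extChartAt I q).target) (v : E) :
    dchartSymm I q z (dchart I q ((extChartAt I q).symm z) v) = v := by
  have : IsManifold I 1 N := .of_le (n := ∞) (by simp)
  have h := mfderivWithin_extChartAt_symm_comp_mfderiv_extChartAt (I := I) hz
  rw [I.range_eq_univ, mfderivWithin_univ] at h
  exact DFunLike.congr_fun h v

theorem dchartSymm_dchart' (q : N) {q' : N} (hq : q' ∈ (extChartAt I q).source) (v : E) :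
    dchartSymm I q (extChartAt I q q') (dchart I q q' v) = v := by
  have h := dchartSymm_dchart (I := I) q ((extChartAt I q).map_source hq) v
  rwa [(extChartAt I q).left_inv hq] at h

theorem isInvertible_dchartSymm (q : N) {z : E} (hz : z ∈ (extChartAt I q).target) :
    (dchartSymm I q z).IsInvertible :=
  ContinuousLinearMap.IsInvertible.of_inverse (g := dchart I q ((extChartAt I q).symm z))
    (ContinuousLinearMap.ext fun v => dchartSymm_dchart q hz v)
    (ContinuousLinearMap.ext fun v => dchart_dchartSymm q hz v)

/-- The expression of a vector field in the chart at `q`. -/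
noncomputable def chartField (q : N) (V : (p : N) → TangentSpace I p) (z : E) : E :=
  dchart I q ((extChartAt I q).symm z) (V ((extChartAt I q).symm z))

theorem chartField_eq_mpullback (q : N) (V : (p : N) → TangentSpace I p) {z : E}
    (hz : z ∈ (extChartAt I q).target) :
    VectorField.mpullback 𝓘(ℝ, E) I (extChartAt I q).symm V z = chartField q V z := by
  have h := (isInvertible_dchartSymm (I := I) q hz).inverse_apply_self (chartField q V z)
  exact (congrArg (dchartSymm I q z).inverse
    (dchartSymm_dchart q hz (V ((extChartAt I q).symm z)))).symm.trans h

theorem contDiffOn_chartField [CompleteSpace E] (q : N) {V : (p : N) → TangentSpace I p}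
    (hV : IsSmoothVectorField V) :
    ContDiffOn ℝ ∞ (chartField q V) (extChartAt I q).target := by
  intro z hz
  refine ContDiffAt.contDiffWithinAt ?_
  have h1 := ContMDiffAt.mpullback_vectorField_preimage (m := ∞) (n := ∞)
    (hV ((extChartAt I q).symm z)) (contMDiffAt_chart_symm q hz)
    (isInvertible_dchartSymm (I := I) q hz :) (by simp)
  have h2 := (contMDiff_snd_tangentBundle_modelSpace (n := ∞) E 𝓘(ℝ, E)).contMDiffAt.comp z h1
  refine (contMDiffAt_iff_contDiffAt.1 h2).congr_of_eventuallyEq ?_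
  filter_upwards [(isOpen_extChartAt_target q).mem_nhds hz] with w hw
  exact (chartField_eq_mpullback q V hw).symm

theorem lieBracket_chartField [CompleteSpace E] (q : N) {V W : (p : N) → TangentSpace I p}
    (hV : IsSmoothVectorField V) (hW : IsSmoothVectorField W) {z : E}
    (hz : z ∈ (extChartAt I q).target) :
    VectorField.lieBracket ℝ (chartField q V) (chartField q W) z
      = chartField q (VectorField.mlieBracket I V W) z := by
  have : IsManifold I (minSmoothness ℝ 3) N := .of_le (n := ∞) (by simp; exact ENat.LEInfty.out)
  have h1 := VectorField.mpullback_mlieBracket (n := ∞) (f := (extChartAt I q).symm)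
    (I := 𝓘(ℝ, E)) (I' := I) (x₀ := z) (V := V) (W := W)
    ((hV _).mdifferentiableAt (by simp)) ((hW _).mdifferentiableAt (by simp))
    (contMDiffAt_chart_symm q hz) (by simp; exact ENat.LEInfty.out)
  rw [chartField_eq_mpullback q _ hz] at h1
  have h2 : ∀ V' W' : E → E, VectorField.mlieBracket 𝓘(ℝ, E) V' W' z
      = VectorField.lieBracket ℝ V' W' z := by
    intro V' W'
    rw [← VectorField.lieBracketWithin_univ]
    exact congrFun (VectorField.mlieBracketWithin_eq_lieBracketWithin (s := Set.univ)) z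
  rw [h1]
  refine Eq.trans ?_ (h2 _ _).symm
  have hev : ∀ V : (p : N) → TangentSpace I p,
      chartField q V =ᶠ[𝓝 z] VectorField.mpullback 𝓘(ℝ, E) I (extChartAt I q).symm V := by
    intro V
    filter_upwards [(isOpen_extChartAt_target q).mem_nhds hz] with w hw
    exact (chartField_eq_mpullback q V hw).symm
  exact (hev V).lieBracket_vectorField_eq (hev W)

theorem chartField_eq_zero_iff (q : N) (V : (p : N) → TangentSpace I p) {z : E}
    (hz : z ∈ (extChartAt I q).target) :
    chartField q V z = 0 ↔ V ((extChartAt I q).symm z) = 0 := by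
  constructor
  · intro h
    have h1 := dchartSymm_dchart q hz (V ((extChartAt I q).symm z))
    rw [chartField] at h
    rw [h, map_zero] at h1
    exact h1.symm
  · intro h
    rw [chartField, h]
    exact map_zero (dchart I q _)

end Chart

/-! ### Invariance under a flow and the Lie bracket. -/

section FlowBracket

open Topology

variable {E : Type*} [NormedAddCommGroup E] [NormedSpace ℝ E]

/-- A vector field that is invariant under the flow of `V` commutes with `V`. -/
theorem lieBracket_eq_zero_of_flow {G : ℝ × E → E} {V W : E → E} {z₀ : E}
    (hG : ContDiffAt ℝ 2 G (0, z₀)) (hG0 : G (0, z₀) = z₀)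
    (hV : ∀ᶠ z in 𝓝 z₀, V z = fderiv ℝ G (0, z) (1, 0)) (hW : DifferentiableAt ℝ W z₀)
    (hinv : ∀ᶠ t in 𝓝 (0 : ℝ), W (G (t, z₀)) = fderiv ℝ G (t, z₀) (0, W z₀)) :
    VectorField.lieBracket ℝ V W z₀ = 0 := by
  have hGd : HasFDerivAt G (fderiv ℝ G (0, z₀)) (0, z₀) :=
    (hG.differentiableAt (by simp)).hasFDerivAt
  have hG2 : HasFDerivAt (fderiv ℝ G) (fderiv ℝ (fderiv ℝ G) (0, z₀)) (0, z₀) :=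
    ((hG.fderiv_right (m := 1) (by norm_num)).differentiableAt (by simp)).hasFDerivAt
  -- Both terms of the bracket will be mixed second derivatives of `G`, in time and in the direction
  -- `W z₀`.
  have hsymm := (hG.isSymmSndFDerivAt (by simp)).eq ((1 : ℝ), (0 : E)) ((0 : ℝ), W z₀)
  -- the derivative of `V`
  have h1 : HasFDerivAt (fun z : E => ((0 : ℝ), z)) (ContinuousLinearMap.inr ℝ ℝ E) z₀ :=
    hasFDerivAt_prodMk_right 0 z₀
  have h2 : fderiv ℝ V z₀ (W z₀) = fderiv ℝ (fderiv ℝ G) (0, z₀) (0, W z₀) (1, 0) := by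
    have h3 := ((hG2.comp z₀ h1).clm_apply (hasFDerivAt_const ((1 : ℝ), (0 : E)) z₀))
    have h4 : V =ᶠ[𝓝 z₀] fun z => (fderiv ℝ G ∘ fun z : E => ((0 : ℝ), z)) z (1, 0) := hV
    rw [h4.fderiv_eq, h3.fderiv]
    simp
  -- the derivative of the invariance relation
  have h5 : HasDerivAt (fun t : ℝ => (t, z₀)) ((1 : ℝ), (0 : E)) 0 :=
    (hasDerivAt_id (0 : ℝ)).prodMk (hasDerivAt_const 0 z₀)
  have h6 : HasDerivAt (fun t : ℝ => G (t, z₀)) (V z₀) 0 := by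
    rw [hV.self_of_nhds]
    exact hGd.comp_hasDerivAt (0 : ℝ) h5
  have h7 : HasDerivAt (fun t : ℝ => W (G (t, z₀))) (fderiv ℝ W z₀ (V z₀)) 0 := by
    have hW' : HasFDerivAt W (fderiv ℝ W z₀) (G (0, z₀)) := by rw [hG0]; exact hW.hasFDerivAt
    exact hW'.comp_hasDerivAt (0 : ℝ) h6
  have h8 : HasDerivAt (fun t : ℝ => fderiv ℝ G (t, z₀) (0, W z₀))
      (fderiv ℝ (fderiv ℝ G) (0, z₀) (1, 0) (0, W z₀)) 0 := by
    have h9 := hG2.comp_hasDerivAt (0 : ℝ) h5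
    simpa using h9.clm_apply (hasDerivAt_const (0 : ℝ) ((0 : ℝ), W z₀))
  have h10 := h7.unique (h8.congr_of_eventuallyEq hinv)
  rw [VectorField.lieBracket, h10, h2, hsymm, sub_self]

end FlowBracket

/-! ### Curves and self-maps read in a chart. -/

section ChartMaps

open Topology

variable {E : Type*} [NormedAddCommGroup E] [NormedSpace ℝ E]
  {H : Type*} [TopologicalSpace H] {I : ModelWithCorners ℝ E H}
  {N : Type*} [TopologicalSpace N] [ChartedSpace H N] [IsManifold I ∞ N]

theorem hasDerivAt_chart_comp (q : N) {γ : ℝ → N} {t : ℝ} {v : E}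
    (hγ : HasMFDerivAt 𝓘(ℝ, ℝ) I γ t ((1 : ℝ →L[ℝ] ℝ).smulRight v :))
    (ht : γ t ∈ (extChartAt I q).source) :
    HasDerivAt (fun s => extChartAt I q (γ s)) (dchart I q (γ t) v) t := by
  have h1 : HasFDerivAt (fun s => extChartAt I q (γ s))
      (dchart I q (γ t) ∘L (1 : ℝ →L[ℝ] ℝ).smulRight v) t :=
    ((hasMFDerivAt_chart q ht).comp t hγ).hasFDerivAt
  refine h1.hasDerivAt.congr_deriv ?_
  show dchart I q (γ t) ((1 : ℝ) • v) = _
  rw [one_smul]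

variable [I.Boundaryless]

theorem hasFDerivAt_chart_conj (q : N) {f : N → N} {z : E} {D : E →L[ℝ] E}
    (hz : z ∈ (extChartAt I q).target)
    (hf : HasMFDerivAt I I f ((extChartAt I q).symm z) D)
    (hfz : f ((extChartAt I q).symm z) ∈ (extChartAt I q).source) :
    HasFDerivAt (fun w => extChartAt I q (f ((extChartAt I q).symm w)))
      (dchart I q (f ((extChartAt I q).symm z)) ∘L D ∘L dchartSymm I q z) z := by
  have h1 := (hasMFDerivAt_chart q hfz).comp ((extChartAt I q).symm z) hf
  exact (h1.comp z (hasMFDerivAt_chart_symm q hz)).hasFDerivAt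

theorem contDiffAt_chart_conj (q : N) {f : N → N} {z : E}
    (hz : z ∈ (extChartAt I q).target) (hf : ContMDiffAt I I ∞ f ((extChartAt I q).symm z))
    (hfz : f ((extChartAt I q).symm z) ∈ (extChartAt I q).source) :
    ContDiffAt ℝ ∞ (fun w => extChartAt I q (f ((extChartAt I q).symm w))) z := by
  have h1 := (contMDiffAt_chart q hfz).comp ((extChartAt I q).symm z) hf
  exact contMDiffAt_iff_contDiffAt.1 (h1.comp z (contMDiffAt_chart_symm q hz))

end ChartMaps

/-! ### The complexified fundamental fields commute. -/

section Brackets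

open Topology

variable {n : ℕ} {E : Type*} [NormedAddCommGroup E] [NormedSpace ℝ E]
  {H : Type*} [TopologicalSpace H] {I : ModelWithCorners ℝ E H}
  {N : Type*} [TopologicalSpace N] [ChartedSpace H N] [IsManifold I ∞ N]
  [AddAction (Torus n) N]

variable (K : KahlerStructure I N)

theorem isSmoothVectorField_J {V : (p : N) → TangentSpace I p} (hV : IsSmoothVectorField V) :
    IsSmoothVectorField (fun q => K.J q (V q)) :=
  ContMDiff.clm_bundle_apply K.J_smooth hV

/-- The vector fields `-J x_N + r_N`, for `c = (x, r)`. -/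
noncomputable def complexFundamental (q : N) : Vec n × Vec n →L[ℝ] TangentSpace I q :=
  (-(K.J q ∘L fundamental I q)).coprod (fundamental I q)

theorem complexFundamental_apply (q : N) (c : Vec n × Vec n) :
    complexFundamental K q c = -(K.J q (fundamental I q c.1)) + fundamental I q c.2 := by
  simp [complexFundamental]

theorem complexFundamental_eq (c : Vec n × Vec n) :
    (fun q : N => complexFundamental K q c)
      = ((-1 : ℝ) • fun q => K.J q (fundamental I q c.1)) + fun q => fundamental I q c.2 := by
  funext q
  rw [complexFundamental_apply]
  simp

theorem isSmoothVectorField_complexFundamental (hs : IsSmoothTorusAction n I N)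
    (c : Vec n × Vec n) : IsSmoothVectorField (fun q : N => complexFundamental K q c) := by
  rw [complexFundamental_eq]
  exact ContMDiff.add_section (ContMDiff.const_smul_section
    (isSmoothVectorField_J K (isSmoothVectorField_fundamental hs c.1)))
    (isSmoothVectorField_fundamental hs c.2)

variable [CompleteSpace E] [I.Boundaryless]

/-- Invariant vector fields commute with the fundamental vector fields. -/
theorem mlieBracket_fundamental_eq_zero (hs : IsSmoothTorusAction n I N) (ξ : Vec n)
    {W : (p : N) → TangentSpace I p} (hW : IsSmoothVectorField W)
    (hinv : ∀ (a : Torus n) (q : N), mfderiv I I (fun q : N => a +ᵥ q) q (W q) = W (a +ᵥ q))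
    (q : N) : VectorField.mlieBracket I (fun q => fundamental I q ξ) W q = 0 := by
  set ψ := extChartAt I q with hψ
  have hz₀ : ψ q ∈ ψ.target := mem_extChartAt_target q
  have hX := isSmoothVectorField_fundamental hs ξ
  have key : VectorField.lieBracket ℝ (chartField q (fun q => fundamental I q ξ))
      (chartField q W) (ψ q) = 0 := by
    -- The flow of `ξ_N` in the chart at `q`, to which `lieBracket_eq_zero_of_flow` applies.
    let G : ℝ × E → E := fun p => ψ (toTorus (p.1 • ξ) +ᵥ ψ.symm p.2)
    have hsrc0 : ∀ z ∈ ψ.target, toTorus ((0 : ℝ) • ξ) +ᵥ ψ.symm z ∈ ψ.source := by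
      intro z hz
      rw [zero_smul, toTorus_zero, zero_vadd]
      exact ψ.map_target hz
    have hG : ∀ p : ℝ × E, p.2 ∈ ψ.target → toTorus (p.1 • ξ) +ᵥ ψ.symm p.2 ∈ ψ.source →
        ContDiffAt ℝ ∞ G p := by
      intro p hp hp'
      have h1 : ContMDiffAt 𝓘(ℝ, ℝ × E) (𝓘(ℝ, Vec n).prod I) ∞
          (fun p : ℝ × E => (p.1 • ξ, ψ.symm p.2)) p := by
        refine ContMDiffAt.prodMk ?_ ?_
        · exact ContDiff.contMDiff (by fun_prop) |>.contMDiffAt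
        · exact (contMDiffAt_chart_symm q hp).comp p contDiff_snd.contMDiff.contMDiffAt
      have h2 : ContMDiffAt 𝓘(ℝ, ℝ × E) I ∞
          (fun p : ℝ × E => toTorus (p.1 • ξ) +ᵥ ψ.symm p.2) p := hs.contMDiffAt.comp p h1
      exact contMDiffAt_iff_contDiffAt.1 ((contMDiffAt_chart q hp').comp p h2)
    have hGd : ∀ p : ℝ × E, p.2 ∈ ψ.target → toTorus (p.1 • ξ) +ᵥ ψ.symm p.2 ∈ ψ.source →
        HasFDerivAt G (fderiv ℝ G p) p := fun p hp hp' =>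
      ((hG p hp hp').differentiableAt (by simp)).hasFDerivAt
    refine lieBracket_eq_zero_of_flow (G := G)
      ((hG (0, ψ q) hz₀ (hsrc0 _ hz₀)).of_le ENat.LEInfty.out) ?_ ?_ ?_ ?_
    · show ψ (toTorus ((0 : ℝ) • ξ) +ᵥ ψ.symm (ψ q)) = ψ q
      rw [zero_smul, toTorus_zero, zero_vadd, ψ.right_inv hz₀]
    · filter_upwards [(isOpen_extChartAt_target q).mem_nhds hz₀] with z hz
      have h1 := hasDerivAt_chart_comp q (isMIntegralCurve_orbit hs ξ (ψ.symm z) 0)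
        (hsrc0 z hz)
      have h5 : HasDerivAt (fun t : ℝ => (t, z)) ((1 : ℝ), (0 : E)) 0 :=
        (hasDerivAt_id (0 : ℝ)).prodMk (hasDerivAt_const 0 z)
      have h6 := (hGd (0, z) hz (hsrc0 z hz)).comp_hasDerivAt (0 : ℝ) h5
      have h7 := h1.unique h6
      rw [← h7, chartField]
      have h8 : toTorus ((0 : ℝ) • ξ) +ᵥ ψ.symm z = ψ.symm z := by
        rw [zero_smul, toTorus_zero, zero_vadd]
      show dchart I q (ψ.symm z) (fundamental I (ψ.symm z) ξ : E)
        = dchart I q (toTorus ((0 : ℝ) • ξ) +ᵥ ψ.symm z)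
            (fundamental I (toTorus ((0 : ℝ) • ξ) +ᵥ ψ.symm z) ξ : E)
      exact congrArg (fun r : N => dchart I q r (fundamental I r ξ : E)) h8.symm
    · exact ((contDiffOn_chartField q hW).contDiffAt
        ((isOpen_extChartAt_target q).mem_nhds hz₀)).differentiableAt (by simp)
    · have hcont : Continuous (fun t : ℝ => toTorus (t • ξ) +ᵥ q) :=
        (isMIntegralCurve_orbit hs ξ q).continuous
      have hev : ∀ᶠ t in 𝓝 (0 : ℝ), toTorus (t • ξ) +ᵥ q ∈ ψ.source := by
        refine hcont.continuousAt.eventually_mem ((isOpen_extChartAt_source q).mem_nhds ?_)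
        rw [zero_smul, toTorus_zero, zero_vadd]
        exact mem_extChartAt_source q
      filter_upwards [hev] with t ht
      have hq : ψ.symm (ψ q) = q := ψ.left_inv (mem_extChartAt_source q)
      have ht' : toTorus (t • ξ) +ᵥ ψ.symm (ψ q) ∈ ψ.source := by rw [hq]; exact ht
      have h5 : HasFDerivAt (fun z : E => (t, z)) (ContinuousLinearMap.inr ℝ ℝ E) (ψ q) :=
        hasFDerivAt_prodMk_right t (ψ q)
      have h6 := (hGd (t, ψ q) hz₀ ht').comp (ψ q) h5
      have h7 := hasFDerivAt_chart_conj (I := I) q hz₀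
        (hasMFDerivAt_vadd hs (toTorus (t • ξ)) (ψ.symm (ψ q))) ht'
      have h8 := DFunLike.congr_fun (h6.unique h7) (chartField q W (ψ q))
      have h9 : fderiv ℝ G (t, ψ q) (0, chartField q W (ψ q))
          = dchart I q (toTorus (t • ξ) +ᵥ ψ.symm (ψ q))
            (mfderiv I I (fun q : N => toTorus (t • ξ) +ᵥ q) (ψ.symm (ψ q))
              (dchartSymm I q (ψ q) (chartField q W (ψ q)) : E)) := h8
      rw [h9, chartField, chartField]
      have h10 := dchartSymm_dchart q hz₀ (W (ψ.symm (ψ q)) : E)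
      have h11 : G (t, ψ q) = ψ (toTorus (t • ξ) +ᵥ ψ.symm (ψ q)) := rfl
      have h12 : ψ.symm (G (t, ψ q)) = toTorus (t • ξ) +ᵥ ψ.symm (ψ q) := by
        rw [h11, ψ.left_inv ht']
      refine (congrArg (fun r : N => dchart I q r (W r : E)) h12).trans ?_
      refine congrArg (dchart I q (toTorus (t • ξ) +ᵥ ψ.symm (ψ q))) ?_
      refine (hinv (toTorus (t • ξ)) (ψ.symm (ψ q))).symm.trans ?_
      exact congrArg (fun v : E => (mfderiv I I (fun q : N => toTorus (t • ξ) +ᵥ q)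
        (ψ.symm (ψ q)) v : E)) h10.symm
  rw [lieBracket_chartField q hX hW hz₀, chartField_eq_zero_iff q _ hz₀] at key
  rwa [hψ, extChartAt_to_inv] at key

/-- A holomorphic action preserves `J η_N` because it preserves `η_N`. -/
theorem mlieBracket_J_fundamental (hs : IsSmoothTorusAction n I N) (hhol : IsHolomorphicAction K n)
    (ξ η : Vec n) (q : N) : VectorField.mlieBracket I (fun q => fundamental I q ξ)
      (fun q => K.J q (fundamental I q η)) q = 0 := by
  refine mlieBracket_fundamental_eq_zero hs ξ
    (isSmoothVectorField_J K (isSmoothVectorField_fundamental hs η)) (fun a q => ?_) q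
  rw [hhol a q, mfderiv_vadd_fundamental hs]

/-- Integrability of `J` expresses this bracket through the three others in the Nijenhuis tensor,
all of which vanish. -/
theorem mlieBracket_J_J_fundamental (hs : IsSmoothTorusAction n I N)
    (hhol : IsHolomorphicAction K n) (ξ η : Vec n) (q : N) :
    VectorField.mlieBracket I (fun q => K.J q (fundamental I q ξ))
      (fun q => K.J q (fundamental I q η)) q = 0 := by
  have h := K.integrable _ _ (isSmoothVectorField_fundamental hs ξ)
    (isSmoothVectorField_fundamental hs η) q
  rw [mlieBracket_J_fundamental K hs hhol, mlieBracket_fundamental_eq_zero hs ξ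
    (isSmoothVectorField_fundamental hs η) (fun a q => mfderiv_vadd_fundamental hs a q η),
    VectorField.mlieBracket_swap_apply, mlieBracket_J_fundamental K hs hhol] at h
  simpa using h

theorem mlieBracket_complexFundamental (hs : IsSmoothTorusAction n I N)
    (hhol : IsHolomorphicAction K n) (c d : Vec n × Vec n) (q : N) :
    VectorField.mlieBracket I (fun q => complexFundamental K q c)
      (fun q => complexFundamental K q d) q = 0 := by
  have : IsManifold I 2 N := .of_le (n := ∞) ENat.LEInfty.out
  have hX : ∀ ξ : Vec n, MDifferentiableAt I I.tangent
      (fun p : N => (⟨p, fundamental I p ξ⟩ : TangentBundle I N)) q := fun ξ =>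
    (isSmoothVectorField_fundamental hs ξ q).mdifferentiableAt (by simp)
  have hJ : ∀ ξ : Vec n, MDifferentiableAt I I.tangent
      (fun p : N => (⟨p, K.J p (fundamental I p ξ)⟩ : TangentBundle I N)) q := fun ξ =>
    (isSmoothVectorField_J K (isSmoothVectorField_fundamental hs ξ) q).mdifferentiableAt (by simp)
  have hJ' : ∀ ξ : Vec n, MDifferentiableAt I I.tangent (fun p : N =>
      (⟨p, ((-1 : ℝ) • fun q => K.J q (fundamental I q ξ)) p⟩ : TangentBundle I N)) q := fun ξ =>
    ((ContMDiff.const_smul_section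
      (isSmoothVectorField_J K (isSmoothVectorField_fundamental hs ξ))) q).mdifferentiableAt
        (by simp)
  rw [complexFundamental_eq, complexFundamental_eq, VectorField.mlieBracket_add_left (hJ' _) (hX _),
    VectorField.mlieBracket_add_right (hJ' _) (hX _),
    VectorField.mlieBracket_add_right (hJ' _) (hX _),
    VectorField.mlieBracket_const_smul_left (hJ _), VectorField.mlieBracket_const_smul_left (hJ _),
    VectorField.mlieBracket_const_smul_right (hJ _),
    VectorField.mlieBracket_const_smul_right (hJ _),
    mlieBracket_J_fundamental K hs hhol, mlieBracket_J_J_fundamental K hs hhol,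
    VectorField.mlieBracket_swap_apply (V := fun q => K.J q (fundamental I q c.1)),
    mlieBracket_J_fundamental K hs hhol,
    mlieBracket_fundamental_eq_zero hs _ (isSmoothVectorField_fundamental hs _)
      (fun a q => mfderiv_vadd_fundamental hs a q _)]
  simp

end Brackets

/-! ### Commuting frames are coordinate frames. -/

section Flattening

open Topology

variable {E F : Type*} [NormedAddCommGroup E] [NormedSpace ℝ E] [CompleteSpace E]
  [NormedAddCommGroup F] [NormedSpace ℝ F] [CompleteSpace F]

/-- A commuting frame is a coordinate frame. -/
theorem exists_flattening {A : E → F →L[ℝ] E} {Ω : Set E} (hΩ : IsOpen Ω)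
    (hA : ContDiffOn ℝ ∞ A Ω) {z₀ : E} (hz₀ : z₀ ∈ Ω) (hinv : (A z₀).IsInvertible)
    (hbr : ∀ z ∈ Ω, ∀ c d, VectorField.lieBracket ℝ (fun z => A z c) (fun z => A z d) z = 0) :
    ∃ f : OpenPartialHomeomorph E F, z₀ ∈ f.source ∧ f.source ⊆ Ω ∧
      (∀ z ∈ f.source, ContDiffAt ℝ ∞ f z) ∧
      ∀ w ∈ f.target, ContDiffAt ℝ ∞ f.symm w ∧ HasFDerivAt f.symm (A (f.symm w)) w := by
  have hev : ∀ᶠ z in 𝓝 z₀, z ∈ Ω ∧ (A z).IsInvertible := by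
    refine (hΩ.eventually_mem hz₀).and ?_
    obtain ⟨e, he⟩ := hinv
    have hc : ContinuousAt A z₀ := (hA.contDiffAt (hΩ.mem_nhds hz₀)).continuousAt
    have := hc.eventually_mem (s := Set.range ((↑) : (F ≃L[ℝ] E) → F →L[ℝ] E))
      (by rw [← he]; exact e.nhds)
    exact this
  obtain ⟨ε, hε, hB⟩ := Metric.eventually_nhds_iff_ball.1 hev
  set B := Metric.ball z₀ ε with hBdef
  have hBo : IsOpen B := Metric.isOpen_ball
  -- The dual coframe. Commutation of the frame makes it closed, and a primitive on the ball gives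
  -- the coordinates.
  let θ : E → E →L[ℝ] F := fun z => (A z).inverse
  have hAat : ∀ z ∈ B, ContDiffAt ℝ ∞ A z := fun z hz => hA.contDiffAt (hΩ.mem_nhds (hB z hz).1)
  have hθ : ContDiffOn ℝ ∞ θ B := by
    intro z hz
    obtain ⟨e, he⟩ := (hB z hz).2
    have h2 : ContDiffAt ℝ ∞ ContinuousLinearMap.inverse (A z) := by
      rw [← he]; exact contDiffAt_map_inverse e
    exact (h2.comp z (hAat z hz)).contDiffWithinAt
  have hθd : ∀ z ∈ B, DifferentiableAt ℝ θ z := fun z hz =>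
    (hθ.contDiffAt (hBo.mem_nhds hz)).differentiableAt (by simp)
  have hAd : ∀ z ∈ B, DifferentiableAt ℝ A z := fun z hz => (hAat z hz).differentiableAt (by simp)
  have hθA : ∀ z ∈ B, ∀ c, θ z (A z c) = c := fun z hz c => (hB z hz).2.inverse_apply_self c
  have hAθ : ∀ z ∈ B, ∀ v, A z (θ z v) = v := fun z hz v => (hB z hz).2.self_apply_inverse v
  have hderiv : ∀ z ∈ B, ∀ c u, fderiv ℝ θ z u (A z c) = -θ z (fderiv ℝ (fun z => A z c) z u) := by
    intro z hz c u
    have hAc : HasFDerivAt (fun z => A z c) (fderiv ℝ (fun z => A z c) z) z :=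
      ((hAd z hz).clm_apply (differentiableAt_const c)).hasFDerivAt
    have h1 := (hθd z hz).hasFDerivAt.clm_apply hAc
    have h2 : (fun z => θ z (A z c)) =ᶠ[𝓝 z] fun _ => c := by
      filter_upwards [hBo.mem_nhds hz] with w hw using hθA w hw c
    have h3 := h1.unique ((hasFDerivAt_const c z).congr_of_eventuallyEq h2)
    have h4 := DFunLike.congr_fun h3 u
    simp only [add_apply, ContinuousLinearMap.comp_apply, ContinuousLinearMap.flip_apply,
      zero_apply] at h4
    exact eq_neg_of_add_eq_zero_right h4
  obtain ⟨f, hf⟩ := (convex_ball z₀ ε).exists_forall_hasFDerivAt_of_fderiv_symmetric hBo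
    (fun z hz => (hθd z hz).differentiableWithinAt) (by
      intro a ha x y
      obtain ⟨c, rfl⟩ : ∃ c, A a c = x := ⟨_, hAθ a ha x⟩
      obtain ⟨d, rfl⟩ : ∃ d, A a d = y := ⟨_, hAθ a ha y⟩
      rw [hderiv a ha d, hderiv a ha c]
      have := hbr a (hB a ha).1 c d
      rw [VectorField.lieBracket, sub_eq_zero] at this
      rw [this])
  have hfs : ContDiffOn ℝ ∞ f B := by
    rw [contDiffOn_infty_iff_fderiv_of_isOpen hBo]
    refine ⟨fun z hz => (hf z hz).differentiableAt.differentiableWithinAt, ?_⟩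
    exact hθ.congr fun z hz => (hf z hz).fderiv
  have hz₀B : z₀ ∈ B := Metric.mem_ball_self hε
  obtain ⟨e₀, he₀⟩ := hinv
  have hθ₀ : θ z₀ = (e₀.symm : E →L[ℝ] F) := by
    show (A z₀).inverse = _
    rw [← he₀, ContinuousLinearMap.inverse_equiv]
  have hf₀ : HasFDerivAt f (e₀.symm : E →L[ℝ] F) z₀ := by rw [← hθ₀]; exact hf z₀ hz₀B
  let f₀ := (hfs.contDiffAt (hBo.mem_nhds hz₀B)).toOpenPartialHomeomorph f hf₀ (by simp)
  let f₁ := f₀.restrOpen B hBo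
  have hsrc : f₁.source ⊆ B := Set.inter_subset_right
  refine ⟨f₁, ⟨ContDiffAt.mem_toOpenPartialHomeomorph_source _ _ _, hz₀B⟩,
    fun z hz => (hB z (hsrc hz)).1, ?_, ?_⟩
  · intro z hz
    exact hfs.contDiffAt (hBo.mem_nhds (hsrc hz))
  · intro w hw
    have hz := f₁.map_target hw
    obtain ⟨e, he⟩ := (hB _ (hsrc hz)).2
    have hθe : θ (f₁.symm w) = (e.symm : E →L[ℝ] F) := by
      show (A (f₁.symm w)).inverse = _
      rw [← he, ContinuousLinearMap.inverse_equiv]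
    have hd : HasFDerivAt f₁ (e.symm : E →L[ℝ] F) (f₁.symm w) := by
      rw [← hθe]; exact hf _ (hsrc hz)
    refine ⟨f₁.contDiffAt_symm hw hd (hfs.contDiffAt (hBo.mem_nhds (hsrc hz))), ?_⟩
    have := f₁.hasFDerivAt_symm hw hd
    rw [← he]
    simpa using this

end Flattening

/-! ### Joint flow of a complete commuting frame. -/

section CommutingFlow

open Topology

variable {E F : Type*} [NormedAddCommGroup E] [NormedSpace ℝ E] [FiniteDimensional ℝ E]
  [NormedAddCommGroup F] [NormedSpace ℝ F]
  {H : Type*} [TopologicalSpace H] {I : ModelWithCorners ℝ E H}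
  {N : Type*} [TopologicalSpace N] [ChartedSpace H N] [IsManifold I ∞ N]

/-- The complete commuting vector fields `Z c`, `c ∈ F`, with time-one maps `Ψ c`, form a frame at
the points of the invariant set `S`. -/
structure IsCommutingFlow (Z : (q : N) → F →L[ℝ] TangentSpace I q) (Ψ : F → N → N) (S : Set N) :
    Prop where
  smooth : ∀ c, IsSmoothVectorField (fun q => Z q c)
  bracket : ∀ c d q, VectorField.mlieBracket I (fun q => Z q c) (fun q => Z q d) q = 0
  zero : ∀ q, Ψ 0 q = q
  curve : ∀ c q, IsMIntegralCurve (fun s : ℝ => Ψ (s • c) q) (fun q => Z q c)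
  invariant : ∀ c, ∀ q ∈ S, Ψ c q ∈ S
  bijective : ∀ q ∈ S, Function.Bijective (Z q)

namespace IsCommutingFlow

variable {Z : (q : N) → F →L[ℝ] TangentSpace I q} {Ψ : F → N → N} {S : Set N}

/-- Coordinates in which all `Z c` are constant. -/
theorem exists_chart [FiniteDimensional ℝ F] [I.Boundaryless]
    (hΨ : IsCommutingFlow Z Ψ S) {q : N} (hq : q ∈ S) :
    ∃ χ : OpenPartialHomeomorph N F, q ∈ χ.source ∧
      (∀ q' ∈ χ.source, ContMDiffAt I 𝓘(ℝ, F) ∞ χ q') ∧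
      ∀ w ∈ χ.target, ContMDiffAt 𝓘(ℝ, F) I ∞ χ.symm w ∧
        HasMFDerivAt 𝓘(ℝ, F) I χ.symm w (Z (χ.symm w)) := by
  have : CompleteSpace E := FiniteDimensional.complete ℝ E
  have : CompleteSpace F := FiniteDimensional.complete ℝ F
  let e : OpenPartialHomeomorph N E := (chartAt H q).transHomeomorph I.toHomeomorph
  have he : ∀ q', e q' = extChartAt I q q' := fun q' => rfl
  have hes : ∀ z, e.symm z = (extChartAt I q).symm z := fun z => rfl
  have hsrc : e.source = (extChartAt I q).source := (extChartAt_source I q).symm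
  have htgt : e.target = (extChartAt I q).target := by
    rw [← e.image_source_eq_target, ← (extChartAt I q).image_source_eq_target, hsrc]
    rfl
  let ψ := extChartAt I q
  let A : E → F →L[ℝ] E := fun z => dchart I q (ψ.symm z) ∘L (Z (ψ.symm z) : F →L[ℝ] E)
  have hAc : ∀ c z, A z c = chartField q (fun q => Z q c) z := fun c z => rfl
  have hz₀ : ψ q ∈ ψ.target := mem_extChartAt_target q
  have hA : ContDiffOn ℝ ∞ A ψ.target := by
    rw [contDiffOn_clm_apply]
    intro c
    exact contDiffOn_chartField q (hΨ.smooth c)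
  have hinv : (A (ψ q)).IsInvertible := by
    have hbij : Function.Bijective (A (ψ q)) := by
      have h1 : Function.Bijective (Z (ψ.symm (ψ q))) := by
        have : ψ.symm (ψ q) = q := extChartAt_to_inv q
        rw [this]; exact hΨ.bijective q hq
      have h2 : Function.Bijective (dchart I q (ψ.symm (ψ q))) := by
        refine ⟨Function.LeftInverse.injective (g := dchartSymm I q (ψ q))
            (dchartSymm_dchart q hz₀), Function.RightInverse.surjective (g := dchartSymm I q (ψ q))
            (dchart_dchartSymm q hz₀)⟩
      exact h2.comp h1
    refine ⟨(LinearEquiv.ofBijective (A (ψ q) : F →ₗ[ℝ] E) hbij).toContinuousLinearEquiv, ?_⟩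
    ext c
    rfl
  obtain ⟨f, hf0, hfΩ, hfs, hft⟩ := exists_flattening (isOpen_extChartAt_target (I := I) q) hA hz₀
    hinv (by
      intro z hz c d
      have h1 := lieBracket_chartField q (hΨ.smooth c) (hΨ.smooth d) hz
      refine h1.trans ?_
      rw [chartField_eq_zero_iff q _ hz]
      exact hΨ.bracket c d _)
  refine ⟨e.trans f, ?_, ?_, ?_⟩
  · rw [OpenPartialHomeomorph.trans_source]
    refine ⟨?_, hf0⟩
    rw [hsrc]
    exact mem_extChartAt_source q
  · intro q' hq'
    rw [OpenPartialHomeomorph.trans_source] at hq'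
    have h1 : ContMDiffAt 𝓘(ℝ, E) 𝓘(ℝ, F) ∞ f (extChartAt I q q') :=
      (hfs _ hq'.2).contMDiffAt
    have hq1 : q' ∈ (extChartAt I q).source := by rw [← hsrc]; exact hq'.1
    exact h1.comp q' (contMDiffAt_chart q hq1)
  · intro w hw
    rw [OpenPartialHomeomorph.trans_target] at hw
    have hz : f.symm w ∈ (extChartAt I q).target := by rw [← htgt]; exact hw.2
    obtain ⟨h1, h2⟩ := hft w hw.1
    refine ⟨(contMDiffAt_chart_symm q hz).comp w h1.contMDiffAt, ?_⟩
    have h3 := (hasMFDerivAt_chart_symm q hz).comp w h2.hasMFDerivAt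
    refine h3.congr_mfderiv ?_
    refine ContinuousLinearMap.ext fun c => ?_
    exact dchartSymm_dchart q hz (Z (ψ.symm (f.symm w)) c)

theorem eq_of_isMIntegralCurve [I.Boundaryless] [T2Space N] (hΨ : IsCommutingFlow Z Ψ S) {c : F}
    {γ : ℝ → N} (hγ : IsMIntegralCurve γ (fun q => Z q c)) (s : ℝ) :
    γ s = Ψ (s • c) (γ 0) := by
  have : CompleteSpace E := FiniteDimensional.complete ℝ E
  have : IsManifold I 1 N := .of_le (n := ∞) (by simp)
  have h := isMIntegralCurve_Ioo_eq_of_contMDiff_boundaryless (t₀ := 0)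
    ((hΨ.smooth c).of_le (by simp)) hγ (hΨ.curve c (γ 0)) (by simp [hΨ.zero])
  exact congrFun h s

theorem smul_smul [I.Boundaryless] [T2Space N] (hΨ : IsCommutingFlow Z Ψ S) (c : F) (s t : ℝ)
    (q : N) : Ψ (s • c) (Ψ (t • c) q) = Ψ ((s + t) • c) q := by
  have h := hΨ.eq_of_isMIntegralCurve ((hΨ.curve c q).comp_add t) s
  simp only [Function.comp_apply, zero_add] at h
  exact h.symm

/-- In the coordinates of `exists_chart`, the maps `Ψ c` are locally translations. -/
theorem exists_local_formula [I.Boundaryless] [T2Space N] (hΨ : IsCommutingFlow Z Ψ S) {q : N}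
    {χ : OpenPartialHomeomorph N F} (hq : q ∈ χ.source)
    (hχ : ∀ w ∈ χ.target, HasMFDerivAt 𝓘(ℝ, F) I χ.symm w (Z (χ.symm w))) :
    ∃ ε > 0, ∀ q' ∈ χ.source, ‖χ q' - χ q‖ < ε → ∀ c, ‖c‖ < ε →
      χ q' + c ∈ χ.target ∧ Ψ c q' = χ.symm (χ q' + c) := by
  have : CompleteSpace E := FiniteDimensional.complete ℝ E
  have : IsManifold I 1 N := .of_le (n := ∞) (by simp)
  obtain ⟨δ, hδ, hball⟩ := Metric.isOpen_iff.1 χ.open_target (χ q) (χ.map_source hq)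
  -- The curve is followed for times in `(-1, 2)`, an open interval around 0 and 1, where `‖s • c‖ ≤
  -- 2 * ‖c‖`; together with the distance of `χ q'` from `χ q` this stays below `δ`.
  refine ⟨δ / 3, by positivity, fun q' hq' hd c hc => ?_⟩
  have hmem : ∀ s ∈ Set.Ioo (-1 : ℝ) 2, χ q' + s • c ∈ χ.target := by
    intro s hs
    apply hball
    rw [mem_ball_iff_norm]
    have h1 : ‖s • c‖ ≤ 2 * ‖c‖ := by
      rw [norm_smul, Real.norm_eq_abs]
      exact mul_le_mul_of_nonneg_right (abs_le.2 ⟨by linarith [hs.1], hs.2.le⟩) (norm_nonneg c)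
    calc ‖χ q' + s • c - χ q‖ = ‖(χ q' - χ q) + s • c‖ := by congr 1; abel
      _ ≤ ‖χ q' - χ q‖ + ‖s • c‖ := norm_add_le _ _
      _ < δ := by linarith
  have hcurve : IsMIntegralCurveOn (I := I) (fun s : ℝ => χ.symm (χ q' + s • c)) (fun q => Z q c)
      (Set.Ioo (-1) 2) := by
    intro s hs
    have h1 : HasMFDerivAt 𝓘(ℝ, ℝ) 𝓘(ℝ, F) (fun s : ℝ => χ q' + s • c) s
        ((1 : ℝ →L[ℝ] ℝ).smulRight c) := by
      have := ((hasFDerivAt_id (𝕜 := ℝ) s).smul_const c).const_add (χ q')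
      exact this.hasMFDerivAt
    have h3 := HasMFDerivAt.comp (f := fun s : ℝ => χ q' + s • c) s (hχ _ (hmem s hs)) h1
    refine (h3.congr_mfderiv (ContinuousLinearMap.ext_ring ?_)).hasMFDerivWithinAt
    exact (Z (χ.symm (χ q' + s • c))).map_smul (1 : ℝ) c
  have heq := isMIntegralCurveOn_Ioo_eqOn_of_contMDiff_boundaryless (t₀ := 0) (by norm_num)
    ((hΨ.smooth c).of_le (by simp)) ((hΨ.curve c q').isMIntegralCurveOn _) hcurve
    (by simp [hΨ.zero, χ.left_inv hq'])
  have h1 : (1 : ℝ) ∈ Set.Ioo (-1 : ℝ) 2 := by norm_num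
  have h2 := heq h1
  have h3 := hmem 1 h1
  simp only [one_smul] at h2 h3
  exact ⟨h3, h2⟩

theorem exists_local_add [FiniteDimensional ℝ F] [I.Boundaryless] [T2Space N]
    (hΨ : IsCommutingFlow Z Ψ S) {q : N}
    (hq : q ∈ S) : ∃ V ∈ 𝓝 q, ∃ ε > 0, ∀ q' ∈ V, ∀ c d, ‖c‖ < ε → ‖d‖ < ε →
      Ψ c (Ψ d q') = Ψ (c + d) q' := by
  obtain ⟨χ, hqχ, -, hχ⟩ := hΨ.exists_chart hq
  obtain ⟨ε, hε, hform⟩ := hΨ.exists_local_formula hqχ (fun w hw => (hχ w hw).2)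
  have hcont : ContinuousAt χ q := χ.continuousAt hqχ
  refine ⟨{q' | q' ∈ χ.source ∧ ‖χ q' - χ q‖ < ε / 2}, ?_, ε / 2, by positivity, ?_⟩
  · refine (χ.open_source.eventually_mem hqχ).and ?_
    have := hcont.eventually (Metric.ball_mem_nhds (χ q) (half_pos hε))
    filter_upwards [this] with q' hq'
    rwa [dist_eq_norm] at hq'
  · rintro q' ⟨hs, hd'⟩ c d hc hd
    obtain ⟨m1, e1⟩ := hform q' hs (by linarith) d (by linarith)
    have hs2 : Ψ d q' ∈ χ.source := by rw [e1]; exact χ.map_target m1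
    have hχ2 : χ (Ψ d q') = χ q' + d := by rw [e1, χ.right_inv m1]
    have hn : ‖χ (Ψ d q') - χ q‖ < ε := by
      rw [hχ2]
      calc ‖χ q' + d - χ q‖ = ‖(χ q' - χ q) + d‖ := by congr 1; abel
        _ ≤ ‖χ q' - χ q‖ + ‖d‖ := norm_add_le _ _
        _ < ε := by linarith
    obtain ⟨-, e2⟩ := hform _ hs2 hn c (by linarith)
    obtain ⟨-, e3⟩ := hform q' hs (by linarith) (c + d) ((norm_add_le _ _).trans_lt (by linarith))
    rw [e2, e3, hχ2, add_assoc, add_comm d c]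

/-- At this stage the maps `Ψ` are related only along lines through 0 and, for small parameters,
near a point. The identity is carried along the ray `s • c` by showing that the set of good `s` is
clopen in ℝ. -/
theorem eventually_add [FiniteDimensional ℝ F] [I.Boundaryless] [T2Space N]
    (hΨ : IsCommutingFlow Z Ψ S) {q : N}
    (hq : q ∈ S) (c : F) : ∀ᶠ d in 𝓝 (0 : F), Ψ (c + d) q = Ψ d (Ψ c q) := by
  let R : ℝ → Prop := fun s => ∀ᶠ d in 𝓝 (0 : F), Ψ (s • c + d) q = Ψ d (Ψ (s • c) q)
  have hlin : ∀ (a : F) (s t : ℝ), Ψ (s • a) (Ψ (t • a) q) = Ψ ((s + t) • a) q := fun a s t =>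
    hΨ.smul_smul a s t q
  have hR0 : R 0 := Filter.Eventually.of_forall fun d => by simp [hΨ.zero]
  have key : ∀ s₁ : ℝ, ∀ᶠ p : ℝ × ℝ in 𝓝 (s₁, s₁), R p.1 → R p.2 := by
    intro s₁
    obtain ⟨V, hV, ε, hε, hadd⟩ := hΨ.exists_local_add (hΨ.invariant (s₁ • c) q hq)
    have hVs : ∀ᶠ s in 𝓝 s₁, Ψ (s • c) q ∈ V :=
      (hΨ.curve c q).continuous.continuousAt.eventually_mem hV
    have hsmall : ∀ᶠ p : ℝ × ℝ in 𝓝 (s₁, s₁), ‖(p.2 - p.1) • c‖ < ε / 2 := by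
      have hc : Continuous fun p : ℝ × ℝ => ‖(p.2 - p.1) • c‖ := by fun_prop
      refine hc.continuousAt.eventually_lt continuousAt_const ?_
      simpa using hε
    filter_upwards [hsmall, (continuous_fst.tendsto (s₁, s₁)).eventually hVs] with ⟨s, s'⟩ hp hVp hR
    simp only at hp hVp hR
    show R s'
    by_cases hs' : s' = 0
    · rw [hs']; exact hR0
    -- The point `s • c + l • d` lies on the line through `s' • c + d`. The flow therefore passes
    -- through it, where the identity is known at `s`; the remaining small increment is handled by
    -- local additivity.
    set l := s / s' with hl
    have h1 : ∀ᶠ d in 𝓝 (0 : F), Ψ (s • c + l • d) q = Ψ (l • d) (Ψ (s • c) q) := by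
      have ht : Filter.Tendsto (fun d : F => l • d) (𝓝 0) (𝓝 0) := by
        have : Continuous fun d : F => l • d := by fun_prop
        simpa using this.tendsto 0
      exact ht.eventually hR
    have hn : ∀ b : ℝ, ∀ᶠ d in 𝓝 (0 : F), ‖b • d‖ < ε / 2 := by
      intro b
      have hc : Continuous fun d : F => ‖b • d‖ := by fun_prop
      refine hc.continuousAt.eventually_lt continuousAt_const ?_
      simpa using hε
    filter_upwards [h1, hn 1, hn l, hn (1 - l)] with d hd hd1 hdl hdl'
    rw [one_smul] at hd1
    have hls : l * s' = s := by rw [hl]; field_simp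
    have e1 : Ψ (s' • c + d) q
        = Ψ ((1 - l) • (s' • c + d)) (Ψ (l • (s' • c + d)) q) := by
      rw [hlin]; congr 1; simp
    have e2 : l • (s' • c + d) = s • c + l • d := by rw [smul_add, _root_.smul_smul, hls]
    have e3 : (1 - l) • (s' • c + d) = (s' - s) • c + (1 - l) • d := by
      rw [smul_add, _root_.smul_smul, sub_mul, one_mul, hls]
    have e4 : Ψ (s' • c) q = Ψ ((s' - s) • c) (Ψ (s • c) q) := by rw [hlin]; congr 1; simp
    rw [e1, e2, e3, hd, e4, hadd _ hVp _ _ ((norm_add_le _ _).trans_lt (by linarith))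
      (by linarith), hadd _ hVp _ _ (by linarith) (by linarith)]
    congr 1
    module
  have hclopen : IsClopen {s | R s} := by
    constructor
    · rw [← isOpen_compl_iff, isOpen_iff_mem_nhds]
      intro s₁ hs₁
      have h1 : Filter.Tendsto (fun s : ℝ => (s, s₁)) (𝓝 s₁) (𝓝 (s₁, s₁)) :=
        (Continuous.tendsto (by fun_prop) s₁)
      filter_upwards [h1.eventually (key s₁)] with s hs hRs
      exact hs₁ (hs hRs)
    · rw [isOpen_iff_mem_nhds]
      intro s₁ hs₁
      have h1 : Filter.Tendsto (fun s : ℝ => (s₁, s)) (𝓝 s₁) (𝓝 (s₁, s₁)) :=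
        (Continuous.tendsto (by fun_prop) s₁)
      filter_upwards [h1.eventually (key s₁)] with s hs
      exact hs hs₁
  have huniv : {s | R s} = Set.univ := hclopen.eq_univ ⟨0, hR0⟩
  have hR1 : R 1 := by
    have : (1 : ℝ) ∈ {s | R s} := by rw [huniv]; trivial
    exact this
  simpa [R] using hR1

/-- Locally the orbit map is a translation followed by an inverse chart; its smoothness, its
derivative and its local invertibility are read off from this. -/
theorem eventually_eq_chart [FiniteDimensional ℝ F] [I.Boundaryless] [T2Space N]
    (hΨ : IsCommutingFlow Z Ψ S) {q : N}
    (hq : q ∈ S) (c : F) : ∃ χ : OpenPartialHomeomorph N F, Ψ c q ∈ χ.source ∧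
      (∀ q' ∈ χ.source, ContMDiffAt I 𝓘(ℝ, F) ∞ χ q') ∧
      (∀ w ∈ χ.target, ContMDiffAt 𝓘(ℝ, F) I ∞ χ.symm w ∧
        HasMFDerivAt 𝓘(ℝ, F) I χ.symm w (Z (χ.symm w))) ∧
      ∀ᶠ c' in 𝓝 c, Ψ c' q = χ.symm (c' + (χ (Ψ c q) - c)) := by
  obtain ⟨χ, hqχ, hχs, hχ⟩ := hΨ.exists_chart (hΨ.invariant c q hq)
  obtain ⟨ε, hε, hform⟩ := hΨ.exists_local_formula hqχ (fun w hw => (hχ w hw).2)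
  refine ⟨χ, hqχ, hχs, hχ, ?_⟩
  have ht : Filter.Tendsto (fun c' : F => c' - c) (𝓝 c) (𝓝 0) := by
    have : Continuous fun c' : F => c' - c := by fun_prop
    simpa using this.tendsto c
  filter_upwards [ht.eventually (hΨ.eventually_add hq c),
    ht.eventually (Metric.ball_mem_nhds 0 hε)] with c' h1 h2
  rw [add_sub_cancel] at h1
  rw [h1, (hform _ hqχ (by simpa using hε) _ (by simpa using h2)).2]
  congr 1
  abel

theorem hasMFDerivAt [FiniteDimensional ℝ F] [I.Boundaryless] [T2Space N]
    (hΨ : IsCommutingFlow Z Ψ S) {q : N}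
    (hq : q ∈ S) (c : F) : HasMFDerivAt 𝓘(ℝ, F) I (fun c => Ψ c q) c (Z (Ψ c q)) := by
  obtain ⟨χ, hqχ, -, hχ, hev⟩ := hΨ.eventually_eq_chart hq c
  have hw : c + (χ (Ψ c q) - c) = χ (Ψ c q) := by abel
  have h2 : HasMFDerivAt 𝓘(ℝ, F) I χ.symm (c + (χ (Ψ c q) - c)) (Z (Ψ c q)) := by
    rw [hw]
    have := (hχ _ (χ.map_source hqχ)).2
    rwa [χ.left_inv hqχ] at this
  have h3 : HasMFDerivAt 𝓘(ℝ, F) 𝓘(ℝ, F) (fun c' : F => c' + (χ (Ψ c q) - c)) c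
      (ContinuousLinearMap.id ℝ F) := ((hasFDerivAt_id c).add_const _).hasMFDerivAt
  exact (HasMFDerivAt.comp (f := fun c' : F => c' + (χ (Ψ c q) - c)) c h2 h3).congr_of_eventuallyEq
    hev

theorem isLocalDiffeomorphAt [FiniteDimensional ℝ F] [I.Boundaryless] [T2Space N]
    (hΨ : IsCommutingFlow Z Ψ S) {q : N}
    (hq : q ∈ S) (c : F) : IsLocalDiffeomorphAt 𝓘(ℝ, F) I ∞ (fun c => Ψ c q) c := by
  obtain ⟨χ, hqχ, hχs, hχ, hev⟩ := hΨ.eventually_eq_chart hq c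
  obtain ⟨U, hU, hUo, hcU⟩ := eventually_nhds_iff.1 hev
  let e : OpenPartialHomeomorph F N :=
    ((Homeomorph.addRight (χ (Ψ c q) - c)).toOpenPartialHomeomorph.trans χ.symm).restrOpen U hUo
  have hsrc : ∀ c' ∈ e.source, c' + (χ (Ψ c q) - c) ∈ χ.target ∧ c' ∈ U := by
    intro c' hc'
    simpa [e] using hc'
  have htgt : ∀ q' ∈ e.target, q' ∈ χ.source := by
    intro q' hq'
    have h1 := hsrc _ (e.map_target hq')
    have h2 : e (e.symm q') = χ.symm (e.symm q' + (χ (Ψ c q) - c)) := rfl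
    rw [← e.right_inv hq', h2]
    exact χ.map_target h1.1
  refine ⟨⟨e.toPartialEquiv, e.open_source, e.open_target, ?_, ?_⟩, ?_, ?_⟩
  · intro c' hc'
    have h1 : ContMDiffAt 𝓘(ℝ, F) 𝓘(ℝ, F) ∞ (fun c' : F => c' + (χ (Ψ c q) - c)) c' :=
      ContDiff.contMDiff (by fun_prop) |>.contMDiffAt
    exact (((hχ _ (hsrc c' hc').1).1).comp c' h1).contMDiffWithinAt
  · intro q' hq'
    have h1 : ContMDiffAt 𝓘(ℝ, F) 𝓘(ℝ, F) ∞ (fun w : F => w + -(χ (Ψ c q) - c)) (χ q') :=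
      ContDiff.contMDiff (by fun_prop) |>.contMDiffAt
    exact (h1.comp q' (hχs q' (htgt q' hq'))).contMDiffWithinAt
  · have : c ∈ e.source := by simp [e, hcU, χ.map_source hqχ]
    exact this
  · intro c' hc'
    exact hU c' (hsrc c' hc').2

/-- Once the orbit map is differentiable everywhere, `s ↦ Ψ (c + s • d) q` is an integral curve of
`Z d`, and uniqueness applies. -/
theorem add_apply [FiniteDimensional ℝ F] [I.Boundaryless] [T2Space N]
    (hΨ : IsCommutingFlow Z Ψ S) {q : N}
    (hq : q ∈ S) (c d : F) : Ψ (c + d) q = Ψ d (Ψ c q) := by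
  have hcurve : IsMIntegralCurve (I := I) (fun s : ℝ => Ψ (c + s • d) q) (fun q => Z q d) := by
    intro s
    have h1 : HasMFDerivAt 𝓘(ℝ, ℝ) 𝓘(ℝ, F) (fun s : ℝ => c + s • d) s
        ((1 : ℝ →L[ℝ] ℝ).smulRight d) := by
      have := ((hasFDerivAt_id (𝕜 := ℝ) s).smul_const d).const_add c
      exact this.hasMFDerivAt
    have h3 := HasMFDerivAt.comp (f := fun s : ℝ => c + s • d) s
      (hΨ.hasMFDerivAt hq (c + s • d)) h1
    refine h3.congr_mfderiv (ContinuousLinearMap.ext_ring ?_)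
    exact (Z (Ψ (c + s • d) q)).map_smul (1 : ℝ) d
  have h := hΨ.eq_of_isMIntegralCurve hcurve 1
  simpa using h

theorem contMDiff [FiniteDimensional ℝ F] [I.Boundaryless] [T2Space N]
    (hΨ : IsCommutingFlow Z Ψ S) {q : N}
    (hq : q ∈ S) : ContMDiff 𝓘(ℝ, F) I ∞ (fun c => Ψ c q) :=
  fun c => (hΨ.isLocalDiffeomorphAt hq c).contMDiffAt

theorem isOpen_range [FiniteDimensional ℝ F] [I.Boundaryless] [T2Space N]
    (hΨ : IsCommutingFlow Z Ψ S) {q : N}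
    (hq : q ∈ S) : IsOpen (Set.range fun c => Ψ c q) :=
  (IsLocalDiffeomorph.isOpen_range fun c => hΨ.isLocalDiffeomorphAt hq c)

end IsCommutingFlow

end CommutingFlow

/-! ### The complexified torus action on the free points. -/

theorem vadd_mem_freeSet {n : ℕ} {N : Type*} [AddAction (Torus n) N] (a : Torus n) {q : N}
    (hq : q ∈ freeSet n N) : a +ᵥ q ∈ freeSet n N := by
  intro b hb
  apply hq b
  rw [← add_vadd, add_comm, add_vadd] at hb
  exact (vadd_left_cancel_iff a).1 hb

section ComplexFlow

open Topology

variable {n : ℕ} {E : Type*} [NormedAddCommGroup E] [NormedSpace ℝ E]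
  {H : Type*} [TopologicalSpace H] {I : ModelWithCorners ℝ E H}
  {N : Type*} [TopologicalSpace N] [ChartedSpace H N] [AddAction (Torus n) N]

theorem hasMFDerivAt_action (hs : IsSmoothTorusAction n I N) (t : Vec n) (q : N) :
    HasMFDerivAt (𝓘(ℝ, Vec n).prod I) I (fun q : Vec n × N => toTorus q.1 +ᵥ q.2) (t, q)
      ((fundamental I (toTorus t +ᵥ q) : Vec n →L[ℝ] E).coprod
        (mfderiv I I (fun q : N => toTorus t +ᵥ q) q : E →L[ℝ] E) :) := by
  have h2 : MDifferentiableAt (𝓘(ℝ, Vec n).prod I) I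
    (fun q : Vec n × N => toTorus q.1 +ᵥ q.2) (t, q) := hs.mdifferentiable (by simp) _
  refine h2.hasMFDerivAt.congr_mfderiv (ContinuousLinearMap.ext fun v => ?_)
  refine (mfderiv_prod_eq_add_apply h2).trans ?_
  exact congrArg (fun w : E => HAdd.hAdd (α := E) (β := E) w
    (mfderiv I I (fun q : N => toTorus t +ᵥ q) q v.2))
    (DFunLike.congr_fun (hasMFDerivAt_orbit hs q t).mfderiv v.1)

variable [IsManifold I ∞ N] (K : KahlerStructure I N)

theorem IsMomentumMap.hasMFDerivAt {K : KahlerStructure I N} {μ : N → Vec n}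
    (hμ : IsMomentumMap K μ) (q : N) :
    HasMFDerivAt I 𝓘(ℝ, Vec n) μ q (mfderiv I 𝓘(ℝ, Vec n) μ q) :=
  (hμ.smooth.mdifferentiable (by simp) q).hasMFDerivAt

theorem IsMomentumMap.inner_mfderiv {K : KahlerStructure I N} {μ : N → Vec n}
    (hμ : IsMomentumMap K μ) (q : N) (v : TangentSpace I q) (ξ : Vec n) :
    inner (E := Vec n) ℝ (mfderiv I 𝓘(ℝ, Vec n) μ q v) ξ
      = K.g.inner q (K.J q (fundamental I q ξ)) v := by
  refine Eq.trans ?_ (hμ.hamiltonian ξ q v).symm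
  have h1 : HasMFDerivAt 𝓘(ℝ, Vec n) 𝓘(ℝ, ℝ) (fun z : Vec n => inner ℝ z ξ) (μ q)
      ((innerSL ℝ).flip ξ :) := ((innerSL ℝ).flip ξ).hasFDerivAt.hasMFDerivAt
  exact (DFunLike.congr_fun (h1.comp q (hμ.hasMFDerivAt q)).mfderiv v).symm

theorem IsMomentumMap.mfderiv_fundamental {K : KahlerStructure I N} {μ : N → Vec n}
    (hs : IsSmoothTorusAction n I N) (hμ : IsMomentumMap K μ) (q : N) (ξ : Vec n) :
    mfderiv I 𝓘(ℝ, Vec n) μ q (fundamental I q ξ) = 0 := by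
  have h0 : toTorus (0 : Vec n) +ᵥ q = q := by rw [toTorus_zero, zero_vadd]
  have h1 : HasMFDerivAt I 𝓘(ℝ, Vec n) μ (toTorus (0 : Vec n) +ᵥ q)
      (mfderiv I 𝓘(ℝ, Vec n) μ q) := by
    rw [h0]; exact hμ.hasMFDerivAt q
  have h3 := HasMFDerivAt.comp (f := fun t : Vec n => toTorus t +ᵥ q) 0 h1
    (hasMFDerivAt_orbit_zero hs q)
  have h4 : μ ∘ (fun t : Vec n => toTorus t +ᵥ q) = fun _ => μ q := by
    funext t
    exact hμ.invariant _ _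
  rw [h4] at h3
  exact DFunLike.congr_fun (hasMFDerivAt_unique h3 (hasMFDerivAt_const (μ q) 0)) ξ

/-- The orbits are isotropic. -/
theorem IsMomentumMap.inner_J_fundamental {K : KahlerStructure I N} {μ : N → Vec n}
    (hs : IsSmoothTorusAction n I N) (hμ : IsMomentumMap K μ) (q : N) (ξ η : Vec n) :
    K.g.inner q (K.J q (fundamental I q ξ)) (fundamental I q η) = 0 := by
  rw [← hμ.inner_mfderiv, hμ.mfderiv_fundamental hs]
  exact inner_zero_left _

/-- The cross terms vanish because the orbits are isotropic, and `J` is an isometry. -/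
theorem inner_complexFundamental {K : KahlerStructure I N} {μ : N → Vec n}
    (hs : IsSmoothTorusAction n I N) (hμ : IsMomentumMap K μ) (q : N) (c d : Vec n × Vec n) :
    K.g.inner q (complexFundamental K q c) (complexFundamental K q d)
      = K.g.inner q (fundamental I q c.1) (fundamental I q d.1)
        + K.g.inner q (fundamental I q c.2) (fundamental I q d.2) := by
  have h1 := hμ.inner_J_fundamental hs q c.1 d.2
  have h2 := hμ.inner_J_fundamental hs q d.1 c.2
  rw [K.g.symm] at h2
  simp [complexFundamental_apply, K.hermitian, h1, h2]

section Flow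

variable [FiniteDimensional ℝ E] [I.Boundaryless] [T2Space N]

/-- If `ξ_N` vanishes at `q`, the constant curve is an integral curve, so the one-parameter group of
`ξ` fixes `q` and is trivial. -/
theorem fundamental_injective (hs : IsSmoothTorusAction n I N) {q : N} (hq : q ∈ freeSet n N) :
    Function.Injective (fundamental (n := n) I q) := by
  have : CompleteSpace E := FiniteDimensional.complete ℝ E
  have : IsManifold I 1 N := .of_le (n := ∞) (by simp)
  refine (injective_iff_map_eq_zero _).2 fun ξ hξ => ?_
  refine eq_zero_of_forall_toTorus_smul fun s => hq _ ?_
  have h := isMIntegralCurve_Ioo_eq_of_contMDiff_boundaryless (t₀ := 0)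
    ((isSmoothVectorField_fundamental hs ξ).of_le (by simp)) (isMIntegralCurve_orbit hs ξ q)
    (isMIntegralCurve_const (v := fun q => fundamental I q ξ) hξ)
    (by simp [toTorus_zero])
  exact congrFun h s

theorem complexFundamental_injective {K : KahlerStructure I N} {μ : N → Vec n}
    (hs : IsSmoothTorusAction n I N) (hμ : IsMomentumMap K μ) {q : N} (hq : q ∈ freeSet n N) :
    Function.Injective (complexFundamental (n := n) K q) := by
  refine (injective_iff_map_eq_zero _).2 fun c hc => ?_
  have h1 := inner_complexFundamental hs hμ q c c
  rw [hc, map_zero] at h1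
  have hnn : ∀ v : TangentSpace I q, 0 ≤ K.g.inner q v v := fun v => by
    by_cases hv : v = 0
    · rw [hv, map_zero]
    · exact (K.g.pos q v hv).le
  have hz : ∀ ξ : Vec n, K.g.inner q (fundamental I q ξ) (fundamental I q ξ) = 0 → ξ = 0 := by
    intro ξ h0
    refine (injective_iff_map_eq_zero _).1 (fundamental_injective hs hq) ξ ?_
    by_contra hne
    exact (K.g.pos q _ hne).ne' h0
  have h2 := hnn (fundamental I q c.1)
  have h3 := hnn (fundamental I q c.2)
  have h4 : (0 : ℝ) = K.g.inner q (fundamental I q c.1) (fundamental I q c.1)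
        + K.g.inner q (fundamental I q c.2) (fundamental I q c.2) := h1
  exact Prod.ext (hz _ (by linarith)) (hz _ (by linarith))

theorem complexFundamental_bijective {K : KahlerStructure I N} {μ : N → Vec n}
    (hs : IsSmoothTorusAction n I N) (hμ : IsMomentumMap K μ)
    (hE : Module.finrank ℝ E = 2 * n) {q : N} (hq : q ∈ freeSet n N) :
    Function.Bijective (complexFundamental (n := n) K q) := by
  have hinj := complexFundamental_injective hs hμ hq
  have hdim : Module.finrank ℝ (Vec n × Vec n) = Module.finrank ℝ E := by
    rw [hE]; simp; ring
  let L : Vec n × Vec n →L[ℝ] E := complexFundamental (n := n) K q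
  exact ⟨hinj, (LinearMap.injective_iff_surjective_of_finrank_eq_finrank
    (f := (L : Vec n × Vec n →ₗ[ℝ] E)) hdim).1 hinj⟩

variable {K} {φ : Vec n → ℝ → N → N}

theorem flow_eq_of_isMIntegralCurve (hs : IsSmoothTorusAction n I N)
    (hφ : ∀ ξ : Vec n, IsFlow (fun q : N => -(K.J q (fundamental I q ξ))) (φ ξ)) {x : Vec n}
    {γ : ℝ → N} (hγ : IsMIntegralCurve γ (fun q => -(K.J q (fundamental I q x)))) (s : ℝ) :
    γ s = φ x s (γ 0) := by
  have : CompleteSpace E := FiniteDimensional.complete ℝ E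
  have : IsManifold I 1 N := .of_le (n := ∞) (by simp)
  have hsm : IsSmoothVectorField (fun q : N => -(K.J q (fundamental I q x))) := by
    have := isSmoothVectorField_complexFundamental K hs (x, 0)
    simpa [complexFundamental_apply] using this
  have h := isMIntegralCurve_Ioo_eq_of_contMDiff_boundaryless (t₀ := 0)
    (hsm.of_le (by simp)) hγ (hφ x (γ 0)).2 (hφ x (γ 0)).1.symm
  exact congrFun h s

theorem flow_smul (hs : IsSmoothTorusAction n I N)
    (hφ : ∀ ξ : Vec n, IsFlow (fun q : N => -(K.J q (fundamental I q ξ))) (φ ξ)) (x : Vec n)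
    (s : ℝ) (q : N) : φ (s • x) 1 q = φ x s q := by
  have h1 := (hφ x q).2.comp_mul s
  have h2 : (s • fun q : N => -(K.J q (fundamental I q x)))
      = fun q : N => -(K.J q (fundamental I q (s • x))) := by
    funext q
    simp
  rw [h2] at h1
  have h3 := flow_eq_of_isMIntegralCurve hs hφ h1 1
  simp only [Function.comp_apply, one_mul, zero_mul, (hφ x q).1] at h3
  exact h3.symm

theorem flow_add (hs : IsSmoothTorusAction n I N)
    (hφ : ∀ ξ : Vec n, IsFlow (fun q : N => -(K.J q (fundamental I q ξ))) (φ ξ)) (x : Vec n)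
    (s t : ℝ) (q : N) : φ x (s + t) q = φ x s (φ x t q) := by
  have h3 := flow_eq_of_isMIntegralCurve hs hφ ((hφ x q).2.comp_add t) s
  simpa only [Function.comp_apply, zero_add] using h3

/-- The field `-J x_N` is invariant under the torus, so `a` maps its integral curves to integral
curves. -/
theorem vadd_flow (hs : IsSmoothTorusAction n I N) (hhol : IsHolomorphicAction K n)
    (hφ : ∀ ξ : Vec n, IsFlow (fun q : N => -(K.J q (fundamental I q ξ))) (φ ξ)) (a : Torus n)
    (x : Vec n) (s : ℝ) (q : N) : a +ᵥ φ x s q = φ x s (a +ᵥ q) := by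
  have h1 : IsMIntegralCurve (I := I) (fun s => a +ᵥ φ x s q)
      (fun q => -(K.J q (fundamental I q x))) := by
    intro s
    have h3 := (hasMFDerivAt_vadd hs a (φ x s q)).comp s ((hφ x q).2 s)
    refine h3.congr_mfderiv (ContinuousLinearMap.ext_ring ?_)
    show mfderiv I I (fun q : N => a +ᵥ q) (φ x s q)
      ((1 : ℝ) • -(K.J (φ x s q) (fundamental I (φ x s q) x)))
        = (1 : ℝ) • -(K.J (a +ᵥ φ x s q) (fundamental I (a +ᵥ φ x s q) x))
    rw [one_smul, one_smul, map_neg, hhol a, mfderiv_vadd_fundamental hs]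
  have h3 := flow_eq_of_isMIntegralCurve hs hφ h1 s
  simpa only [(hφ x q).1] using h3

theorem flow_mem_freeSet (hs : IsSmoothTorusAction n I N) (hhol : IsHolomorphicAction K n)
    (hφ : ∀ ξ : Vec n, IsFlow (fun q : N => -(K.J q (fundamental I q ξ))) (φ ξ))
    (x : Vec n) (s : ℝ) {q : N} (hq : q ∈ freeSet n N) : φ x s q ∈ freeSet n N := by
  intro a ha
  apply hq a
  have h1 : ∀ q', φ x (-s) (φ x s q') = q' := fun q' => by
    rw [← flow_add hs hφ, neg_add_cancel, (hφ x q').1]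
  rw [vadd_flow hs hhol hφ] at ha
  rw [← h1 (a +ᵥ q), ha, h1]

/-- The joint action of `ℝⁿ` by the flows `φ` and of the torus. -/
def complexFlow (φ : Vec n → ℝ → N → N) (c : Vec n × Vec n) (q : N) : N :=
  toTorus c.2 +ᵥ φ c.1 1 q

theorem isMIntegralCurve_complexFlow (hs : IsSmoothTorusAction n I N)
    (hhol : IsHolomorphicAction K n)
    (hφ : ∀ ξ : Vec n, IsFlow (fun q : N => -(K.J q (fundamental I q ξ))) (φ ξ))
    (c : Vec n × Vec n) (q : N) :
    IsMIntegralCurve (I := I) (fun s : ℝ => complexFlow φ (s • c) q)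
      (fun q => complexFundamental K q c) := by
  have h0 : (fun s : ℝ => complexFlow φ (s • c) q)
      = (fun q : Vec n × N => toTorus q.1 +ᵥ q.2) ∘ fun s : ℝ => (s • c.2, φ c.1 s q) := by
    funext s
    simp [complexFlow, flow_smul hs hφ]
  intro s
  have h1 : HasMFDerivAt 𝓘(ℝ, ℝ) 𝓘(ℝ, Vec n) (fun s : ℝ => s • c.2) s
      ((1 : ℝ →L[ℝ] ℝ).smulRight c.2) :=
    ((hasFDerivAt_id (𝕜 := ℝ) s).smul_const c.2).hasMFDerivAt
  have h3 := HasMFDerivAt.comp s (hasMFDerivAt_action hs (s • c.2) (φ c.1 s q))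
    (h1.prodMk ((hφ c.1 q).2 s))
  rw [← h0] at h3
  refine h3.congr_mfderiv (ContinuousLinearMap.ext_ring ?_)
  have h4 : complexFlow φ (s • c) q = toTorus (s • c.2) +ᵥ φ c.1 s q := congrFun h0 s
  show (fundamental I (toTorus (s • c.2) +ᵥ φ c.1 s q) ((1 : ℝ) • c.2) : E)
      + (mfderiv I I (fun q : N => toTorus (s • c.2) +ᵥ q) (φ c.1 s q)
        ((1 : ℝ) • -(K.J (φ c.1 s q) (fundamental I (φ c.1 s q) c.1))) : E)
    = (1 : ℝ) • (complexFundamental K (complexFlow φ (s • c) q) c : E)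
  rw [h4, one_smul, one_smul, one_smul]
  refine Eq.trans ?_ (complexFundamental_apply K _ c).symm
  rw [map_neg, hhol, mfderiv_vadd_fundamental hs]
  exact add_comm _ _

theorem isCommutingFlow_complexFlow {μ : N → Vec n} (hs : IsSmoothTorusAction n I N)
    (hhol : IsHolomorphicAction K n) (hμ : IsMomentumMap K μ) (hE : Module.finrank ℝ E = 2 * n)
    (hφ : ∀ ξ : Vec n, IsFlow (fun q : N => -(K.J q (fundamental I q ξ))) (φ ξ)) :
    IsCommutingFlow (fun q => complexFundamental (n := n) K q) (complexFlow φ) (freeSet n N) where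
  smooth c := isSmoothVectorField_complexFundamental K hs c
  bracket c d q := by
    have : CompleteSpace E := FiniteDimensional.complete ℝ E
    exact mlieBracket_complexFundamental K hs hhol c d q
  zero q := by
    have h := flow_smul hs hφ 0 0 q
    rw [smul_zero] at h
    simp [complexFlow, toTorus_zero, h, (hφ 0 q).1]
  curve c q := isMIntegralCurve_complexFlow hs hhol hφ c q
  invariant c q hq := vadd_mem_freeSet _ (flow_mem_freeSet hs hhol hφ _ _ hq)
  bijective q hq := complexFundamental_bijective hs hμ hE hq

end Flow

end ComplexFlow

/-! ### A connectedness criterion for dense subsets. -/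

section DensePreconnected

open Topology

/-- A dense subset of a connected space is connected if its points close to any given point of the
space can be joined in it. -/
theorem isPreconnected_of_dense_of_locally_joinedIn {X : Type*} [TopologicalSpace X]
    [PreconnectedSpace X] {S : Set X} (hd : Dense S)
    (hj : ∀ q, ∃ U ∈ 𝓝 q, ∀ x ∈ U ∩ S, ∀ y ∈ U ∩ S, JoinedIn S x y) : IsPreconnected S := by
  rw [isPreconnected_iff_subset_of_disjoint]
  intro u v hu hv hcov hdisj
  -- A separation of `S` by `u` and `v` extends to one of `X` by `A u` and `A v`: the local joining
  -- gives the covering, density the disjointness.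
  let A : Set X → Set X := fun u => {q | ∀ᶠ q' in 𝓝 q, q' ∈ S → q' ∈ u}
  have hAo : ∀ u, IsOpen (A u) := fun u => isOpen_setOfPred_eventually_nhds
  have hpath : ∀ u v : Set X, IsOpen u → IsOpen v → S ⊆ u ∪ v → S ∩ (u ∩ v) = ∅ →
      ∀ x y, JoinedIn S x y → x ∈ u → y ∈ u := by
    intro u v hu hv hcov hdisj x y hxy hx
    have hr : IsPreconnected (Set.range hxy.somePath) :=
      isPreconnected_range hxy.somePath.continuous
    have hrS : Set.range hxy.somePath ⊆ S := by
      rintro _ ⟨t, rfl⟩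
      exact hxy.somePath_mem t
    rcases isPreconnected_iff_subset_of_disjoint.1 hr u v hu hv (hrS.trans hcov)
      (Set.subset_empty_iff.1 ((Set.inter_subset_inter_left _ hrS).trans hdisj.subset)) with h | h
    · exact h ⟨1, hxy.somePath.target⟩
    · exact absurd ⟨hxy.source_mem, hx, h ⟨0, hxy.somePath.source⟩⟩
        (Set.eq_empty_iff_forall_notMem.1 hdisj x)
  have hAB : (Set.univ : Set X) ⊆ A u ∪ A v := by
    intro q _
    obtain ⟨U, hU, hUj⟩ := hj q
    obtain ⟨x, hxU, hxS⟩ := hd.inter_nhds_nonempty hU |>.imp fun x hx => hx.symm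
    rcases hcov hxS with hx | hx
    · left
      filter_upwards [hU] with y hyU hyS
      exact hpath u v hu hv hcov hdisj x y (hUj x ⟨hxU, hxS⟩ y ⟨hyU, hyS⟩) hx
    · right
      filter_upwards [hU] with y hyU hyS
      exact hpath v u hv hu (by rwa [Set.union_comm]) (by rwa [Set.inter_comm v u]) x y
        (hUj x ⟨hxU, hxS⟩ y ⟨hyU, hyS⟩) hx
  have hABd : Set.univ ∩ (A u ∩ A v) = ∅ := by
    rw [Set.univ_inter, Set.eq_empty_iff_forall_notMem]
    rintro q ⟨h1, h2⟩
    obtain ⟨x, hxS, h1, h2⟩ := hd.inter_nhds_nonempty (h1.and h2)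
    exact Set.eq_empty_iff_forall_notMem.1 hdisj x ⟨hxS, h1 hxS, h2 hxS⟩
  refine (isPreconnected_iff_subset_of_disjoint.1 isPreconnected_univ (A u) (A v) (hAo u) (hAo v)
    hAB hABd).imp (fun h q hq => ?_) (fun h q hq => ?_)
  · exact (h (Set.mem_univ q)).self_of_nhds hq
  · exact (h (Set.mem_univ q)).self_of_nhds hq

end DensePreconnected

/-! ### Torsion elements near their fixed points. -/

section FixedPoints

open Topology

variable {n : ℕ} {E : Type*} [NormedAddCommGroup E] [NormedSpace ℝ E]
  {H : Type*} [TopologicalSpace H] {I : ModelWithCorners ℝ E H}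
  {N : Type*} [TopologicalSpace N] [ChartedSpace H N] [AddAction (Torus n) N]

theorem hasMFDerivAt_nsmul_vadd {a : Torus n} {q : N}
    (hq : a +ᵥ q = q) (hD : HasMFDerivAt I I (fun q : N => a +ᵥ q) q (ContinuousLinearMap.id ℝ E :))
    (j : ℕ) : (j • a +ᵥ q = q) ∧
      HasMFDerivAt I I (fun q : N => j • a +ᵥ q) q (ContinuousLinearMap.id ℝ E :) := by
  induction j with
  | zero =>
    have h0 : (fun q : N => 0 • a +ᵥ q) = id := by
      funext q'
      rw [zero_smul, zero_vadd, id]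
    refine ⟨congrFun h0 q, ?_⟩
    rw [h0]
    exact hasMFDerivAt_id (I := I) q
  | succ j ih =>
    obtain ⟨h1, h2⟩ := ih
    have h0 : (fun q : N => (j + 1) • a +ᵥ q) = (fun q : N => j • a +ᵥ q) ∘ fun q => a +ᵥ q := by
      funext q'
      simp only [Function.comp_apply]
      rw [add_smul, one_smul, add_vadd]
    refine ⟨(congrFun h0 q).trans ?_, ?_⟩
    · simp only [Function.comp_apply, hq, h1]
    · rw [h0]
      have h3 : HasMFDerivAt I I (fun q : N => j • a +ᵥ q) (a +ᵥ q)
        (ContinuousLinearMap.id ℝ E :) := by rw [hq]; exact h2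
      exact h3.comp q hD

/-- Stabilizers are closed, so a nontrivial one contains nontrivial torsion. This leaves only
countably many fixed sets to consider. -/
theorem notMem_freeSet_iff [T2Space N] (hs : IsSmoothTorusAction n I N) (q : N) :
    q ∉ freeSet n N ↔ ∃ a : Torus n, a ≠ 0 ∧ (∃ m : ℕ, 0 < m ∧ m • a = 0) ∧ a +ᵥ q = q := by
  constructor
  · intro h
    simp only [freeSet, Set.mem_ofPred_eq, not_forall] at h
    obtain ⟨c, hc, hc0⟩ := h
    obtain ⟨a, haG, ha0, ham⟩ := exists_torsion_mem_of_isClosed (isClosed_stabilizer hs q) hc hc0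
    exact ⟨a, ha0, ham, haG⟩
  · rintro ⟨a, ha, -, haq⟩ h
    exact ha (h a haq)

variable [IsManifold I ∞ N] [I.Boundaryless]

/-- A transformation of finite order that is tangent to the identity at a fixed point is the
identity near that point. -/
theorem eventually_vadd_eq_self [FiniteDimensional ℝ E] (hs : IsSmoothTorusAction n I N)
    {a : Torus n} {m : ℕ} (hm : 0 < m) (hma : m • a = 0) {q : N} (hq : a +ᵥ q = q)
    (hD : HasMFDerivAt I I (fun q : N => a +ᵥ q) q (ContinuousLinearMap.id ℝ E :)) :
    ∀ᶠ q' in 𝓝 q, a +ᵥ q' = q' := by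
  have : CompleteSpace E := FiniteDimensional.complete ℝ E
  set ψ := extChartAt I q with hψ
  -- The sum over the cyclic group generated by `a` is invariant under `a` and has derivative `m`
  -- times the identity. It is thus locally injective, which forces `a +ᵥ q' = q'`.
  let F : E → E := fun w => ∑ j ∈ Finset.range m, ψ (j • a +ᵥ ψ.symm w)
  have hz : ψ q ∈ ψ.target := mem_extChartAt_target q
  have hzq : ψ.symm (ψ q) = q := extChartAt_to_inv q
  have hj : ∀ j : ℕ, HasStrictFDerivAt (fun w => ψ (j • a +ᵥ ψ.symm w))
      (ContinuousLinearMap.id ℝ E) (ψ q) := by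
    intro j
    obtain ⟨hjq, hjD⟩ := hasMFDerivAt_nsmul_vadd hq hD j
    have hjz : j • a +ᵥ ψ.symm (ψ q) = ψ.symm (ψ q) := by rw [hzq, hjq]
    have hsrc : j • a +ᵥ ψ.symm (ψ q) ∈ ψ.source := by rw [hjz]; exact ψ.map_target hz
    have h1 := contDiffAt_chart_conj (I := I) q hz ((contMDiff_vadd hs (j • a)) _) hsrc
    have hjD' : HasMFDerivAt I I (fun q : N => j • a +ᵥ q) (ψ.symm (ψ q))
        (ContinuousLinearMap.id ℝ E :) := by rw [hzq]; exact hjD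
    have h2 := hasFDerivAt_chart_conj (I := I) q hz hjD' hsrc
    refine h1.hasStrictFDerivAt' (h2.congr_fderiv (ContinuousLinearMap.ext fun v => ?_)) (by simp)
    have h3 := dchart_dchartSymm (I := I) q hz v
    refine Eq.trans ?_ h3
    exact congrArg (fun r : N => dchart I q r (dchartSymm I q (ψ q) v)) hjz
  have hF : HasStrictFDerivAt F (∑ j ∈ Finset.range m, ContinuousLinearMap.id ℝ E) (ψ q) :=
    HasStrictFDerivAt.fun_sum fun j _ => hj j
  have hm' : (m : ℝ) ≠ 0 := by exact_mod_cast hm.ne'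
  have hF' : HasStrictFDerivAt F
      ((ContinuousLinearEquiv.smulLeft (Units.mk0 (m : ℝ) hm') : E ≃L[ℝ] E) : E →L[ℝ] E)
      (ψ q) := by
    refine hF.congr_fderiv (ContinuousLinearMap.ext fun v => ?_)
    rw [Finset.sum_const, Finset.card_range]
    show (m • ContinuousLinearMap.id ℝ E) v = (m : ℝ) • v
    simp [Nat.cast_smul_eq_nsmul]
  have hinj := (hF'.toOpenPartialHomeomorph F).injOn
  have hnhds := (hF'.toOpenPartialHomeomorph F).open_source.mem_nhds
    hF'.mem_toOpenPartialHomeomorph_source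
  set O := (hF'.toOpenPartialHomeomorph F).source
  have hψc : ContinuousAt ψ q := continuousAt_extChartAt q
  have hac : ContinuousAt (fun q : N => a +ᵥ q) q := (contMDiff_vadd hs a).continuous.continuousAt
  have hψa : ContinuousAt ψ (a +ᵥ q) := by rw [hq]; exact hψc
  have e1 := hψc.eventually_mem hnhds
  have e2 : ∀ᶠ q' in 𝓝 q, ψ (a +ᵥ q') ∈ O := by
    have h3 : Filter.Tendsto (fun q' => a +ᵥ q') (𝓝 q) (𝓝 q) := by
      have h4 := hac.tendsto
      rwa [hq] at h4
    exact h3.eventually e1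
  have e3 : ∀ᶠ q' in 𝓝 q, q' ∈ ψ.source := extChartAt_source_mem_nhds q
  have e4 : ∀ᶠ q' in 𝓝 q, a +ᵥ q' ∈ ψ.source :=
    hac.eventually_mem (by rw [hq]; exact extChartAt_source_mem_nhds q)
  filter_upwards [e1, e2, e3, e4] with q' h1 h2 h3 h4
  refine ψ.injOn h4 h3 (hinj h2 h1 ?_)
  show F (ψ (a +ᵥ q')) = F (ψ q')
  simp only [F, ψ.left_inv h3, ψ.left_inv h4]
  have h5 : ∀ j : ℕ, j • a +ᵥ (a +ᵥ q') = (j + 1) • a +ᵥ q' := fun j => by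
    rw [add_smul, one_smul, add_vadd]
  simp only [h5]
  have h6 := Finset.sum_range_succ (fun j => ψ (j • a +ᵥ q')) m
  rw [Finset.sum_range_succ'] at h6
  simpa [hma] using h6

/-- Being fixed is a closed condition, and in a chart the derivative is continuous, so both pass to
limits of points near which `a` acts trivially. -/
theorem hasMFDerivAt_id_of_eventually [T2Space N] (hs : IsSmoothTorusAction n I N) {a : Torus n}
    {q : N} (hfr : ∃ᶠ q₁ in 𝓝 q, ∀ᶠ q' in 𝓝 q₁, a +ᵥ q' = q') :
    a +ᵥ q = q ∧ HasMFDerivAt I I (fun q : N => a +ᵥ q) q (ContinuousLinearMap.id ℝ E :) := by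
  have hq : a +ᵥ q = q := by
    have hcl : IsClosed {q : N | a +ᵥ q = q} :=
      isClosed_eq (contMDiff_vadd hs a).continuous continuous_id
    exact hcl.mem_of_frequently_of_tendsto (hfr.mono fun q₁ h => h.self_of_nhds) Filter.tendsto_id
  refine ⟨hq, ?_⟩
  set ψ := extChartAt I q with hψ
  have hz : ψ q ∈ ψ.target := mem_extChartAt_target q
  have hzq : ψ.symm (ψ q) = q := extChartAt_to_inv q
  have hsrc : a +ᵥ ψ.symm (ψ q) ∈ ψ.source := by rw [hzq, hq]; exact mem_extChartAt_source q
  let G : E → E := fun w => ψ (a +ᵥ ψ.symm w)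
  have hG : ContDiffAt ℝ ∞ G (ψ q) :=
    contDiffAt_chart_conj (I := I) q hz ((contMDiff_vadd hs a) _) hsrc
  have hGc : ContinuousAt (fderiv ℝ G) (ψ q) := hG.continuousAt_fderiv (by simp)
  have hψc : Filter.Tendsto ψ (𝓝 q) (𝓝 (ψ q)) := continuousAt_extChartAt q
  have hid : fderiv ℝ G (ψ q) = ContinuousLinearMap.id ℝ E := by
    refine isClosed_singleton.mem_of_frequently_of_tendsto (s := {ContinuousLinearMap.id ℝ E})
      (f := fun q₁ => fderiv ℝ G (ψ q₁)) (b := 𝓝 q) ?_ (hGc.tendsto.comp hψc)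
    refine (hfr.and_eventually (extChartAt_source_mem_nhds (I := I) q)).mono ?_
    rintro q₁ ⟨h1, h2⟩
    have hq₁ : ψ.symm (ψ q₁) = q₁ := ψ.left_inv h2
    have hsc : Filter.Tendsto ψ.symm (𝓝 (ψ q₁)) (𝓝 q₁) := by
      have h3 := (contMDiffAt_chart_symm (I := I) q (ψ.map_source h2)).continuousAt.tendsto
      rwa [hq₁] at h3
    have h4 : G =ᶠ[𝓝 (ψ q₁)] id := by
      filter_upwards [hsc.eventually h1, (isOpen_extChartAt_target q).mem_nhds (ψ.map_source h2)]
        with w hw hw'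
      show ψ (a +ᵥ ψ.symm w) = w
      rw [hw, ψ.right_inv hw']
    show fderiv ℝ G (ψ q₁) = _
    rw [h4.fderiv_eq, fderiv_id]
  have h5 := hasFDerivAt_chart_conj (I := I) q hz (hasMFDerivAt_vadd hs a (ψ.symm (ψ q))) hsrc
  let D : N → E →L[ℝ] E := fun q => mfderiv I I (fun q : N => a +ᵥ q) q
  have h6 : dchart I q (a +ᵥ ψ.symm (ψ q)) ∘L D (ψ.symm (ψ q)) ∘L dchartSymm I q (ψ q)
        = ContinuousLinearMap.id ℝ E := h5.fderiv.symm.trans hid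
  refine (hasMFDerivAt_vadd hs a q).congr_mfderiv (ContinuousLinearMap.ext fun (v : E) => ?_)
  have hqs : q ∈ ψ.source := mem_extChartAt_source q
  have h8 : dchart I q (a +ᵥ ψ.symm (ψ q)) (D (ψ.symm (ψ q))
      (dchartSymm I q (ψ q) (dchart I q q v))) = dchart I q q v :=
    DFunLike.congr_fun h6 (dchart I q q v)
  rw [dchartSymm_dchart' q hqs v, hzq, hq] at h8
  have h9 := congrArg (dchartSymm I q (ψ q)) h8
  rw [dchartSymm_dchart' q hqs, dchartSymm_dchart' q hqs] at h9
  exact h9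

/-- Otherwise the set of points near which `a` acts trivially, which is clopen, is nonempty and
hence everything, against effectiveness. -/
theorem not_hasMFDerivAt_id [FiniteDimensional ℝ E] [T2Space N] [PreconnectedSpace N]
    [FaithfulVAdd (Torus n) N]
    (hs : IsSmoothTorusAction n I N) {a : Torus n} (ha : a ≠ 0) {m : ℕ} (hm : 0 < m)
    (hma : m • a = 0) {q : N} (hq : a +ᵥ q = q) :
    ¬ HasMFDerivAt I I (fun q : N => a +ᵥ q) q (ContinuousLinearMap.id ℝ E :) := by
  intro hD
  have hcl : IsClopen {q : N | ∀ᶠ q' in 𝓝 q, a +ᵥ q' = q'} := by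
    refine ⟨isClosed_iff_frequently.2 fun q₁ hq₁ => ?_, isOpen_setOfPred_eventually_nhds⟩
    obtain ⟨h1, h2⟩ := hasMFDerivAt_id_of_eventually hs hq₁
    exact eventually_vadd_eq_self hs hm hma h1 h2
  have huniv := hcl.eq_univ ⟨q, eventually_vadd_eq_self hs hm hma hq hD⟩
  apply ha
  refine FaithfulVAdd.eq_of_vadd_eq_vadd (P := N) fun q' => ?_
  have h1 : q' ∈ {q : N | ∀ᶠ q' in 𝓝 q, a +ᵥ q' = q'} := by rw [huniv]; trivial
  rw [zero_vadd]
  exact h1.self_of_nhds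

end FixedPoints

/-! ### Connectedness of N° and transitivity of the complexified torus. -/

section FreeSet

open Topology

variable {n : ℕ} {E : Type*} [NormedAddCommGroup E] [InnerProductSpace ℝ E] [FiniteDimensional ℝ E]
  {H : Type*} [TopologicalSpace H] {I : ModelWithCorners ℝ E H} [I.Boundaryless]
  {N : Type*} [TopologicalSpace N] [T2Space N] [PreconnectedSpace N] [ChartedSpace H N]
  [IsManifold I ∞ N] [AddAction (Torus n) N] [FaithfulVAdd (Torus n) N] {K : KahlerStructure I N}

/-- In a chart, the fixed points of a non-trivial transformation of finite order form a set of
codimension at least two. -/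
theorem isThin_fixed (hs : IsSmoothTorusAction n I N) (hhol : IsHolomorphicAction K n)
    {a : Torus n} (ha : a ≠ 0) {m : ℕ} (hm : 0 < m) (hma : m • a = 0) (q : N) :
    IsThin {w ∈ (extChartAt I q).target |
      a +ᵥ (extChartAt I q).symm w = (extChartAt I q).symm w} := by
  set ψ := extChartAt I q with hψ
  refine isThin_of_fixed (f := fun w => ψ (a +ᵥ ψ.symm w)) ?_ ?_
  · rintro w ⟨hw, hfix⟩
    rw [hfix, ψ.right_inv hw]
  · rintro w ⟨hw, hfix⟩
    have hsrc : a +ᵥ ψ.symm w ∈ ψ.source := by rw [hfix]; exact ψ.map_target hw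
    have h1 := contDiffAt_chart_conj (I := I) q hw ((contMDiff_vadd hs a) _) hsrc
    have h2 := hasFDerivAt_chart_conj (I := I) q hw (hasMFDerivAt_vadd hs a (ψ.symm w)) hsrc
    let D : E →L[ℝ] E := mfderiv I I (fun q : N => a +ᵥ q) (ψ.symm w)
    let J : E →L[ℝ] E := K.J (ψ.symm w)
    have hB : dchart I q (a +ᵥ ψ.symm w) ∘L D ∘L dchartSymm I q w
        = dchart I q (ψ.symm w) ∘L D ∘L dchartSymm I q w := by rw [hfix]
    have hDJ : ∀ v, D (J v) = J (D v) := by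
      intro v
      refine (hhol a (ψ.symm w) v).trans ?_
      exact congrArg (fun r : N => (K.J r (D v : E) : E)) hfix
    refine ⟨dchart I q (ψ.symm w) ∘L D ∘L dchartSymm I q w,
      dchart I q (ψ.symm w) ∘L J ∘L dchartSymm I q w, ?_, ?_, ?_, ?_⟩
    · rw [← hB]
      exact h1.hasStrictFDerivAt' h2 (by simp)
    · intro v
      simp only [ContinuousLinearMap.comp_apply]
      rw [dchartSymm_dchart q hw]
      have h3 : J (J (dchartSymm I q w v)) = -(dchartSymm I q w v) := K.J_sq _ _
      rw [h3, map_neg, dchart_dchartSymm q hw]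
    · intro v
      simp only [ContinuousLinearMap.comp_apply]
      rw [dchartSymm_dchart q hw, dchartSymm_dchart q hw, hDJ]
    · intro hid
      refine not_hasMFDerivAt_id hs ha hm hma hfix ?_
      refine (hasMFDerivAt_vadd hs a _).congr_mfderiv (ContinuousLinearMap.ext fun (v : E) => ?_)
      have h3 := congrArg (dchartSymm I q w) (DFunLike.congr_fun hid (dchart I q (ψ.symm w) v))
      simp only [ContinuousLinearMap.comp_apply, ContinuousLinearMap.id_apply] at h3
      rw [dchartSymm_dchart q hw, dchartSymm_dchart q hw] at h3
      exact h3

theorem freeSet_eq_compl_iUnion_chart (hs : IsSmoothTorusAction n I N)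
    (hhol : IsHolomorphicAction K n) (q : N) :
    ∃ (T : {a : Torus n | ∃ m : ℕ, 0 < m ∧ m • a = 0} → Set E), (∀ a, IsThin (T a)) ∧
      ∀ w ∈ (extChartAt I q).target,
        (extChartAt I q).symm w ∈ freeSet n N ↔ w ∈ (⋃ a, T a)ᶜ := by
  refine ⟨fun a => {w ∈ (extChartAt I q).target | (a : Torus n) ≠ 0 ∧
      (a : Torus n) +ᵥ (extChartAt I q).symm w = (extChartAt I q).symm w}, ?_, ?_⟩
  · rintro ⟨a, m, hm, hma⟩
    by_cases ha : a = 0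
    · rintro s ⟨-, hs, -⟩
      exact absurd ha hs
    · simpa [ha] using isThin_fixed hs hhol ha hm hma q
  · intro w hw
    rw [Set.mem_compl_iff, ← not_iff_not, not_not, notMem_freeSet_iff hs, Set.mem_iUnion]
    constructor
    · rintro ⟨a, ha, ham, haw⟩
      exact ⟨⟨a, ham⟩, hw, ha, haw⟩
    · rintro ⟨⟨a, ham⟩, -, ha, haw⟩
      exact ⟨a, ha, ham, haw⟩

/-- In each chart N° is the complement of countably many thin sets: it is dense, and its points in a
small coordinate ball can be joined inside it. -/
theorem isPreconnected_freeSet (hs : IsSmoothTorusAction n I N) (hhol : IsHolomorphicAction K n) :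
    IsPreconnected (freeSet n N) := by
  have hc : Countable {a : Torus n | ∃ m : ℕ, 0 < m ∧ m • a = 0} := countable_torsion n
  refine isPreconnected_of_dense_of_locally_joinedIn ?_ ?_
  · intro q
    rw [mem_closure_iff_nhds]
    intro V hV
    obtain ⟨T, hT, hTf⟩ := freeSet_eq_compl_iUnion_chart hs hhol q
    have hz := mem_extChartAt_target (I := I) q
    have h1 : ∀ᶠ w in 𝓝 (extChartAt I q q), (extChartAt I q).symm w ∈ V := by
      refine (contMDiffAt_chart_symm (I := I) q hz).continuousAt.eventually_mem ?_
      rwa [extChartAt_to_inv]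
    obtain ⟨w, hw, hwV, hwt⟩ := (dense_compl_iUnion_of_isThin hT).inter_nhds_nonempty
      (h1.and ((isOpen_extChartAt_target q).mem_nhds hz))
    exact ⟨_, hwV, (hTf w hwt).2 hw⟩
  · intro q
    obtain ⟨T, hT, hTf⟩ := freeSet_eq_compl_iUnion_chart hs hhol q
    obtain ⟨ε, hε, hball⟩ := Metric.isOpen_iff.1 (isOpen_extChartAt_target (I := I) q) _
      (mem_extChartAt_target q)
    refine ⟨(extChartAt I q).source ∩ extChartAt I q ⁻¹' Metric.ball (extChartAt I q q) ε,
      Filter.inter_mem (extChartAt_source_mem_nhds q)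
        ((continuousAt_extChartAt q).preimage_mem_nhds (Metric.ball_mem_nhds _ hε)), ?_⟩
    rintro x ⟨⟨hxs, hxb⟩, hxf⟩ y ⟨⟨hys, hyb⟩, hyf⟩
    have hmem : ∀ z ∈ (extChartAt I q).source, z ∈ freeSet n N →
        extChartAt I q z ∈ Metric.ball (extChartAt I q q) ε →
        extChartAt I q z ∈ Metric.ball (extChartAt I q q) ε \ ⋃ a, T a := by
      intro z hz hzf hzb
      refine ⟨hzb, (hTf _ ((extChartAt I q).map_source hz)).1 ?_⟩
      rwa [(extChartAt I q).left_inv hz]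
    have hj := joinedIn_diff_iUnion_of_isThin hT (convex_ball (extChartAt I q q) ε)
      Metric.isOpen_ball (hmem x hxs hxf hxb) (hmem y hys hyf hyb)
    have hj2 := hj.map_continuousOn (f := (extChartAt I q).symm)
      ((continuousOn_extChartAt_symm q).mono fun w hw => hball hw.1)
    rw [(extChartAt I q).left_inv hxs, (extChartAt I q).left_inv hys] at hj2
    refine hj2.mono ?_
    rintro _ ⟨w, hw, rfl⟩
    exact (hTf w (hball hw.1)).2 hw.2

/-- The complexified torus acts transitively on the free points. -/
theorem range_complexFlow {μ : N → Vec n} {φ : Vec n → ℝ → N → N}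
    (hs : IsSmoothTorusAction n I N) (hhol : IsHolomorphicAction K n) (hμ : IsMomentumMap K μ)
    (hE : Module.finrank ℝ E = 2 * n)
    (hφ : ∀ ξ : Vec n, IsFlow (fun q : N => -(K.J q (fundamental I q ξ))) (φ ξ))
    {p : N} (hp : p ∈ freeSet n N) :
    Set.range (fun c => complexFlow φ c p) = freeSet n N := by
  have hΨ := isCommutingFlow_complexFlow hs hhol hμ hE hφ
  have hsub : ∀ q ∈ freeSet n N, Set.range (fun c => complexFlow φ c q) ⊆ freeSet n N := by
    rintro q hq _ ⟨c, rfl⟩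
    exact hΨ.invariant c q hq
  refine (hsub p hp).antisymm ?_
  -- The union of the other orbits in N°. Orbits are open and pairwise disjoint or equal, so
  -- connectedness leaves only the orbit of `p`.
  let V := ⋃ q ∈ freeSet n N \ Set.range (fun c => complexFlow φ c p),
    Set.range (fun c => complexFlow φ c q)
  refine (isPreconnected_freeSet hs hhol).subset_left_of_subset_union
    (hΨ.isOpen_range hp) (v := V) ?_ ?_ ?_ ⟨p, hp, 0, hΨ.zero p⟩
  · exact isOpen_biUnion fun q hq => hΨ.isOpen_range hq.1
  · rw [Set.disjoint_left]
    rintro _ ⟨c, rfl⟩ hV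
    obtain ⟨q, ⟨hq, hqp⟩, d, hd⟩ := Set.mem_iUnion₂.1 hV
    apply hqp
    refine ⟨c + -d, ?_⟩
    have h1 : complexFlow φ c p = complexFlow φ d q := hd.symm
    have h2 := hΨ.add_apply hq d (-d)
    rw [add_neg_cancel, hΨ.zero] at h2
    show complexFlow φ (c + -d) p = q
    rw [hΨ.add_apply hp, h1, ← h2]
  · intro q hq
    by_cases h : q ∈ Set.range (fun c => complexFlow φ c p)
    · exact Or.inl h
    · exact Or.inr (Set.mem_iUnion₂.2 ⟨q, ⟨hq, h⟩, 0, hΨ.zero q⟩)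

end FreeSet

/-! ### The momentum map along the flows. -/

theorem complexFlow_mk_zero {n : ℕ} {N : Type*} [AddAction (Torus n) N]
    (φ : Vec n → ℝ → N → N) (x : Vec n) (q : N) :
    complexFlow φ (x, 0) q = φ x 1 q := by
  simp [complexFlow, toTorus_zero]

theorem sum_smul_single {n : ℕ} (t : Vec n) :
    ∑ i, t i • (EuclideanSpace.single i 1 : Vec n) = t := by
  simpa using (EuclideanSpace.basisFun (Fin n) ℝ).sum_repr t

section Momentum

variable {n : ℕ} {E : Type*} [NormedAddCommGroup E] [NormedSpace ℝ E]
  {H : Type*} [TopologicalSpace H] {I : ModelWithCorners ℝ E H}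
  {N : Type*} [TopologicalSpace N] [ChartedSpace H N] [IsManifold I ∞ N]
  [AddAction (Torus n) N] {K : KahlerStructure I N}

/-- The metric is recovered from `ω` and `J` by `g(v, w) = ω(v, J w)`. -/
theorem isIsometricAction_of_isSymplecticAction (hsymp : IsSymplecticAction K n)
    (hhol : IsHolomorphicAction K n) : IsIsometricAction K n := by
  intro a q v w
  have h1 := hsymp a q v (K.J q w)
  rw [hhol] at h1
  rw [← K.hermitian, ← K.hermitian q]
  exact h1

theorem inner_fundamental_vadd (hs : IsSmoothTorusAction n I N) (hiso : IsIsometricAction K n)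
    (a : Torus n) (q : N) (u v : Vec n) :
    K.g.inner (a +ᵥ q) (fundamental I (a +ᵥ q) u) (fundamental I (a +ᵥ q) v)
      = K.g.inner q (fundamental I q u) (fundamental I q v) := by
  rw [← mfderiv_vadd_fundamental hs, ← mfderiv_vadd_fundamental hs]
  exact hiso a q _ _

variable {μ : N → Vec n}

theorem IsMomentumMap.inner_mfderiv_complexFundamental (hs : IsSmoothTorusAction n I N)
    (hμ : IsMomentumMap K μ) (q : N) (c : Vec n × Vec n) (w : Vec n) :
    inner (E := Vec n) ℝ (mfderiv I 𝓘(ℝ, Vec n) μ q (complexFundamental K q c)) w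
      = -K.g.inner q (fundamental I q c.1) (fundamental I q w) := by
  rw [hμ.inner_mfderiv, complexFundamental_apply, map_add, hμ.inner_J_fundamental hs, map_neg,
    K.hermitian, add_zero, K.g.symm]

variable (K μ) in
/-- The map `v ↦ dμ (-J v_N)`. -/
noncomputable def momentumDeriv (q : N) : Vec n →L[ℝ] Vec n :=
  (mfderiv I 𝓘(ℝ, Vec n) μ q : TangentSpace I q →L[ℝ] Vec n) ∘L
    complexFundamental K q ∘L ContinuousLinearMap.inl ℝ (Vec n) (Vec n)

theorem IsMomentumMap.inner_momentumDeriv (hs : IsSmoothTorusAction n I N)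
    (hμ : IsMomentumMap K μ) (q : N) (v w : Vec n) :
    inner ℝ (momentumDeriv K μ q v) w = -K.g.inner q (fundamental I q v) (fundamental I q w) :=
  hμ.inner_mfderiv_complexFundamental hs q (v, 0) w

variable [FiniteDimensional ℝ E] [I.Boundaryless] [T2Space N]

theorem inner_fundamental_pos (K : KahlerStructure I N) (hs : IsSmoothTorusAction n I N) {q : N}
    (hq : q ∈ freeSet n N) {u : Vec n} (hu : u ≠ 0) :
    0 < K.g.inner q (fundamental I q u) (fundamental I q u) :=
  K.g.pos q _ fun h0 => hu ((injective_iff_map_eq_zero _).1 (fundamental_injective hs hq) u h0)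

/-- Pairing `dμ` with `c.1` gives minus the squared length of the fundamental field of `c.1`. So on
N° the fields `r_N` span the kernel of `dμ`, and the `-J v_N` span its orthogonal complement. -/
theorem IsMomentumMap.mfderiv_complexFundamental_eq_zero_iff (hs : IsSmoothTorusAction n I N)
    (hμ : IsMomentumMap K μ) {q : N} (hq : q ∈ freeSet n N) (c : Vec n × Vec n) :
    mfderiv I 𝓘(ℝ, Vec n) μ q (complexFundamental K q c) = 0 ↔ c.1 = 0 := by
  constructor
  · intro h0
    by_contra hne
    have h1 := hμ.inner_mfderiv_complexFundamental hs q c c.1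
    rw [h0] at h1
    have h2 : (0 : ℝ) = _ := (inner_zero_left c.1).symm.trans h1
    linarith [inner_fundamental_pos K hs hq hne]
  · intro h0
    rw [complexFundamental_apply, h0, map_zero, map_zero, neg_zero, zero_add,
      hμ.mfderiv_fundamental hs]

theorem IsMomentumMap.surjective_mfderiv (hs : IsSmoothTorusAction n I N)
    (hμ : IsMomentumMap K μ) {q : N} (hq : q ∈ freeSet n N) :
    Function.Surjective (mfderiv I 𝓘(ℝ, Vec n) μ q) := by
  have hinj : Function.Injective (momentumDeriv K μ q) :=
    (injective_iff_map_eq_zero _).2 fun v hv =>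
      (hμ.mfderiv_complexFundamental_eq_zero_iff hs hq (v, 0)).1 hv
  have hsurj : Function.Surjective (momentumDeriv K μ q) :=
    LinearMap.injective_iff_surjective (f := (momentumDeriv K μ q : Vec n →ₗ[ℝ] Vec n)).1 hinj
  intro z
  obtain ⟨v, hv⟩ := hsurj z
  exact ⟨_, hv⟩

/-- The derivative of `μ` is isometric on the orthogonal complement of its kernel as soon as it is
so on the vectors `-J v_N`. -/
theorem IsMomentumMap.isSubmersionMetric_iff (hs : IsSmoothTorusAction n I N)
    (hμ : IsMomentumMap K μ) (hE : Module.finrank ℝ E = 2 * n)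
    {k : Vec n → Vec n →L[ℝ] Vec n →L[ℝ] ℝ} (hk : IsRiemannianMetric (μ '' freeSet n N) k) :
    IsSubmersionMetric K μ k ↔ ∀ q ∈ freeSet n N, ∀ u v : Vec n,
      k (μ q) (momentumDeriv K μ q u) (momentumDeriv K μ q v)
        = K.g.inner q (fundamental I q u) (fundamental I q v) := by
  constructor
  · intro hsub q hq u v
    have horth : ∀ (u : Vec n) (w : TangentSpace I q), mfderiv I 𝓘(ℝ, Vec n) μ q w = 0 →
        K.g.inner q (complexFundamental K q (u, 0)) w = 0 := by
      intro u w hw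
      obtain ⟨c, rfl⟩ := (complexFundamental_bijective hs hμ hE hq).2 w
      rw [hμ.mfderiv_complexFundamental_eq_zero_iff hs hq] at hw
      rw [inner_complexFundamental hs hμ, hw]
      simp
    refine (hsub.isometric q hq _ _ fun w hw => ⟨horth u w hw, horth v w hw⟩).trans ?_
    rw [inner_complexFundamental hs hμ]
    simp
  · intro hiso
    refine ⟨hk, fun q hq => hμ.surjective_mfderiv hs hq, fun q hq u v huv => ?_⟩
    have hform : ∀ u : TangentSpace I q, (∀ w : TangentSpace I q,
        mfderiv I 𝓘(ℝ, Vec n) μ q w = 0 → K.g.inner q u w = 0) →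
        ∃ v : Vec n, complexFundamental K q (v, 0) = u := by
      intro u hu
      obtain ⟨⟨v, r⟩, rfl⟩ := (complexFundamental_bijective hs hμ hE hq).2 u
      have h1 := hu (complexFundamental K q (0, r))
        ((hμ.mfderiv_complexFundamental_eq_zero_iff hs hq _).2 rfl)
      rw [inner_complexFundamental hs hμ] at h1
      have hr : r = 0 := by
        by_contra hne
        have h2 := inner_fundamental_pos K hs hq hne
        simp only [map_zero, zero_add] at h1
        exact h2.ne' h1
      exact ⟨v, by rw [hr]⟩
    obtain ⟨u, rfl⟩ := hform u fun w hw => (huv w hw).1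
    obtain ⟨v, rfl⟩ := hform v fun w hw => (huv w hw).2
    refine (hiso q hq u v).trans ?_
    rw [inner_complexFundamental hs hμ]
    simp

section Orbit

variable {φ : Vec n → ℝ → N → N} {p : N} {h : Vec n → Vec n →L[ℝ] Vec n →L[ℝ] ℝ}

theorem IsMomentumMap.hasFDerivAt_flow (hs : IsSmoothTorusAction n I N)
    (hhol : IsHolomorphicAction K n) (hμ : IsMomentumMap K μ) (hE : Module.finrank ℝ E = 2 * n)
    (hφ : ∀ ξ : Vec n, IsFlow (fun q : N => -(K.J q (fundamental I q ξ))) (φ ξ))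
    (hp : p ∈ freeSet n N) (x : Vec n) :
    HasFDerivAt (fun x => μ (φ x 1 p)) (momentumDeriv K μ (φ x 1 p)) x := by
  have hΨ := isCommutingFlow_complexFlow hs hhol hμ hE hφ
  have h1 : HasMFDerivAt 𝓘(ℝ, Vec n) 𝓘(ℝ, Vec n × Vec n) (fun x : Vec n => (x, (0 : Vec n))) x
      (ContinuousLinearMap.inl ℝ (Vec n) (Vec n) :) :=
    (hasFDerivAt_prodMk_left x (0 : Vec n)).hasMFDerivAt
  have h2 := HasMFDerivAt.comp (f := fun x : Vec n => (x, (0 : Vec n))) x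
    (hΨ.hasMFDerivAt hp (x, 0)) h1
  have h3 := ((hμ.hasMFDerivAt (complexFlow φ (x, 0) p)).comp x h2).hasFDerivAt
  have h4 : μ ∘ (fun c => complexFlow φ c p) ∘ (fun x : Vec n => (x, (0 : Vec n)))
      = fun x => μ (φ x 1 p) := by
    funext x
    simp only [Function.comp_apply, complexFlow_mk_zero]
  rw [h4] at h3
  rw [← complexFlow_mk_zero φ x p]
  exact h3

theorem IsMomentumMap.fderiv_flow (hs : IsSmoothTorusAction n I N)
    (hhol : IsHolomorphicAction K n) (hμ : IsMomentumMap K μ) (hE : Module.finrank ℝ E = 2 * n)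
    (hφ : ∀ ξ : Vec n, IsFlow (fun q : N => -(K.J q (fundamental I q ξ))) (φ ξ))
    (hp : p ∈ freeSet n N) (x v : Vec n) :
    fderiv ℝ (fun x => -μ (φ x 1 p)) x v = -momentumDeriv K μ (φ x 1 p) v := by
  rw [(hμ.hasFDerivAt_flow hs hhol hE hφ hp x).fun_neg.fderiv]
  rfl

/-- The link between `μ` and `h`: the derivative of `⟨μ, w⟩` along `-J v_N` is `g(J w_N, -J v_N) =
-g(w_N, v_N)`. -/
theorem IsMomentumMap.isHessian (hs : IsSmoothTorusAction n I N)
    (hhol : IsHolomorphicAction K n) (hμ : IsMomentumMap K μ) (hE : Module.finrank ℝ E = 2 * n)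
    (hφ : ∀ ξ : Vec n, IsFlow (fun q : N => -(K.J q (fundamental I q ξ))) (φ ξ))
    (hp : p ∈ freeSet n N)
    (hh : ∀ x u v : Vec n, h x u v = K.g.inner (φ x 1 p) (fundamental I (φ x 1 p) u)
      (fundamental I (φ x 1 p) v)) :
    IsHessian Set.univ h (fun x => -μ (φ x 1 p)) where
  isOpen := isOpen_univ
  smooth := by
    have hΨ := isCommutingFlow_complexFlow hs hhol hμ hE hφ
    have h1 : ContMDiff 𝓘(ℝ, Vec n) 𝓘(ℝ, Vec n × Vec n) ∞ (fun x : Vec n => (x, (0 : Vec n))) :=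
      ContDiff.contMDiff (by fun_prop)
    have h2 : ContMDiff 𝓘(ℝ, Vec n) 𝓘(ℝ, Vec n) ∞ (fun x : Vec n => μ (complexFlow φ (x, 0) p)) :=
      hμ.smooth.comp ((hΨ.contMDiff hp).comp h1)
    simp only [complexFlow_mk_zero] at h2
    exact h2.contDiff.neg.contDiffOn
  eq x _ u v := by
    rw [hμ.fderiv_flow hs hhol hE hφ hp, hh, inner_neg_left, hμ.inner_momentumDeriv hs, neg_neg]
  symm x _ u v := by rw [hh, hh, K.g.symm]
  pos x _ u hu := by
    rw [hh]
    exact inner_fundamental_pos K hs (flow_mem_freeSet hs hhol hφ x 1 hp) hu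

/-- Invariance of `μ` and injectivity of the Hessian map `-μ (φ x 1 p)` recover `x`; freeness then
recovers the torus component modulo ℤⁿ. -/
theorem complexFlow_eq_iff (hs : IsSmoothTorusAction n I N)
    (hhol : IsHolomorphicAction K n) (hμ : IsMomentumMap K μ) (hE : Module.finrank ℝ E = 2 * n)
    (hφ : ∀ ξ : Vec n, IsFlow (fun q : N => -(K.J q (fundamental I q ξ))) (φ ξ))
    (hp : p ∈ freeSet n N)
    (hh : ∀ x u v : Vec n, h x u v = K.g.inner (φ x 1 p) (fundamental I (φ x 1 p) u)
      (fundamental I (φ x 1 p) v)) (c d : Vec n × Vec n) :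
    complexFlow φ c p = complexFlow φ d p ↔
      c.1 = d.1 ∧ ∃ k : Fin n → ℤ, d.2 = c.2 + ∑ i, (k i : ℝ) • EuclideanSpace.single i 1 := by
  have hlat : (∃ k : Fin n → ℤ, d.2 = c.2 + ∑ i, (k i : ℝ) • EuclideanSpace.single i 1) ↔
      toTorus (d.2 - c.2) = 0 := by
    rw [toTorus_eq_zero_iff]
    refine exists_congr fun k => ?_
    rw [← sub_eq_iff_eq_add']
    constructor
    · intro h1 i
      rw [h1]
      simp [Finset.sum_apply, Pi.single_apply]
    · intro h1
      rw [← sum_smul_single (d.2 - c.2)]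
      simp only [h1]
  rw [hlat]
  constructor
  · intro heq
    have h1 : c.1 = d.1 := by
      apply (hμ.isHessian hs hhol hE hφ hp hh).injective
      have h2 := congrArg μ heq
      simp only [complexFlow, hμ.invariant] at h2
      simp only [h2]
    refine ⟨h1, flow_mem_freeSet hs hhol hφ d.1 1 hp _ ?_⟩
    have h3 : toTorus c.2 +ᵥ φ d.1 1 p = toTorus d.2 +ᵥ φ d.1 1 p := by
      rw [← h1]
      nth_rewrite 2 [h1]
      exact heq
    rw [sub_eq_neg_add, toTorus_add_vadd, ← h3, ← toTorus_add_vadd, neg_add_cancel, toTorus_zero,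
      zero_vadd]
  · rintro ⟨h1, h2⟩
    rw [complexFlow, complexFlow, h1, ← sub_add_cancel d.2 c.2, toTorus_add, h2, zero_add]

/-- This makes the dual connection independent of the choice of momentum map. -/
theorem IsHessian.fderiv_eq {y₁ y₂ : Vec n → Vec n} (h₁ : IsHessian Set.univ h y₁)
    (h₂ : IsHessian Set.univ h y₂) : fderiv ℝ y₁ = fderiv ℝ y₂ := by
  funext x
  ext1 u
  refine ext_inner_right ℝ fun v => ?_
  rw [← h₁.eq x trivial, ← h₂.eq x trivial]

end Orbit

end Momentum

/-! ### The image μ(N°) and its submersion metric. -/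

section Image

variable {n : ℕ} {E : Type*} [NormedAddCommGroup E] [InnerProductSpace ℝ E] [FiniteDimensional ℝ E]
  {H : Type*} [TopologicalSpace H] {I : ModelWithCorners ℝ E H} [I.Boundaryless]
  {N : Type*} [TopologicalSpace N] [T2Space N] [PreconnectedSpace N] [ChartedSpace H N]
  [IsManifold I ∞ N] [AddAction (Torus n) N] [FaithfulVAdd (Torus n) N] {K : KahlerStructure I N}
  {μ : N → Vec n} {φ : Vec n → ℝ → N → N} {p : N} {h : Vec n → Vec n →L[ℝ] Vec n →L[ℝ] ℝ}

theorem IsMomentumMap.image_freeSet (hs : IsSmoothTorusAction n I N)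
    (hhol : IsHolomorphicAction K n) (hμ : IsMomentumMap K μ) (hE : Module.finrank ℝ E = 2 * n)
    (hφ : ∀ ξ : Vec n, IsFlow (fun q : N => -(K.J q (fundamental I q ξ))) (φ ξ))
    (hp : p ∈ freeSet n N) : μ '' freeSet n N = Set.range (fun x => -(-μ (φ x 1 p))) := by
  rw [← range_complexFlow hs hhol hμ hE hφ hp, ← Set.range_comp]
  ext z
  constructor
  · rintro ⟨c, rfl⟩
    exact ⟨c.1, by simp [complexFlow, hμ.invariant]⟩
  · rintro ⟨x, rfl⟩
    exact ⟨(x, 0), by simp [complexFlow_mk_zero]⟩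

theorem IsMomentumMap.isSubmersionMetric_iff_legendre (hs : IsSmoothTorusAction n I N)
    (hhol : IsHolomorphicAction K n) (hsymp : IsSymplecticAction K n) (hμ : IsMomentumMap K μ)
    (hE : Module.finrank ℝ E = 2 * n)
    (hφ : ∀ ξ : Vec n, IsFlow (fun q : N => -(K.J q (fundamental I q ξ))) (φ ξ))
    (hp : p ∈ freeSet n N)
    (hh : ∀ x u v : Vec n, h x u v = K.g.inner (φ x 1 p) (fundamental I (φ x 1 p) u)
      (fundamental I (φ x 1 p) v)) {k : Vec n → Vec n →L[ℝ] Vec n →L[ℝ] ℝ}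
    (hk : IsRiemannianMetric (μ '' freeSet n N) k) :
    IsSubmersionMetric K μ k ↔ ∀ x u v, k (- -μ (φ x 1 p)) (fderiv ℝ (fun x => -μ (φ x 1 p)) x u)
      (fderiv ℝ (fun x => -μ (φ x 1 p)) x v) = h x u v := by
  rw [hμ.isSubmersionMetric_iff hs hE hk]
  have hiso := isIsometricAction_of_isSymplecticAction hsymp hhol
  constructor
  · intro hq x u v
    rw [neg_neg, hμ.fderiv_flow hs hhol hE hφ hp, hμ.fderiv_flow hs hhol hE hφ hp, hh,
      ← hq _ (flow_mem_freeSet hs hhol hφ x 1 hp) u v]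
    simp
  · intro hx q hq u v
    rw [← range_complexFlow hs hhol hμ hE hφ hp] at hq
    obtain ⟨⟨x, r⟩, rfl⟩ := hq
    -- By transitivity every free point is a torus translate of some `φ x 1 p`, and the torus acts
    -- by isometries, so the derivative of `μ` on `-J v_N` depends on `x` only.
    have hd : ∀ v : Vec n, momentumDeriv K μ (complexFlow φ (x, r) p) v
        = -fderiv ℝ (fun x => -μ (φ x 1 p)) x v := by
      intro v
      refine ext_inner_right ℝ fun w => ?_
      rw [hμ.inner_momentumDeriv hs, inner_neg_left,
        ← (hμ.isHessian hs hhol hE hφ hp hh).eq x trivial, hh]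
      exact congrArg Neg.neg (inner_fundamental_vadd hs hiso (toTorus r) (φ x 1 p) v w)
    have h1 : μ (complexFlow φ (x, r) p) = - -μ (φ x 1 p) := by
      rw [neg_neg]; exact hμ.invariant _ _
    rw [hd, hd, h1]
    refine Eq.trans ?_ (inner_fundamental_vadd hs hiso (toTorus r) (φ x 1 p) u v).symm
    rw [← hh, ← hx]
    simp

end Image

/-! ### The torification of ℝⁿ. -/

section Torification

variable {n : ℕ}

theorem isParallelFrame_single (U : Set (Vec n)) :
    IsParallelFrame U flatConnection fun i _ => (EuclideanSpace.single i 1 : Vec n) where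
  smooth _ := contDiffOn_const
  parallel i Y _ x _ := by simp [flatConnection]
  basis x _ := by
    have h1 := (EuclideanSpace.basisFun (Fin n) ℝ).toBasis.linearIndependent
    rw [OrthonormalBasis.coe_toBasis] at h1
    have h2 : ⇑(EuclideanSpace.basisFun (Fin n) ℝ) = fun i => EuclideanSpace.single i 1 :=
      funext fun i => EuclideanSpace.basisFun_apply (Fin n) ℝ i
    rwa [h2] at h1

variable {E : Type*} [NormedAddCommGroup E] [InnerProductSpace ℝ E] [FiniteDimensional ℝ E]
  {H : Type*} [TopologicalSpace H] {I : ModelWithCorners ℝ E H} [I.Boundaryless]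
  {N : Type*} [TopologicalSpace N] [T2Space N] [PreconnectedSpace N] [ChartedSpace H N]
  [IsManifold I ∞ N] [AddAction (Torus n) N] [FaithfulVAdd (Torus n) N] {K : KahlerStructure I N}
  {μ : N → Vec n} {φ : Vec n → ℝ → N → N} {p : N} {h : Vec n → Vec n →L[ℝ] Vec n →L[ℝ] ℝ}

/-- The orbit map of `p` descends to the quotient by ℤⁿ and is the required map. Its derivative
sends `(x, r)` to `-J x_N + r_N`; thus `(-r, x)` goes to `J r_N + x_N = J (-J x_N + r_N)`, and the
metric splits by isotropy. -/
theorem isTorification_flat (hs : IsSmoothTorusAction n I N)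
    (hhol : IsHolomorphicAction K n) (hsymp : IsSymplecticAction K n) (hμ : IsMomentumMap K μ)
    (hE : Module.finrank ℝ E = 2 * n)
    (hφ : ∀ ξ : Vec n, IsFlow (fun q : N => -(K.J q (fundamental I q ξ))) (φ ξ))
    (hp : p ∈ freeSet n N)
    (hh : ∀ x u v : Vec n, h x u v = K.g.inner (φ x 1 p) (fundamental I (φ x 1 p) u)
      (fundamental I (φ x 1 p) v)) :
    IsTorification K Set.univ h flatConnection := by
  have hΨ := isCommutingFlow_complexFlow hs hhol hμ hE hφ
  have hiso := isIsometricAction_of_isSymplecticAction hsymp hhol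
  have heq := complexFlow_eq_iff hs hhol hμ hE hφ hp hh
  have hd : ∀ u A : Vec n × Vec n,
      mfderiv 𝓘(ℝ, Vec n × Vec n) I (fun c => complexFlow φ c p) u A
        = complexFundamental K (complexFlow φ u p) A := fun u A =>
    DFunLike.congr_fun (hΨ.hasMFDerivAt hp u).mfderiv A
  refine ⟨inferInstance, hhol, hiso, fun i _ => EuclideanSpace.single i 1,
    isParallelFrame_single _, Quotient.lift (fun u => complexFlow φ u.1 p)
      fun u v huv => (heq u.1 v.1).2 huv, ?_, ?_, ?_, fun c => complexFlow φ c p, fun u => rfl,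
    ?_, ?_, ?_⟩
  · rintro ⟨u⟩ ⟨v⟩ huv
    exact Quotient.sound ((heq u.1 v.1).1 huv)
  · rw [← range_complexFlow hs hhol hμ hE hφ hp]
    ext z
    constructor
    · rintro ⟨⟨u⟩, rfl⟩
      exact ⟨u.1, rfl⟩
    · rintro ⟨c, rfl⟩
      exact ⟨quotientMap _ _ ⟨c, Set.mem_univ _⟩, rfl⟩
  · intro t u v h1 h2
    show complexFlow φ v.1 p = toTorus t +ᵥ complexFlow φ u.1 p
    rw [sum_smul_single] at h2
    rw [complexFlow, complexFlow, h1, h2, add_comm, toTorus_add_vadd]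
  · exact fun u => hΨ.isLocalDiffeomorphAt hp u.1
  · intro u _ A
    rw [hd, hd, complexFundamental_apply, complexFundamental_apply]
    simp [dombrowskiJ, connector, flatConnection, K.J_sq, add_comm]
  · intro u _ A B
    rw [hd, hd, inner_complexFundamental hs hμ]
    have h1 := fun a b => inner_fundamental_vadd hs hiso (toTorus u.2) (φ u.1 1 p) a b
    refine (congrArg₂ (· + ·) (h1 _ _) (h1 _ _)).trans ?_
    rw [← hh, ← hh]
    simp [dombrowskiMetric, connector, flatConnection]

end Torification

end KahlerToric

theorem theorem7p1 {n : ℕ} {N : Type*} [TopologicalSpace N] [T2Space N]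
    [SecondCountableTopology N] [ConnectedSpace N]
    [ChartedSpace (EuclideanSpace ℝ (Fin (2 * n))) N] [IsManifold (𝓡 (2 * n)) ∞ N]
    (K : KahlerStructure (𝓡 (2 * n)) N)
    [AddAction (Torus n) N] (hsmooth : IsSmoothTorusAction n (𝓡 (2 * n)) N)
    (heff : FaithfulVAdd (Torus n) N)
    (hham : IsHamiltonianAction K n)
    (hhol : IsHolomorphicAction K n)
    (φ : Vec n → ℝ → N → N)
    (hφ : ∀ ξ : Vec n, IsFlow (fun q : N => -(K.J q (fundamental (𝓡 (2 * n)) q ξ))) (φ ξ))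
    (p : N) (hp : p ∈ freeSet n N)
    (h : Vec n → Vec n →L[ℝ] Vec n →L[ℝ] ℝ)
    (hh : ∀ x u v : Vec n, h x u v =
      K.g.inner (φ x 1 p) (fundamental (𝓡 (2 * n)) (φ x 1 p) u)
        (fundamental (𝓡 (2 * n)) (φ x 1 p) v)) :
    ∃ Dstar : (Vec n → Vec n) → (Vec n → Vec n) → (Vec n → Vec n),
      -- (1)
      IsDuallyFlat Set.univ h flatConnection Dstar ∧
      -- (2)
      IsTorification K Set.univ h flatConnection ∧
      -- (3)
      ∀ μ : N → Vec n, IsMomentumMap K μ →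
        (∃ k Dk, IsCanonicalStructure K μ k Dk) ∧
        (∀ k k', IsSubmersionMetric K μ k → IsSubmersionMetric K μ k' →
          ∀ z ∈ μ '' freeSet n N, k z = k' z) ∧
        (CompactSpace N →
          ¬ ∃ C : Vec n, C ≠ 0 ∧ (fun z => z + C) '' (μ '' freeSet n N) = μ '' freeSet n N) ∧
        ∀ k Dk, IsCanonicalStructure K μ k Dk →
          (∃ y : Vec n → Vec n,
            IsDualCoordinatePair Set.univ h flatConnection Dstar id y ∧
            IsDuallyFlatIso Set.univ h flatConnection Dstar
              (μ '' freeSet n N) k Dk flatConnection (fun x => -y x)) ∧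
          ((¬ ∃ C : Vec n, C ≠ 0 ∧
              (fun z => z + C) '' (μ '' freeSet n N) = μ '' freeSet n N) →
            ∀ y₁ y₂ : Vec n → Vec n,
              IsDualCoordinatePair Set.univ h flatConnection Dstar id y₁ →
              IsDuallyFlatIso Set.univ h flatConnection Dstar
                (μ '' freeSet n N) k Dk flatConnection (fun x => -y₁ x) →
              IsDualCoordinatePair Set.univ h flatConnection Dstar id y₂ →
              IsDuallyFlatIso Set.univ h flatConnection Dstar
                (μ '' freeSet n N) k Dk flatConnection (fun x => -y₂ x) →
              y₁ = y₂) := by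
  have hE : Module.finrank ℝ (EuclideanSpace ℝ (Fin (2 * n))) = 2 * n := by simp
  obtain ⟨hsymp, μ₀, hμ₀⟩ := hham
  have H₀ := hμ₀.isHessian hsmooth hhol hE hφ hp hh
  -- The dual connection is fixed before `μ`, so it is built from an auxiliary momentum map `μ₀`;
  -- `hDual` identifies it with the one from `μ`.
  refine ⟨hessianDual fun x => -μ₀ (φ x 1 p), H₀.isDuallyFlat,
    isTorification_flat hsmooth hhol hsymp hμ₀ hE hφ hp hh, fun μ hμ => ?_⟩
  have H := hμ.isHessian hsmooth hhol hE hφ hp hh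
  have hDual : hessianDual (fun x => -μ₀ (φ x 1 p)) = hessianDual fun x => -μ (φ x 1 p) := by
    unfold hessianDual
    rw [H₀.fderiv_eq H]
  have himg := hμ.image_freeSet hsmooth hhol hE hφ hp
  have hleg : ∀ k, IsRiemannianMetric (μ '' freeSet n N) k → (IsSubmersionMetric K μ k ↔ _) :=
    fun k hk => hμ.isSubmersionMetric_iff_legendre hsmooth hhol hsymp hE hφ hp hh hk
  rw [hDual]
  refine ⟨?_, ?_, ?_, ?_⟩
  · obtain ⟨-, ψ, hψ, hl⟩ := H.exists_inverse_neg
    obtain ⟨k, hk⟩ := H.exists_legendre_metric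
    have hD := (H.legendre hk hψ hl).isDualistic_swap
    rw [← himg] at hD
    exact ⟨k, _, (hleg k hD.metric).2 hk, hD⟩
  · intro k k' hk hk' z hz
    have e := (hleg k hk.metric).1 hk
    have e' := (hleg k' hk'.metric).1 hk'
    rw [himg] at hz
    obtain ⟨x, rfl⟩ := hz
    ext u v
    rw [← H.apply_inverse (Set.mem_univ x) u, ← H.apply_inverse (Set.mem_univ x) v]
    exact (e x _ _).trans (e' x _ _).symm
  · intro _
    refine not_translation_invariant_of_isBounded ?_ ⟨_, p, hp, rfl⟩
    exact (isCompact_range hμ.smooth.continuous).isBounded.subset (Set.image_subset_range _ _)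
  · intro k Dk hk
    refine ⟨⟨fun x => -μ (φ x 1 p), H.isDualCoordinatePair, ?_⟩, ?_⟩
    · rw [himg]
      refine H.isDuallyFlatIso ((hleg k hk.submersion.metric).1 hk.submersion) ?_
      rw [← himg]
      exact hk.dualistic
    · intro hC y₁ y₂ h₁ i₁ h₂ i₂
      obtain ⟨C, hy⟩ := h₁.exists_add_const H.isRiemannianMetric h₂
      have hC0 : C = 0 := by
        by_contra hne
        -- Both `-y₁` and `-y₂` have image μ(N°), and `-y₁ = -y₂ - C`.
        refine hC ⟨-C, neg_ne_zero.2 hne, ?_⟩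
        conv_lhs => rw [← i₂.diffeo.image_eq]
        conv_rhs => rw [← i₁.diffeo.image_eq]
        rw [Set.image_image]
        refine Set.image_congr fun x _ => ?_
        rw [hy]
        abel
      funext x
      rw [hy, hC0, add_zero]
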